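/- Let $k$ be a field, $S=k[x_1,\dots,x_n]$ with the degree-lexicographic order ($x_1\succ\dots\succ x_n$), and let $f_1,\dots,f_s\in S$ be the reduced Gröbner basis of the ideal $\mathfrak a=\langle f_1,\dots,f_s\rangle$. Write $x^{\gamma_j}$ for the leading monomial of $f_j$, and assume that the initial ideal $\langle x^{\gamma_1},\dots,x^{\gamma_s}\rangle$ is a complete intersection (i.e. it is generated by a regular sequence). Put $A=S/\mathfrak a$, regarded as a module over $A\otimes_k A^{\mathrm{op}}$ by $(a\otimes b)c=acb$. Put $T(x_i)=x_i\otimes 1-1\otimes x_i$ and, for $g=\sum_\alpha g_\alpha x^\alpha\in S$, $$\frac{T_p(g)}{T(x_p)}=\sum_{\alpha}g_\alpha\sum_{j=0}^{\alpha_p-1}x_1^{\alpha_1}\cdots x_{p-1}^{\alpha_{p-1}}x_p^{j}\otimes x_p^{\alpha_p-1-j}x_{p+1}^{\alpha_{p+1}}\cdots x_n^{\alpha_n}\in A\otimes A^{\mathrm{op}}.$$ Let $F_i$ be the free $A\otimes A^{\mathrm{op}}$-module on the symbols $e_{i_r}\cdots e_{i_1}t_{j_1}^{(l_1)}\cdots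 t_{j_q}^{(l_q)}$ with $1\le i_1<\dots<i_r\le n$, $1\le j_1<\dots<j_q\le s$, $l_1,\dots,l_q\ge 1$ and $i=r+2\sum_m l_m$. Let $F=\bigoplus_i F_i$ have the $A\otimes A^{\mathrm{op}}$-bilinear product determined by $e_ie_j=-e_je_i$, $e_i^2=0$, $t_j^{(0)}=1$, $t_j^{(a)}t_j^{(b)}=\binom{a+b}{a}t_j^{(a+b)}$ (the $t$'s being central), and the $A\otimes A^{\mathrm{op}}$-linear map $\partial$ given by $$\partial(e_{i_r}\cdots e_{i_1})=\sum_{m=1}^r(-1)^{\#\{j:\,i_j>i_m\}}T(x_{i_m})\,e_{i_r}\cdots\widehat{e_{i_m}}\cdots e_{i_1},$$ $$\partial(t_{j_1}^{(l_1)}\cdots t_{j_q}^{(l_q)})=\sum_{m=1}^q\sum_{p=1}^n\frac{T_p(f_{j_m})}{T(x_p)}\,e_p\,t_{j_1}^{(l_1)}\cdots t_{j_m}^{(l_m-1)}\cdots t_{j_q}^{(l_q)},$$ $$\partial(e_{i_r}\cdots e_{i_1}t_{j_1}^{(l_1)}\cdots t_{j_q}^{(l_q)})=\partial(e_{i_r}\cdots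 e_{i_1})\,t_{j_1}^{(l_1)}\cdots t_{j_q}^{(l_q)}+(-1)^r e_{i_r}\cdots e_{i_1}\,\partial(t_{j_1}^{(l_1)}\cdots t_{j_q}^{(l_q)}).$$ Then: 1. $(F_\bullet,\partial)$, with the augmentation $F_0=A\otimes A^{\mathrm{op}}\to A$, $a\otimes b\mapsto ab$, is a free resolution of $A$ as an $A\otimes A^{\mathrm{op}}$-module. 2. $F$ is a (strictly graded-commutative, associative, unital) differential graded algebra. 3. $F_\bullet$ is multigraded: let $M$ be a commutative monoid and let $w_1,\dots,w_n\in M$ be degrees of the variables for which every $f_j$ is homogeneous (for example $M=\mathbb N^n$ with the standard multidegrees if the $f_j$ are monomials, $M=\mathbb N$ with all $w_i=1$ if they are homogeneous polynomials, $M=0$ always). Give $e_i$ the degree $w_i$ and $t_j^{(l)}$ the degree $l\cdot w(\gamma_j)$, where $w(\gamma)=\sum_i\gamma_iw_i$. Then $A$ and $F$ are the direct sums of their homogeneous parts, and the module structure, $\partial$, the augmentation and the product respect the $M$-degrees. 4. Suppose that no $f_j$ has a constant term. Then $F_\bullet$ is minimal, in the sense that $\partial(F)\subseteq\mathfrak mF$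 for the ideal $\mathfrak m$ generated by all $x_i\otimes1$ and $1\otimes x_i$, if and only if no $f_j$ has a term of degree one. 5. Suppose that no $f_j$ has a term of degree $\le 1$, and let $M$, $w$ be as in 3. Let $HH_i(A,k)$ be the Hochschild homology of $A$ with coefficients in $k=A/\langle x_1,\dots,x_n\rangle$ (the homology of $k\otimes_{A\otimes A^{\mathrm{op}}}A^{\otimes(\bullet+2)}$, with the $M$-grading induced by that of $A$). Each $HH_i(A,k)_\mu$ is finite-dimensional, and in $\mathbb Z[M][[t]]$, with $x^\mu$ denoting the basis element of $\mathbb Z[M]$ belonging to $\mu\in M$, $$\sum_{i,\mu}\dim_k HH_i(A,k)_\mu\,x^\mu t^i=\frac{\prod_{i=1}^n(1+x^{w_i}t)}{\prod_{j=1}^s(1-x^{w(\gamma_j)}t^2)}.$$ -/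

import Mathlib

open MvPolynomial
open scoped TensorProduct

namespace BachResolution

/-! ### Reduced Groebner bases for the degree-lexicographic order and complete intersections -/

section Groebner

variable {k : Type*} [Field k] {n s : ℕ}

/-- The exponent `γ` of the leading monomial of `g` for the degree-lexicographic order,
where the variables are ordered by `x₁ > x₂ > ⋯ > xₙ`. -/
noncomputable def leadExp (g : MvPolynomial (Fin n) k) : Fin n →₀ ℕ :=
  MonomialOrder.degLex.degree g

/-- The initial ideal of `I`: the ideal generated by the leading monomials of the nonzero
elements of `I`. -/
noncomputable def initialIdeal (I : Ideal (MvPolynomial (Fin n) k)) :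
    Ideal (MvPolynomial (Fin n) k) :=
  Ideal.span {m | ∃ g ∈ I, g ≠ 0 ∧ m = monomial (leadExp g) 1}

/-- `f` is the reduced Groebner basis of the ideal which it generates: the leading coefficients
are `1`, the leading monomials generate the initial ideal, and no leading monomial divides a
monomial occurring in another member of the family. -/
structure IsReducedGroebnerBasis (f : Fin s → MvPolynomial (Fin n) k) : Prop where
  monic : ∀ j, coeff (leadExp (f j)) (f j) = 1
  span_lead : Ideal.span (Set.range fun j => monomial (leadExp (f j)) (1 : k)) =
    initialIdeal (Ideal.span (Set.range f))
  reduced : ∀ i j, i ≠ j → ∀ α ∈ (f i).support, ¬ leadExp (f j) ≤ α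

/-- An ideal is a complete intersection if it is generated by a regular sequence. -/
def IsCompleteIntersection {S : Type*} [CommRing S] (I : Ideal S) : Prop :=
  ∃ rs : List S, RingTheory.Sequence.IsRegular S rs ∧ Ideal.ofList rs = I

end Groebner

/-! ### General notions: resolutions and differential graded algebras

A chain complex is given as one module `F` with submodules `𝓕 i` (the part of homological degree
`i`) and an endomorphism `d`, so that a product on `F` can be discussed as well. -/

section General

variable {R F : Type*} [CommRing R] [AddCommGroup F] [Module R F]

/-- `(𝓕, d)` together with the augmentation `aug` is a resolution of `N` by free `R`-modules. -/
structure IsFreeResolution {N : Type*} [AddCommGroup N] [Module R N]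
    (𝓕 : ℕ → Submodule R F) (d : F →ₗ[R] F) (aug : F →ₗ[R] N) : Prop where
  free : ∀ i, Module.Free R (𝓕 i)
  d_mem : ∀ i, ∀ x ∈ 𝓕 (i + 1), d x ∈ 𝓕 i
  d_d : ∀ x, d (d x) = 0
  exact : ∀ i, ∀ x ∈ 𝓕 (i + 1), d x = 0 → ∃ y ∈ 𝓕 (i + 2), d y = x
  aug_surjective : ∀ a : N, ∃ x ∈ 𝓕 0, aug x = a
  aug_exact : ∀ x ∈ 𝓕 0, aug x = 0 ↔ ∃ y ∈ 𝓕 1, d y = x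

/-- `F = ⨁ 𝓕 i` with differential `d`, product `mul` and unit `one` is a (strictly
graded-commutative, associative, unital) differential graded `R`-algebra. -/
structure IsDGAlgebra (𝓕 : ℕ → Submodule R F) (d : F →ₗ[R] F)
    (mul : F →ₗ[R] F →ₗ[R] F) (one : F) : Prop where
  independent : iSupIndep 𝓕
  iSup_eq_top : ⨆ i, 𝓕 i = ⊤
  one_mem : one ∈ 𝓕 0
  mul_mem : ∀ i j, ∀ x ∈ 𝓕 i, ∀ y ∈ 𝓕 j, mul x y ∈ 𝓕 (i + j)
  mul_assoc : ∀ x y z, mul (mul x y) z = mul x (mul y z)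
  one_mul : ∀ x, mul one x = x
  mul_one : ∀ x, mul x one = x
  graded_comm : ∀ i j, ∀ x ∈ 𝓕 i, ∀ y ∈ 𝓕 j, mul x y = (-1 : R) ^ (i * j) • mul y x
  sq_zero : ∀ i, Odd i → ∀ x ∈ 𝓕 i, mul x x = 0
  d_mem : ∀ i, ∀ x ∈ 𝓕 (i + 1), d x ∈ 𝓕 i
  d_zero : ∀ x ∈ 𝓕 0, d x = 0
  d_d : ∀ x, d (d x) = 0
  leibniz : ∀ i, ∀ x ∈ 𝓕 i, ∀ y, d (mul x y) = mul (d x) y + (-1 : R) ^ i • mul x (d y)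

end General

/-! ### The algebra `A = k[x₁, ..., xₙ] / ⟨f₁, ..., f_s⟩` and its enveloping algebra -/

section Enveloping

variable (k A : Type*) [Field k] [CommRing A] [Algebra k A]

/-- The enveloping algebra `A ⊗ Aᵒᵖ` of `A`. -/
def Env : Type _ := A ⊗[k] Aᵐᵒᵖ

noncomputable instance : CommRing (Env k A) := inferInstanceAs (CommRing (A ⊗[k] Aᵐᵒᵖ))

noncomputable instance : Algebra k (Env k A) := inferInstanceAs (Algebra k (A ⊗[k] Aᵐᵒᵖ))

/-- `A` as a module over `A ⊗ Aᵒᵖ`, via `(a ⊗ b) • c = a c b`. -/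
noncomputable instance : Module (Env k A) A :=
  (TensorProduct.Algebra.module : Module (A ⊗[k] Aᵐᵒᵖ) A)

variable {A}

/-- The element `a ⊗ b` of the enveloping algebra. -/
def Env.tmul (a b : A) : Env k A := a ⊗ₜ[k] MulOpposite.op b

theorem Env.tmul_smul (a b c : A) : Env.tmul k a b • c = a * c * b := by
  have h : Env.tmul k a b • c = AlgHom.mulLeftRight k A (a ⊗ₜ[k] MulOpposite.op b) c := rfl
  rw [h, AlgHom.mulLeftRight_apply, MulOpposite.unop_op]

theorem Env.tmul_mul_tmul (a b a' b' : A) :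
    Env.tmul k a b * Env.tmul k a' b' = Env.tmul k (a * a') (b' * b) :=
  (Algebra.TensorProduct.tmul_mul_tmul (R := k) a a' (MulOpposite.op b) (MulOpposite.op b')).trans
    (by rw [← MulOpposite.op_mul]; rfl)

theorem Env.one_def : (1 : Env k A) = Env.tmul k 1 1 := rfl

end Enveloping

section Algebra

variable {k : Type*} [Field k] {n s : ℕ}

/-- `A = k[x₁, ..., xₙ] / ⟨f₁, ..., f_s⟩`. -/
def Alg (f : Fin s → MvPolynomial (Fin n) k) : Type _ :=
  MvPolynomial (Fin n) k ⧸ Ideal.span (Set.range f)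

variable (f : Fin s → MvPolynomial (Fin n) k)

noncomputable instance : CommRing (Alg f) :=
  inferInstanceAs (CommRing (MvPolynomial (Fin n) k ⧸ Ideal.span (Set.range f)))

noncomputable instance : Algebra k (Alg f) :=
  inferInstanceAs (Algebra k (MvPolynomial (Fin n) k ⧸ Ideal.span (Set.range f)))

/-- The quotient map `k[x₁, ..., xₙ] → A`. -/
noncomputable def cls : MvPolynomial (Fin n) k →ₐ[k] Alg f :=
  Ideal.Quotient.mkₐ k (Ideal.span (Set.range f))

/-- `T(xᵢ) = xᵢ ⊗ 1 - 1 ⊗ xᵢ`. -/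
noncomputable def T (i : Fin n) : Env k (Alg f) :=
  Env.tmul k (cls f (X i)) 1 - Env.tmul k 1 (cls f (X i))

/-- The difference quotient `T_p(g) / T(x_p)`. -/
noncomputable def diffQuot (p : Fin n) (g : MvPolynomial (Fin n) k) : Env k (Alg f) :=
  ∑ α ∈ g.support, coeff α g • ∑ j ∈ Finset.range (α p),
    Env.tmul k (cls f ((∏ i ∈ Finset.Iio p, X i ^ α i) * X p ^ j))
      (cls f (X p ^ (α p - 1 - j) * ∏ i ∈ Finset.Ioi p, X i ^ α i))

/-- The augmentation ideal of `A ⊗ Aᵒᵖ`, generated by the elements `xᵢ ⊗ 1` and `1 ⊗ xᵢ`. -/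
noncomputable def augIdeal : Ideal (Env k (Alg f)) :=
  Ideal.span (Set.range (fun i => Env.tmul k (cls f (X i)) 1) ∪
    Set.range (fun i => Env.tmul k 1 (cls f (X i))))

end Algebra

/-! ### The graded algebra on the generators `e_I t^{(l)}` -/

section Generators

/-- The index set of the generators: the pair `(I, l)` stands for
`e_{i_r} ⋯ e_{i_1} t_1^{(l 1)} ⋯ t_s^{(l s)}` where `I = {i_1 < ⋯ < i_r}`
(factors `t_j^{(0)} = 1` are allowed here). -/
abbrev Cell (n s : ℕ) : Type := Finset (Fin n) × (Fin s → ℕ)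

/-- The homological degree `r + 2 ∑ l_j`. -/
def Cell.degree {n s : ℕ} (c : Cell n s) : ℕ := c.1.card + 2 * ∑ j, c.2 j

/-- The free `R`-module on all generators. -/
abbrev Total (R : Type*) [CommRing R] (n s : ℕ) : Type _ := Cell n s →₀ R

variable (R : Type*) [CommRing R] {n s : ℕ}

/-- The generator belonging to `(I, l)`. -/
noncomputable def gen (I : Finset (Fin n)) (l : Fin s → ℕ) : Total R n s :=
  Finsupp.single (I, l) 1

/-- `F_i`: the free submodule on the generators of homological degree `i`. -/
noncomputable def part (i : ℕ) : Submodule R (Total R n s) :=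
  Finsupp.supported R R {c | c.degree = i}

/-- The product of two generators: the `e_i` anticommute and have square zero, and
`t_j^{(a)} t_j^{(b)} = (a + b choose a) t_j^{(a + b)}`.  As the `e`'s are written in decreasing
order, the sign counts the pairs `(a, b)` in `I × J` with `a < b`. -/
noncomputable def mulCell (c c' : Cell n s) : Total R n s :=
  if Disjoint c.1 c'.1 then
    ((-1 : R) ^ ((c.1 ×ˢ c'.1).filter fun q => q.1 < q.2).card *
      ((∏ j, (c.2 j + c'.2 j).choose (c.2 j) : ℕ) : R)) • gen R (c.1 ∪ c'.1) (c.2 + c'.2)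
  else 0

/-- The product, extended bilinearly from the generators. -/
noncomputable def mul : Total R n s →ₗ[R] Total R n s →ₗ[R] Total R n s :=
  Finsupp.linearCombination R fun c => Finsupp.linearCombination R fun c' => mulCell R c c'

end Generators

/-! ### The complex -/

section Complex

variable {k : Type*} [Field k] {n s : ℕ} (f : Fin s → MvPolynomial (Fin n) k)

/-- The free `A ⊗ Aᵒᵖ`-module `F = ⨁ F_i` on all generators. -/
abbrev Res : Type _ := Total (Env k (Alg f)) n s

/-- `∂(e_{i_r} ⋯ e_{i_1}) = ∑ₘ (-1)^{#{i_j > i_m}} T(x_{i_m}) e_{i_r} ⋯ ê_{i_m} ⋯ e_{i_1}`. -/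
noncomputable def dExt (I : Finset (Fin n)) : Res f :=
  ∑ i ∈ I, ((-1 : Env k (Alg f)) ^ (I.filter fun j => i < j).card * T f i) • gen _ (I.erase i) 0

/-- `∂(t_{j_1}^{(l_1)} ⋯ t_{j_q}^{(l_q)}) =
∑ₘ ∑ₚ (T_p(f_{j_m}) / T(x_p)) e_p t_{j_1}^{(l_1)} ⋯ t_{j_m}^{(l_m - 1)} ⋯ t_{j_q}^{(l_q)}`,
where `m` runs over the indices with `l_m > 0`. -/
noncomputable def dDiv (l : Fin s → ℕ) : Res f :=
  ∑ m ∈ Finset.univ.filter (fun m => 0 < l m), ∑ p : Fin n,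
    diffQuot f p (f m) • gen _ {p} (Function.update l m (l m - 1))

/-- The differential: `∂(e_I t^{(l)}) = ∂(e_I) t^{(l)} + (-1)^{|I|} e_I ∂(t^{(l)})`. -/
noncomputable def diff : Res f →ₗ[Env k (Alg f)] Res f :=
  Finsupp.linearCombination (Env k (Alg f)) fun c =>
    mul _ (dExt f c.1) (gen _ ∅ c.2) +
      (-1 : Env k (Alg f)) ^ c.1.card • mul _ (gen _ c.1 0) (dDiv f c.2)

/-- The augmentation `F_0 = A ⊗ Aᵒᵖ → A`, `a ⊗ b ↦ a b`, extended by zero to the generators of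
positive degree. -/
noncomputable def aug : Res f →ₗ[Env k (Alg f)] Alg f :=
  Finsupp.linearCombination (Env k (Alg f)) fun c => if c = (∅, 0) then 1 else 0

/-- Minimality: the differential has no constant terms, that is, `∂(F) ⊆ 𝔪 F`
for the augmentation ideal `𝔪` of `A ⊗ Aᵒᵖ`. -/
def IsMinimal : Prop :=
  ∀ x, diff f x ∈ augIdeal f • (⊤ : Submodule (Env k (Alg f)) (Res f))

end Complex

/-! ### Multigradings

`w i` is the degree of the variable `x_i` in a commutative monoid `M`. -/

section Grading

variable {k : Type*} [Field k] {n s : ℕ} {M : Type*} [AddCommMonoid M]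
  (f : Fin s → MvPolynomial (Fin n) k) (w : Fin n → M)

/-- The homogeneous part `A_μ` of `A`. -/
noncomputable def algPart (μ : M) : Submodule k (Alg f) :=
  (weightedHomogeneousSubmodule k w μ).map (cls f).toLinearMap

/-- The homogeneous part of degree `μ` of `A ⊗ Aᵒᵖ`, spanned by the products
`A_{μ₁} ⊗ A_{μ₂}` with `μ₁ + μ₂ = μ`. -/
noncomputable def envPart (μ : M) : Submodule k (Env k (Alg f)) :=
  Submodule.span k {r | ∃ μ₁ μ₂ : M, μ₁ + μ₂ = μ ∧ ∃ a ∈ algPart f w μ₁, ∃ b ∈ algPart f w μ₂,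
    r = Env.tmul k a b}

/-- The degree of the generator `e_I t^{(l)}`: `e_i` has the degree of `x_i`, and `t_j^{(l)}`
has `l` times the degree of the leading monomial of `f_j`. -/
noncomputable def cellWeight (c : Cell n s) : M :=
  ∑ i ∈ c.1, w i + ∑ j, c.2 j • Finsupp.weight w (leadExp (f j))

/-- The homogeneous part of degree `μ` of the free module on the generators. -/
noncomputable def resPart (μ : M) : Submodule k (Res f) :=
  Submodule.span k {x | ∃ (c : Cell n s) (ν : M), ν + cellWeight f w c = μ ∧
    ∃ r ∈ envPart f w ν, x = Finsupp.single c r}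

/-- The complex is a complex of `M`-graded modules (and an `M`-graded algebra): `A` and `F` are
the direct sums of their homogeneous parts, and the module structure, the differential, the
augmentation and the product are compatible with the degrees. -/
structure IsMultigraded : Prop where
  alg_independent : iSupIndep (algPart f w)
  alg_iSup : ⨆ μ, algPart f w μ = ⊤
  res_independent : iSupIndep (resPart f w)
  res_iSup : ⨆ μ, resPart f w μ = ⊤
  smul_mem : ∀ ν μ, ∀ r ∈ envPart f w ν, ∀ x ∈ resPart f w μ, r • x ∈ resPart f w (ν + μ)
  diff_mem : ∀ μ, ∀ x ∈ resPart f w μ, diff f x ∈ resPart f w μ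
  aug_mem : ∀ μ, ∀ x ∈ resPart f w μ, aug f x ∈ algPart f w μ
  mul_mem : ∀ μ ν, ∀ x ∈ resPart f w μ, ∀ y ∈ resPart f w ν, mul _ x y ∈ resPart f w (μ + ν)

end Grading

/-! ### Hochschild homology with coefficients in `k`

For a `k`-algebra `B` with augmentation `ε : B → k`, the tensor product over `B ⊗ Bᵒᵖ` of `k` with
the acyclic Hochschild complex `B^{⊗ (i + 2)}` is the complex `B^{⊗ i}` with
`∂[a₁|⋯|aᵢ] = ε(a₁)[a₂|⋯|aᵢ] + ∑ⱼ (-1)^j [a₁|⋯|aⱼaⱼ₊₁|⋯|aᵢ] + (-1)^i ε(aᵢ)[a₁|⋯|aᵢ₋₁]`. -/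

section Hochschild

variable {k B : Type*} [Field k] [CommRing B] [Algebra k B] (ε : B →ₐ[k] k)

/-- The chains, that is, `B^{⊗ i}`. -/
abbrev HChain (k B : Type*) [Field k] [CommRing B] [Algebra k B] (i : ℕ) : Type _ :=
  ⨂[k] _ : Fin i, B

theorem contractNth_update {i : ℕ} (j : Fin i) (a : Fin (i + 1) → B) (m : Fin (i + 1)) :
    ∃ (l : Fin i) (c : B), ∀ x, j.castSucc.contractNth (· * ·) (Function.update a m x) =
      Function.update (j.castSucc.contractNth (· * ·) a) l (c * x) := by
  refine ⟨j.predAbove m, if m = j.castSucc then a j.succ else if m = j.succ then a j.castSucc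
    else 1, fun x => ?_⟩
  ext l
  simp only [Fin.contractNth, Function.update_apply, Fin.predAbove, Fin.ext_iff, Fin.lt_def,
    Fin.val_castSucc, Fin.val_succ]
  have hj := j.2
  have hm := m.2
  have hl := l.2
  split_ifs <;> simp_all <;> first
    | (exfalso; omega)
    | (obtain rfl : l = j := Fin.ext (by assumption)
       ring)

/-- The inner face `[a₁|⋯|aᵢ₊₁] ↦ [a₁|⋯|aⱼaⱼ₊₁|⋯|aᵢ₊₁]`. -/
noncomputable def innerFace (k B : Type*) [Field k] [CommRing B] [Algebra k B] {i : ℕ}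
    (j : Fin i) : HChain k B (i + 1) →ₗ[k] HChain k B i :=
  PiTensorProduct.lift
    { toFun := fun a => PiTensorProduct.tprod k (j.castSucc.contractNth (· * ·) a)
      map_update_add' := by
        intro inst a m x y
        obtain rfl : inst = instDecidableEqFin _ := Subsingleton.elim _ _
        obtain ⟨l, c, h⟩ := contractNth_update j a m
        rw [h, h, h, mul_add, MultilinearMap.map_update_add]
      map_update_smul' := by
        intro inst a m t x
        obtain rfl : inst = instDecidableEqFin _ := Subsingleton.elim _ _
        obtain ⟨l, c, h⟩ := contractNth_update j a m
        rw [h, h, mul_smul_comm, MultilinearMap.map_update_smul] }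

/-- The first face `[a₁|⋯|aᵢ₊₁] ↦ ε(a₁) [a₂|⋯|aᵢ₊₁]`. -/
noncomputable def firstFace (i : ℕ) : HChain k B (i + 1) →ₗ[k] HChain k B i :=
  PiTensorProduct.lift
    { toFun := fun a => ε (a 0) • PiTensorProduct.tprod k (Fin.tail a)
      map_update_add' := by
        intro inst a m x y
        obtain rfl : inst = instDecidableEqFin _ := Subsingleton.elim _ _
        cases m using Fin.cases <;>
          simp [Fin.tail_update_zero, Fin.tail_update_succ, add_smul,
            Function.update_of_ne (Fin.succ_ne_zero _).symm]
      map_update_smul' := by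
        intro inst a m t x
        obtain rfl : inst = instDecidableEqFin _ := Subsingleton.elim _ _
        cases m using Fin.cases <;>
          simp [Fin.tail_update_zero, Fin.tail_update_succ, mul_smul, smul_comm t,
            Function.update_of_ne (Fin.succ_ne_zero _).symm] }

/-- The last face `[a₁|⋯|aᵢ₊₁] ↦ ε(aᵢ₊₁) [a₁|⋯|aᵢ]`. -/
noncomputable def lastFace (i : ℕ) : HChain k B (i + 1) →ₗ[k] HChain k B i :=
  PiTensorProduct.lift
    { toFun := fun a => ε (a (Fin.last i)) • PiTensorProduct.tprod k (Fin.init a)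
      map_update_add' := by
        intro inst a m x y
        obtain rfl : inst = instDecidableEqFin _ := Subsingleton.elim _ _
        cases m using Fin.lastCases <;>
          simp [Fin.init_update_last, Fin.init_update_castSucc, add_smul,
            Function.update_of_ne (Fin.castSucc_lt_last _).ne']
      map_update_smul' := by
        intro inst a m t x
        obtain rfl : inst = instDecidableEqFin _ := Subsingleton.elim _ _
        cases m using Fin.lastCases <;>
          simp [Fin.init_update_last, Fin.init_update_castSucc, mul_smul, smul_comm t,
            Function.update_of_ne (Fin.castSucc_lt_last _).ne'] }

/-- The differential `B^{⊗ (i + 1)} → B^{⊗ i}`. -/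
noncomputable def hDiff (i : ℕ) : HChain k B (i + 1) →ₗ[k] HChain k B i :=
  firstFace ε i + ∑ j : Fin i, (-1 : k) ^ ((j : ℕ) + 1) • innerFace k B j +
    (-1 : k) ^ (i + 1) • lastFace ε i

/-- The cycles in `B^{⊗ i}`. -/
noncomputable def hCycles : (i : ℕ) → Submodule k (HChain k B i)
  | 0 => ⊤
  | i + 1 => LinearMap.ker (hDiff ε i)

variable {M : Type*} [AddCommMonoid M] (𝒜 : M → Submodule k B)

/-- The homogeneous part of degree `μ` of `B^{⊗ i}`, for a grading `𝒜` of `B`. -/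
noncomputable def hPart (i : ℕ) (μ : M) : Submodule k (HChain k B i) :=
  Submodule.span k {x | ∃ (a : Fin i → B) (ν : Fin i → M), (∀ l, a l ∈ 𝒜 (ν l)) ∧
    ∑ l, ν l = μ ∧ x = PiTensorProduct.tprod k a}

/-- The homogeneous cycles of degree `μ`. -/
noncomputable def hCyclesPart (i : ℕ) (μ : M) : Submodule k (HChain k B i) :=
  hCycles ε i ⊓ hPart 𝒜 i μ

/-- The Hochschild homology `HH_i(B, k)_μ` in homological degree `i` and degree `μ`:
homogeneous cycles of degree `μ` modulo the boundaries of homogeneous chains of degree `μ`. -/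
abbrev HH (i : ℕ) (μ : M) : Type _ :=
  hCyclesPart ε 𝒜 i μ ⧸ ((hPart 𝒜 (i + 1) μ).map (hDiff ε i)).submoduleOf (hCyclesPart ε 𝒜 i μ)

end Hochschild

section HilbertSeries

variable {k : Type*} [Field k] {n s : ℕ} (f : Fin s → MvPolynomial (Fin n) k)

/-- The augmentation `A → k`, `xᵢ ↦ 0`, which exists if the `f_j` have no constant terms; it
makes `k` a module over `A`. -/
noncomputable def augmentation (h : ∀ j, constantCoeff (f j) = 0) : Alg f →ₐ[k] k :=
  Ideal.Quotient.liftₐ (Ideal.span (Set.range f)) (aeval fun _ => (0 : k)) (by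
    intro g hg
    have hle : Ideal.span (Set.range f) ≤
        RingHom.ker (aeval fun _ => (0 : k) : MvPolynomial (Fin n) k →ₐ[k] k) := by
      rw [Ideal.span_le]
      rintro _ ⟨j, rfl⟩
      have := h j
      simpa [RingHom.mem_ker, aeval_zero'] using this
    exact hle hg)

open PowerSeries in
/-- The (multigraded) Hilbert series of `HH(A, k)` is the power series
`∏ᵢ (1 + x^{w i} t) / ∏ⱼ (1 - x^{γⱼ} t²)` in `ℤ[M]⟦t⟧`; here `x^μ` denotes the basis element of
the monoid ring `ℤ[M]` belonging to `μ`, and the (invertible) denominator is multiplied out. -/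
def HasHilbertSeries {M : Type*} [AddCommMonoid M] (w : Fin n → M)
    (h : ∀ j, constantCoeff (f j) = 0) : Prop :=
  (∀ (i : ℕ) (μ : M), Module.Finite k (HH (augmentation f h) (algPart f w) i μ)) ∧
  ∃ H : PowerSeries (AddMonoidAlgebra ℤ M),
    (∀ (i : ℕ) (μ : M), (PowerSeries.coeff i H).coeff μ =
      Module.finrank k (HH (augmentation f h) (algPart f w) i μ)) ∧
    H * ∏ j, (1 - PowerSeries.C (AddMonoidAlgebra.single (Finsupp.weight w (leadExp (f j))) 1) *
      PowerSeries.X ^ 2) =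
    ∏ i, (1 + PowerSeries.C (AddMonoidAlgebra.single (w i) 1) * PowerSeries.X)

end HilbertSeries

end BachResolution

open BachResolution

namespace BachResolution

/-! ### Derivations and multiplications on the algebra of cells; the square of the Tate
differential. -/

section Operators

variable {R : Type*} [CommRing R] {n s : ℕ}

/-! Let τ and g be regular sequences in a commutative ring R with g_j = ∑ₚ a_jp τ_p. Over R/(g),
Tate's algebra on exterior variables e_i and divided powers of t_j, with ∂e_i = τ_i and ∂t_j = ∑ₚ
a_jp e_p, is exact in positive degrees (`tate_exact_quotient`). Both resolutions needed below are
instances of this.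

The proof of exactness stays over R, where ∂ = ∑ τ_i ∂/∂e_i + ∑ a_jp e_p ∂/∂t_j is not a
differential but has square ∑ g_j ∂/∂t_j (`tateD_tateD`), and works modulo initial segments of g.
With no t at all this is the exactness of the Koszul complex (`koszul_exact`). Killing one more g
creates new homology in positive degrees only in degree one, generated by z = ∑ₚ a_p e_p; adjoining
the divided powers of the corresponding t removes it (`exactBelow_succ`).

For the resolution of A, take R = A[x], with quotient A ⊗ Aᵒᵖ = A[x]/(f_j(x)) and τ_i = x̄_i − x_i,
where x̄_i is the class of x_i in A. The difference quotients telescope to f_j(x̄) − f_j(x) =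
−f_j(x), so g_j = −f_j(x). A change of coordinates shows that τ is regular. That g is regular uses
the hypothesis on the initial ideal in two steps. If a minimally generated ideal is also generated
by a regular sequence, syzygies of the minimal generators have coefficients in the ideal; applied to
the syzygy of two leading monomials, divided by their gcd, this makes the leading monomials pairwise
coprime (`leadExp_inf_eq_zero`). Monic polynomials with coprime leading monomials form a regular
sequence over every coefficient ring, by division with remainder (`isRegularFamily_of_coprime`).

The algebra structure rests on ∂/∂e_i and ∂/∂t_j being (signed) derivations. Degrees lie in a monoid
which need not be cancellative, so directness of the decompositions is proved by coactions such as A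
→ A[M]. Minimality is read off from ∂t_j: the coefficient of e_p reduces to the coefficient of x_p
in f_j.

The Hochschild complex of the statement is k ⊗_A (bar resolution of k over A), so it computes
Tor^A(k, k). The exactness theorem with R = k[x], τ = x, g = f gives a second free resolution of k
over A, whose reduction has zero differential if the f_j have no linear terms. A graded comparison
theorem (`GradedResolution.nonempty_homology_equiv`) identifies HH_i in degree μ with the span of
the cells of degree i and weight μ (`nonempty_HH_equiv`), and counting cells gives the product
formula. -/

theorem Total.hom_ext {N : Type*} [AddCommGroup N] [Module R N] {f g : Total R n s →ₗ[R] N}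
    (h : ∀ I l, f (gen R I l) = g (gen R I l)) : f = g := by
  refine Finsupp.lhom_ext' fun c => LinearMap.ext_ring ?_
  exact h c.1 c.2

theorem linearCombination_gen {N : Type*} [AddCommGroup N] [Module R N] (v : Cell n s → N)
    (I : Finset (Fin n)) (l : Fin s → ℕ) :
    Finsupp.linearCombination R v (gen R I l) = v (I, l) := by
  simp [gen]

theorem single_eq_smul_gen (c : Cell n s) (r : R) :
    (Finsupp.single c r : Total R n s) = r • gen R c.1 c.2 := by
  simp [gen]

variable (R) in
/-- The sign `(-1)^{#{j ∈ I : i < j}}`. -/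
def sgn (i : Fin n) (I : Finset (Fin n)) : R := (-1) ^ (I.filter fun j => i < j).card

theorem sgn_mul_self (i : Fin n) (I : Finset (Fin n)) : sgn R i I * sgn R i I = 1 := by
  rw [sgn, ← mul_pow]; simp

theorem sgn_insert (i m : Fin n) (I : Finset (Fin n)) (h : m ∉ I) :
    sgn R i (insert m I) = (if i < m then -1 else 1) * sgn R i I := by
  unfold sgn
  rw [Finset.filter_insert]
  split_ifs with h'
  · rw [Finset.card_insert_of_notMem (by simp [h]), pow_succ]; ring
  · simp

theorem sgn_erase (i m : Fin n) (I : Finset (Fin n)) (h : m ∈ I) :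
    sgn R i (I.erase m) = (if i < m then -1 else 1) * sgn R i I := by
  conv_rhs => rw [← Finset.insert_erase h]
  rw [sgn_insert _ _ _ (Finset.notMem_erase m I)]
  split_ifs <;> ring

variable (R s) in
/-- The left derivation `∂ / ∂ e_i`. -/
noncomputable def dE (i : Fin n) : Total R n s →ₗ[R] Total R n s :=
  Finsupp.linearCombination R fun c =>
    if i ∈ c.1 then sgn R i c.1 • gen R (c.1.erase i) c.2 else 0

variable (R s) in
/-- Left multiplication by `e_p`. -/
noncomputable def lE (p : Fin n) : Total R n s →ₗ[R] Total R n s :=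
  Finsupp.linearCombination R fun c =>
    if p ∈ c.1 then 0 else sgn R p c.1 • gen R (insert p c.1) c.2

variable (R n) in
/-- The derivation `∂ / ∂ t_j`, lowering the exponent of the divided power `t_j^{(l)}`. -/
noncomputable def dT (j : Fin s) : Total R n s →ₗ[R] Total R n s :=
  Finsupp.linearCombination R fun c =>
    if c.2 j = 0 then 0 else gen R c.1 (Function.update c.2 j (c.2 j - 1))

variable (R n) in
/-- The shift `t_j^{(l)} ↦ t_j^{(l + 1)}`. -/
noncomputable def sT (j : Fin s) : Total R n s →ₗ[R] Total R n s :=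
  Finsupp.linearCombination R fun c => gen R c.1 (Function.update c.2 j (c.2 j + 1))

theorem dE_gen (i : Fin n) (I : Finset (Fin n)) (l : Fin s → ℕ) :
    dE R s i (gen R I l) = if i ∈ I then sgn R i I • gen R (I.erase i) l else 0 :=
  linearCombination_gen _ _ _

theorem lE_gen (p : Fin n) (I : Finset (Fin n)) (l : Fin s → ℕ) :
    lE R s p (gen R I l) = if p ∈ I then 0 else sgn R p I • gen R (insert p I) l :=
  linearCombination_gen _ _ _

theorem dT_gen (j : Fin s) (I : Finset (Fin n)) (l : Fin s → ℕ) :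
    dT R n j (gen R I l) = if l j = 0 then 0 else gen R I (Function.update l j (l j - 1)) :=
  linearCombination_gen _ _ _

theorem sT_gen (j : Fin s) (I : Finset (Fin n)) (l : Fin s → ℕ) :
    sT R n j (gen R I l) = gen R I (Function.update l j (l j + 1)) :=
  linearCombination_gen _ _ _

theorem dE_dE_self (i : Fin n) (x : Total R n s) : dE R s i (dE R s i x) = 0 := by
  suffices h : dE R s i ∘ₗ dE R s i = 0 from LinearMap.congr_fun h x
  refine Total.hom_ext fun I l => ?_
  by_cases h : i ∈ I <;> simp [dE_gen, h]

theorem dE_dE (i j : Fin n) (x : Total R n s) :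
    dE R s i (dE R s j x) = - dE R s j (dE R s i x) := by
  rcases eq_or_ne i j with rfl | hij
  · simp [dE_dE_self]
  suffices h : dE R s i ∘ₗ dE R s j = - dE R s j ∘ₗ dE R s i from LinearMap.congr_fun h x
  refine Total.hom_ext fun I l => ?_
  by_cases hi : i ∈ I <;> by_cases hj : j ∈ I <;>
    simp [dE_gen, hi, hj, hij, hij.symm, sgn_erase, smul_smul, Finset.erase_right_comm (a := i)]
  rw [← neg_smul]
  rcases lt_or_gt_of_ne hij with h | h <;> simp [h, h.not_gt, mul_comm]

theorem lE_lE_self (i : Fin n) (x : Total R n s) : lE R s i (lE R s i x) = 0 := by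
  suffices h : lE R s i ∘ₗ lE R s i = 0 from LinearMap.congr_fun h x
  refine Total.hom_ext fun I l => ?_
  by_cases h : i ∈ I <;> simp [lE_gen, h]

theorem lE_lE (i j : Fin n) (x : Total R n s) :
    lE R s i (lE R s j x) = - lE R s j (lE R s i x) := by
  rcases eq_or_ne i j with rfl | hij
  · simp [lE_lE_self]
  suffices h : lE R s i ∘ₗ lE R s j = - lE R s j ∘ₗ lE R s i from LinearMap.congr_fun h x
  refine Total.hom_ext fun I l => ?_
  by_cases hi : i ∈ I <;> by_cases hj : j ∈ I <;>
    simp [lE_gen, hi, hj, hij, hij.symm, sgn_insert, smul_smul, Finset.insert_comm i]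
  rw [← neg_smul]
  rcases lt_or_gt_of_ne hij with h | h <;> simp [h, h.not_gt, mul_comm]

theorem dE_lE_self (i : Fin n) (x : Total R n s) :
    dE R s i (lE R s i x) = x - lE R s i (dE R s i x) := by
  suffices h : dE R s i ∘ₗ lE R s i = LinearMap.id - lE R s i ∘ₗ dE R s i from
    LinearMap.congr_fun h x
  refine Total.hom_ext fun I l => ?_
  by_cases hi : i ∈ I <;>
    simp [lE_gen, dE_gen, hi, sgn_insert, sgn_erase, smul_smul, sgn_mul_self]

theorem dE_lE (i p : Fin n) (hip : i ≠ p) (x : Total R n s) :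
    dE R s i (lE R s p x) = - lE R s p (dE R s i x) := by
  suffices h : dE R s i ∘ₗ lE R s p = - lE R s p ∘ₗ dE R s i from
    LinearMap.congr_fun h x
  refine Total.hom_ext fun I l => ?_
  by_cases hi : i ∈ I <;> by_cases hp : p ∈ I <;>
    simp [lE_gen, dE_gen, hi, hp, hip, hip.symm, sgn_insert, sgn_erase, smul_smul]
  rw [← neg_smul, Finset.erase_insert_of_ne hip.symm]
  rcases lt_or_gt_of_ne hip with h | h <;> simp [h, h.not_gt, mul_comm]

theorem dT_dE (j : Fin s) (i : Fin n) (x : Total R n s) :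
    dT R n j (dE R s i x) = dE R s i (dT R n j x) := by
  suffices h : dT R n j ∘ₗ dE R s i = dE R s i ∘ₗ dT R n j from LinearMap.congr_fun h x
  refine Total.hom_ext fun I l => ?_
  by_cases hi : i ∈ I <;> by_cases hj : l j = 0 <;> simp [dE_gen, dT_gen, hi, hj]

theorem dT_lE (j : Fin s) (i : Fin n) (x : Total R n s) :
    dT R n j (lE R s i x) = lE R s i (dT R n j x) := by
  suffices h : dT R n j ∘ₗ lE R s i = lE R s i ∘ₗ dT R n j from LinearMap.congr_fun h x
  refine Total.hom_ext fun I l => ?_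
  by_cases hi : i ∈ I <;> by_cases hj : l j = 0 <;> simp [lE_gen, dT_gen, hi, hj]

theorem dT_dT (j m : Fin s) (x : Total R n s) :
    dT R n j (dT R n m x) = dT R n m (dT R n j x) := by
  rcases eq_or_ne j m with rfl | hjm
  · rfl
  suffices h : dT R n j ∘ₗ dT R n m = dT R n m ∘ₗ dT R n j from LinearMap.congr_fun h x
  refine Total.hom_ext fun I l => ?_
  by_cases hi : l m = 0 <;> by_cases hj : l j = 0 <;>
    simp [dT_gen, hi, hj, hjm, hjm.symm, Function.update_comm hjm]

theorem dT_sT (j : Fin s) (x : Total R n s) : dT R n j (sT R n j x) = x := by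
  suffices h : dT R n j ∘ₗ sT R n j = LinearMap.id from LinearMap.congr_fun h x
  refine Total.hom_ext fun I l => ?_
  simp [dT_gen, sT_gen]

theorem sT_dT_gen (j : Fin s) (I : Finset (Fin n)) (l : Fin s → ℕ) :
    sT R n j (dT R n j (gen R I l)) = if l j = 0 then 0 else gen R I l := by
  rw [dT_gen]
  split_ifs with h
  · simp
  · rw [sT_gen, Function.update_idem, Function.update_self, Nat.sub_add_cancel (by omega)]
    simp

theorem lE_dE_gen (i : Fin n) (I : Finset (Fin n)) (l : Fin s → ℕ) :
    lE R s i (dE R s i (gen R I l)) = if i ∈ I then gen R I l else 0 := by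
  rw [dE_gen]
  split_ifs with h
  · simp [lE_gen, sgn_erase, h, smul_smul, sgn_mul_self]
  · simp

/-- The differential of the Koszul–Tate complex on elements `τ i` and on cycles
`∑ₚ a j p • e_p`. -/
noncomputable def tateD (τ : Fin n → R) (a : Fin s → Fin n → R) : Total R n s →ₗ[R] Total R n s :=
  ∑ i, τ i • dE R s i + ∑ j, ∑ p, a j p • (lE R s p ∘ₗ dT R n j)

theorem tateD_apply (τ : Fin n → R) (a : Fin s → Fin n → R) (x : Total R n s) :
    tateD τ a x = ∑ i, τ i • dE R s i x + ∑ j, ∑ p, a j p • lE R s p (dT R n j x) := by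
  simp [tateD, LinearMap.sum_apply]

variable {τ : Fin n → R} {a : Fin s → Fin n → R}

theorem dT_tateD (j : Fin s) (x : Total R n s) :
    dT R n j (tateD τ a x) = tateD τ a (dT R n j x) := by
  simp [tateD_apply, map_sum, dT_dE, dT_lE, dT_dT j]

theorem dE_tateD (i : Fin n) (x : Total R n s) :
    dE R s i (tateD τ a x) = - tateD τ a (dE R s i x) + ∑ j, a j i • dT R n j x := by
  have h : ∀ p y, dE R s i (lE R s p y) = - lE R s p (dE R s i y) + if p = i then y else 0 := by
    intro p y
    split_ifs with h
    · subst h; rw [dE_lE_self]; abel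
    · rw [dE_lE i p (Ne.symm h), add_zero]
  simp [tateD_apply, map_sum, dE_dE i, h, dT_dE, smul_add, Finset.sum_add_distrib]
  abel

theorem tateD_lE (i : Fin n) (x : Total R n s) :
    tateD τ a (lE R s i x) = τ i • x - lE R s i (tateD τ a x) := by
  have h : ∀ p y, dE R s p (lE R s i y) = - lE R s i (dE R s p y) + if p = i then y else 0 := by
    intro p y
    split_ifs with h
    · subst h; rw [dE_lE_self]; abel
    · rw [dE_lE p i h, add_zero]
  simp [tateD_apply, map_sum, lE_lE i, h, dT_lE, smul_add, Finset.sum_add_distrib]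
  simp only [lE_lE _ i, smul_neg, Finset.sum_neg_distrib]
  abel

/-- Off-diagonal terms cancel under the swap. The diagonal needs its own hypothesis, since
antisymmetry only gives 2 B(i, i) = 0. -/
theorem sum_sum_eq_zero_of_alternating {ι N : Type*} [Fintype ι] [AddCommGroup N]
    (B : ι → ι → N) (h₁ : ∀ i, B i i = 0) (h₂ : ∀ i j, B i j = - B j i) :
    ∑ i, ∑ j, B i j = 0 := by
  classical
  rw [← Finset.sum_product', Finset.univ_product_univ]
  refine Finset.sum_involution (fun q _ => q.swap) (fun q _ => ?_) (fun q _ hq hs => ?_)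
    (fun q _ => Finset.mem_univ _) (fun q _ => q.swap_swap)
  · rw [Prod.fst_swap, Prod.snd_swap, h₂]; simp
  · obtain ⟨i, j⟩ := q
    obtain rfl : j = i := congrArg Prod.fst hs
    exact hq (h₁ _)

/-- The ∂/∂e_i anticommute, so do the multiplications by e_p, and the ∂/∂t_j commute with all of
them. The two pure parts of the square therefore cancel by alternation, and the mixed part consists
of the anticommutators of ∂/∂e_i and e_p, which are δ_ip. -/
theorem tateD_tateD (x : Total R n s) :
    tateD τ a (tateD τ a x) = ∑ j, (∑ p, a j p * τ p) • dT R n j x := by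
  have hEE : ∑ i, ∑ i', (τ i * τ i') • dE R s i (dE R s i' x) = 0 :=
    sum_sum_eq_zero_of_alternating _ (fun i => by rw [dE_dE_self, smul_zero])
      (fun i j => by rw [dE_dE i j, smul_neg, mul_comm])
  have hLL : ∑ u : Fin s × Fin n, ∑ v : Fin s × Fin n, (a u.1 u.2 * a v.1 v.2) •
      lE R s u.2 (lE R s v.2 (dT R n u.1 (dT R n v.1 x))) = 0 :=
    sum_sum_eq_zero_of_alternating _ (fun u => by rw [lE_lE_self, smul_zero])
      (fun u v => by rw [lE_lE u.2 v.2, smul_neg, mul_comm, dT_dT u.1])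
  simp only [Fintype.sum_prod_type] at hLL
  have hL : tateD τ a (tateD τ a x) = ∑ i, τ i • dE R s i (tateD τ a x) +
      ∑ j, ∑ p, a j p • lE R s p (tateD τ a (dT R n j x)) := by
    conv_lhs => rw [tateD_apply]
    simp only [dT_tateD]
  have h1 : ∀ i, τ i • dE R s i (tateD τ a x) = ∑ i', (τ i * τ i') • dE R s i (dE R s i' x) +
      ∑ j, ∑ p, (τ i * a j p) • dE R s i (lE R s p (dT R n j x)) := fun i => by
    simp [tateD_apply, map_sum, smul_add, Finset.smul_sum, smul_smul]
  have h2 : ∀ j p, a j p • lE R s p (tateD τ a (dT R n j x)) =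
      ∑ i, (τ i * a j p) • lE R s p (dE R s i (dT R n j x)) +
      ∑ m, ∑ q, (a j p * a m q) • lE R s p (lE R s q (dT R n j (dT R n m x))) := fun j p => by
    simp [tateD_apply, map_sum, smul_add, Finset.smul_sum, smul_smul, mul_comm, dT_dT j]
  have h3 : ∀ i p (y : Total R n s), dE R s i (lE R s p y) + lE R s p (dE R s i y) = if p = i then y else 0 := by
    intro i p y
    split_ifs with h
    · subst h; rw [dE_lE_self]; abel
    · rw [dE_lE i p (Ne.symm h)]; abel
  rw [hL]
  simp only [h1, h2, Finset.sum_add_distrib, hEE, hLL, zero_add, add_zero]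
  rw [Finset.sum_comm, ← Finset.sum_add_distrib]
  refine Finset.sum_congr rfl fun j _ => ?_
  rw [Finset.sum_comm, ← Finset.sum_add_distrib, Finset.sum_smul]
  refine Finset.sum_congr rfl fun p _ => ?_
  rw [← Finset.sum_add_distrib]
  simp only [← smul_add, h3]
  simp [mul_comm]

end Operators

/-! ### Homological degrees of neighbouring cells. -/

section Degrees

variable {n s : ℕ}

theorem sum_update_add (l : Fin s → ℕ) (j : Fin s) (v : ℕ) :
    ∑ i, Function.update l j v i + l j = ∑ i, l i + v := by
  rw [Finset.sum_update_of_mem (Finset.mem_univ j),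
    ← Finset.add_sum_erase _ _ (Finset.mem_univ j), Finset.sdiff_singleton_eq_erase]
  ring

theorem Cell.degree_erase {I : Finset (Fin n)} {i : Fin n} (l : Fin s → ℕ) (h : i ∈ I) :
    Cell.degree (I.erase i, l) + 1 = Cell.degree (I, l) := by
  have := Finset.card_erase_add_one h
  simp only [Cell.degree]; omega

theorem Cell.degree_insert {I : Finset (Fin n)} {i : Fin n} (l : Fin s → ℕ) (h : i ∉ I) :
    Cell.degree (insert i I, l) = Cell.degree (I, l) + 1 := by
  have := Finset.card_insert_of_notMem h
  simp only [Cell.degree]; omega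

theorem Cell.degree_pred (I : Finset (Fin n)) {l : Fin s → ℕ} {j : Fin s} (h : l j ≠ 0) :
    Cell.degree (I, Function.update l j (l j - 1)) + 2 = Cell.degree (I, l) := by
  have := sum_update_add l j (l j - 1)
  simp only [Cell.degree]; omega

theorem Cell.degree_succ (I : Finset (Fin n)) (l : Fin s → ℕ) (j : Fin s) :
    Cell.degree (I, Function.update l j (l j + 1)) = Cell.degree (I, l) + 2 := by
  have := sum_update_add l j (l j + 1)
  simp only [Cell.degree]; omega

theorem Cell.degree_eq_zero {c : Cell n s} : c.degree = 0 ↔ c = (∅, 0) := by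
  obtain ⟨I, l⟩ := c
  simp [Cell.degree, funext_iff]

end Degrees

/-! ### Submodules cut out by sets of cells or by ideals of coefficients. -/

section Supports

variable {R : Type*} [CommRing R] {n s : ℕ}

theorem gen_mem_supported {I : Finset (Fin n)} {l : Fin s → ℕ} {S : Set (Cell n s)}
    (h : (I, l) ∈ S) : gen R I l ∈ Finsupp.supported R R S :=
  Finsupp.single_mem_supported R _ h

theorem map_mem_of_gen {N : Type*} [AddCommGroup N] [Module R N] {S : Set (Cell n s)}
    {P : Submodule R N} {f : Total R n s →ₗ[R] N}
    (h : ∀ c ∈ S, f (gen R c.1 c.2) ∈ P) {x : Total R n s}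
    (hx : x ∈ Finsupp.supported R R S) : f x ∈ P := by
  rw [Finsupp.supported_eq_span_single] at hx
  have : Submodule.span R ((fun c : Cell n s => Finsupp.single c (1 : R)) '' S) ≤ P.comap f := by
    rw [Submodule.span_le]
    rintro _ ⟨c, hc, rfl⟩
    exact h c hc
  exact this hx

theorem dE_mem {S S' : Set (Cell n s)} {i : Fin n}
    (h : ∀ c ∈ S, i ∈ c.1 → (c.1.erase i, c.2) ∈ S') {x : Total R n s}
    (hx : x ∈ Finsupp.supported R R S) : dE R s i x ∈ Finsupp.supported R R S' := by
  refine map_mem_of_gen (fun c hc => ?_) hx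
  rw [dE_gen]
  split_ifs with hi
  · exact Submodule.smul_mem _ _ (gen_mem_supported (h c hc hi))
  · exact zero_mem _

theorem lE_mem {S S' : Set (Cell n s)} {i : Fin n}
    (h : ∀ c ∈ S, i ∉ c.1 → (insert i c.1, c.2) ∈ S') {x : Total R n s}
    (hx : x ∈ Finsupp.supported R R S) : lE R s i x ∈ Finsupp.supported R R S' := by
  refine map_mem_of_gen (fun c hc => ?_) hx
  rw [lE_gen]
  split_ifs with hi
  · exact zero_mem _
  · exact Submodule.smul_mem _ _ (gen_mem_supported (h c hc hi))

theorem dT_mem {S S' : Set (Cell n s)} {j : Fin s}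
    (h : ∀ c ∈ S, c.2 j ≠ 0 → (c.1, Function.update c.2 j (c.2 j - 1)) ∈ S') {x : Total R n s}
    (hx : x ∈ Finsupp.supported R R S) : dT R n j x ∈ Finsupp.supported R R S' := by
  refine map_mem_of_gen (fun c hc => ?_) hx
  rw [dT_gen]
  split_ifs with hi
  · exact zero_mem _
  · exact gen_mem_supported (h c hc hi)

theorem sT_mem {S S' : Set (Cell n s)} {j : Fin s}
    (h : ∀ c ∈ S, (c.1, Function.update c.2 j (c.2 j + 1)) ∈ S') {x : Total R n s}
    (hx : x ∈ Finsupp.supported R R S) : sT R n j x ∈ Finsupp.supported R R S' := by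
  refine map_mem_of_gen (fun c hc => ?_) hx
  rw [sT_gen]
  exact gen_mem_supported (h c hc)

variable {τ : Fin n → R} {a : Fin s → Fin n → R}

theorem tateD_mem {S S' : Set (Cell n s)}
    (h₁ : ∀ c ∈ S, ∀ i ∈ c.1, (c.1.erase i, c.2) ∈ S')
    (h₂ : ∀ c ∈ S, ∀ j, c.2 j ≠ 0 → ∀ p ∉ c.1,
      (insert p c.1, Function.update c.2 j (c.2 j - 1)) ∈ S') {x : Total R n s}
    (hx : x ∈ Finsupp.supported R R S) : tateD τ a x ∈ Finsupp.supported R R S' := by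
  rw [tateD_apply]
  refine Submodule.add_mem _ (Submodule.sum_mem _ fun i _ => Submodule.smul_mem _ _
    (dE_mem (fun c hc hi => h₁ c hc i hi) hx)) (Submodule.sum_mem _ fun j _ =>
    Submodule.sum_mem _ fun p _ => Submodule.smul_mem _ _ ?_)
  refine lE_mem (S := {c | ∃ c' ∈ S, c'.2 j ≠ 0 ∧
    c = (c'.1, Function.update c'.2 j (c'.2 j - 1))}) ?_
    (dT_mem (fun c hc hj => Set.mem_ofPred.2 ⟨c, hc, hj, rfl⟩) hx)
  rintro _ ⟨c, hc, hj, rfl⟩ hp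
  exact h₂ c hc j hj p hp

theorem tateD_part {i : ℕ} {x : Total R n s} (hx : x ∈ part R (i + 1)) :
    tateD τ a x ∈ part R i := by
  refine tateD_mem (fun c (hc : c.degree = i + 1) m hm => ?_)
    (fun c (hc : c.degree = i + 1) j hj p hp => ?_) hx
  · have : Cell.degree (c.1.erase m, c.2) + 1 = Cell.degree c := Cell.degree_erase c.2 hm
    change Cell.degree (c.1.erase m, c.2) = i
    omega
  · have h1 := Cell.degree_insert (Function.update c.2 j (c.2 j - 1)) hp
    have h2 : _ = Cell.degree c := Cell.degree_pred c.1 hj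
    change Cell.degree _ = i
    omega

theorem eq_smul_gen_of_mem_part_zero {x : Total R n s} (hx : x ∈ part R 0) :
    x = x (∅, 0) • gen R ∅ 0 := by
  ext c
  by_cases hc : c = (∅, 0)
  · subst hc; simp [gen]
  · rw [Finsupp.smul_apply, gen, Finsupp.single_eq_of_ne hc, smul_zero]
    by_contra h
    exact hc (Cell.degree_eq_zero.1 (hx (Finsupp.mem_support_iff.2 h)))

theorem tateD_gen_empty (r : R) : tateD τ a (r • gen R (∅ : Finset (Fin n)) (0 : Fin s → ℕ)) = 0 := by
  simp [tateD_apply, dE_gen, dT_gen]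

theorem tateD_part_zero {x : Total R n s} (hx : x ∈ part R 0) : tateD τ a x = 0 := by
  rw [eq_smul_gen_of_mem_part_zero hx, tateD_gen_empty]

theorem tateD_gen_singleton (i : Fin n) :
    tateD τ a (gen R {i} (0 : Fin s → ℕ)) = τ i • gen R ∅ 0 := by
  rw [tateD_apply, Finset.sum_eq_single i]
  · simp [dE_gen, dT_gen, sgn, Finset.filter_singleton]
  · intro b _ hb; simp [dE_gen, hb]
  · simp

theorem tateD_gen_t (j : Fin s) :
    tateD τ a (gen R (∅ : Finset (Fin n)) (Function.update 0 j 1)) =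
      ∑ p, a j p • gen R {p} 0 := by
  rw [tateD_apply, Finset.sum_eq_zero (fun i _ => by simp [dE_gen]), zero_add,
    Finset.sum_eq_single j]
  · simp [dT_gen, lE_gen, sgn]
  · intro b _ hb; simp [dT_gen, hb]
  · simp

/-- The elements all of whose coefficients lie in the ideal `J`. -/
def coeffIn (J : Ideal R) : Submodule R (Total R n s) where
  carrier := {x | ∀ c, x c ∈ J}
  add_mem' hx hy c := J.add_mem (hx c) (hy c)
  zero_mem' _ := J.zero_mem
  smul_mem' r _ hx c := J.mul_mem_left r (hx c)

theorem smul_mem_coeffIn {J : Ideal R} {r : R} (hr : r ∈ J) (x : Total R n s) :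
    r • x ∈ coeffIn J := fun c => J.mul_mem_right (x c) hr

theorem map_mem_coeffIn {J : Ideal R} (f : Total R n s →ₗ[R] Total R n s) {x : Total R n s}
    (hx : x ∈ coeffIn J) : f x ∈ coeffIn J := by
  rw [← Finsupp.sum_single x, map_finsuppSum]
  refine Submodule.sum_mem _ fun c _ => ?_
  simp only [single_eq_smul_gen, map_smul]
  exact smul_mem_coeffIn (hx c) _

theorem coeffIn_mono {J J' : Ideal R} (h : J ≤ J') :
    (coeffIn J : Submodule R (Total R n s)) ≤ coeffIn J' := fun _ hx c => h (hx c)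

/-- Turns a congruence modulo J + (g) into a division by g modulo J. The quotient is chosen cell by
cell, and is zero where x is zero, so that it stays in the same span of cells. -/
theorem exists_sub_smul_mem_coeffIn {J : Ideal R} {g : R} {S : Set (Cell n s)} {x : Total R n s}
    (hx : x ∈ Finsupp.supported R R S) (h : x ∈ coeffIn (J ⊔ Ideal.span {g})) :
    ∃ v ∈ Finsupp.supported R R S, x - g • v ∈ coeffIn J := by
  have h' : ∀ c, ∃ r : R, x c - g * r ∈ J := fun c => by
    obtain ⟨y, hy, z, hz, hyz⟩ := Submodule.mem_sup.1 (h c)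
    obtain ⟨r, rfl⟩ := Ideal.mem_span_singleton'.1 hz
    exact ⟨r, by rw [← hyz, mul_comm g]; simpa using hy⟩
  choose r hr using h'
  classical
  refine ⟨Finsupp.onFinset x.support (fun c => if x c = 0 then 0 else r c) (fun c => by
    simp +contextual), fun c hc => hx ?_, fun c => ?_⟩
  · simp only [Finset.mem_coe, Finsupp.mem_support_iff, Finsupp.onFinset_apply] at hc ⊢
    exact fun h0 => hc (if_pos h0)
  · by_cases hc : x c = 0
    · simp [hc]
    · simpa [hc] using hr c

end Supports

/-! ### Exactness of the Koszul complex of a regular sequence. -/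

section Koszul

variable {R : Type*} [CommRing R] {n s : ℕ} {τ : Fin n → R} {a : Fin s → Fin n → R}

/-- The cells of degree `q` in the exterior algebra on the `e_i` with `i < m`. -/
def koszulCells (n s m q : ℕ) : Set (Cell n s) :=
  {c | c.degree = q ∧ c.2 = 0 ∧ ∀ i ∈ c.1, (i : ℕ) < m}

theorem lE_koszulCells {m q : ℕ} (hm : m < n) {x : Total R n s}
    (hx : x ∈ Finsupp.supported R R (koszulCells n s m q)) :
    lE R s ⟨m, hm⟩ x ∈ Finsupp.supported R R (koszulCells n s (m + 1) (q + 1)) := by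
  refine lE_mem (fun c hc hi => ?_) hx
  obtain ⟨h1, h2, h3⟩ := hc
  have h4 : _ = Cell.degree c + 1 := Cell.degree_insert c.2 hi
  refine ⟨by omega, h2, fun i hi' => ?_⟩
  rcases Finset.mem_insert.1 hi' with rfl | hi'
  · exact Nat.lt_succ_self m
  · exact Nat.lt_succ_of_lt (h3 i hi')

theorem koszulCells_mono (m q : ℕ) :
    Finsupp.supported R R (koszulCells n s m q) ≤
      Finsupp.supported R R (koszulCells n s (m + 1) q) :=
  Finsupp.supported_mono fun _ hc => ⟨hc.1, hc.2.1, fun i hi => Nat.lt_succ_of_lt (hc.2.2 i hi)⟩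

theorem dE_koszulCells {m q : ℕ} (hm : m < n) {x : Total R n s}
    (hx : x ∈ Finsupp.supported R R (koszulCells n s (m + 1) (q + 1))) :
    dE R s ⟨m, hm⟩ x ∈ Finsupp.supported R R (koszulCells n s m q) := by
  refine dE_mem (fun c hc hi => ?_) hx
  obtain ⟨h1, h2, h3⟩ := hc
  have : _ = Cell.degree c := Cell.degree_erase c.2 hi
  refine ⟨by omega, h2, fun i' hi' => lt_of_le_of_ne (Nat.le_of_lt_succ
    (h3 i' (Finset.mem_of_mem_erase hi'))) fun h => Finset.ne_of_mem_erase hi' (Fin.ext h)⟩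

theorem sub_lE_dE_koszulCells {m q : ℕ} (hm : m < n) {x : Total R n s}
    (hx : x ∈ Finsupp.supported R R (koszulCells n s (m + 1) q)) :
    x - lE R s ⟨m, hm⟩ (dE R s ⟨m, hm⟩ x) ∈ Finsupp.supported R R (koszulCells n s m q) := by
  refine map_mem_of_gen (f := LinearMap.id - lE R s ⟨m, hm⟩ ∘ₗ dE R s ⟨m, hm⟩)
    (fun c hc => ?_) hx
  obtain ⟨h1, h2, h3⟩ := hc
  simp only [LinearMap.sub_apply, LinearMap.id_apply, LinearMap.comp_apply, lE_dE_gen]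
  split_ifs with h
  · simp
  · rw [sub_zero]
    exact gen_mem_supported ⟨h1, h2, fun i hi => lt_of_le_of_ne (Nat.le_of_lt_succ (h3 i hi))
      fun h' => h (by convert hi; exact h'.symm)⟩

theorem koszulCells_le_part (m q : ℕ) :
    Finsupp.supported R R (koszulCells n s m q) ≤ part R q :=
  Finsupp.supported_mono fun _ hc => hc.1

theorem tateD_koszulCells_one {m : ℕ} {x : Total R n s}
    (hx : x ∈ Finsupp.supported R R (koszulCells n s m 1)) :
    tateD τ a x (∅, 0) ∈ Ideal.span (τ '' {i | (i : ℕ) < m}) := by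
  refine map_mem_of_gen (f := Finsupp.lapply (∅, 0) ∘ₗ tateD τ a)
    (P := Ideal.span (τ '' {i | (i : ℕ) < m})) (fun c hc => ?_) hx
  obtain ⟨I, l⟩ := c
  obtain ⟨h1, h2, h3⟩ := hc
  simp only at h2 h3
  subst h2
  have hI : I.card = 1 := by simpa [Cell.degree] using h1
  obtain ⟨i, rfl⟩ := Finset.card_eq_one.1 hI
  simp only [LinearMap.comp_apply, tateD_gen_singleton, map_smul]
  exact Ideal.mul_mem_right _ _ (Ideal.subset_span ⟨i, h3 i (Finset.mem_singleton_self i), rfl⟩)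

theorem exists_tateD_eq_smul_gen {m : ℕ} {r : R}
    (hr : r ∈ Ideal.span (τ '' {i | (i : ℕ) < m})) :
    ∃ y ∈ Finsupp.supported R R (koszulCells n s m 1), tateD τ a y = r • gen R ∅ 0 := by
  induction hr using Submodule.span_induction with
  | mem x h =>
    obtain ⟨i, hi, rfl⟩ := h
    refine ⟨gen R {i} 0, gen_mem_supported ⟨by simp [Cell.degree], rfl, ?_⟩,
      tateD_gen_singleton i⟩
    simpa using hi
  | zero => exact ⟨0, zero_mem _, by simp⟩
  | add x y _ _ hx hy =>
    obtain ⟨u, hu, hux⟩ := hx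
    obtain ⟨v, hv, hvy⟩ := hy
    exact ⟨u + v, add_mem hu hv, by rw [map_add, hux, hvy, add_smul]⟩
  | smul t x _ hx =>
    obtain ⟨u, hu, hux⟩ := hx
    exact ⟨t • u, Submodule.smul_mem _ _ hu, by rw [map_smul, hux, smul_smul, smul_eq_mul]⟩

/-- A regular sequence: each member is a non-zero-divisor modulo the preceding ones. -/
def IsRegularFamily {N : ℕ} (g : Fin N → R) : Prop :=
  ∀ (j : Fin N) (r : R), g j * r ∈ Ideal.span (g '' {i | (i : ℕ) < j}) →
    r ∈ Ideal.span (g '' {i | (i : ℕ) < j})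

/-- Induction on the number of exterior variables, unwinding the mapping cone of multiplication by
τ_m. Write x = x₀ + e_m y with y = ∂x/∂e_m. Then y is the boundary of some u, x₀ + τ_m u is a cycle
in fewer variables, hence the boundary of some v, and v − e_m u has boundary x. -/
theorem koszul_exact (hτ : IsRegularFamily τ) {m : ℕ} (hm : m ≤ n) (q : ℕ) {x : Total R n s}
    (hx : x ∈ Finsupp.supported R R (koszulCells n s m (q + 1))) (hd : tateD τ a x = 0) :
    ∃ y ∈ Finsupp.supported R R (koszulCells n s m (q + 2)), tateD τ a y = x := by
  induction m generalizing q x with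
  | zero =>
    refine ⟨0, zero_mem _, ?_⟩
    have hx' : x ∈ Finsupp.supported R R (∅ : Set (Cell n s)) := by
      refine Finsupp.supported_mono ?_ hx
      rintro ⟨I, l⟩ ⟨h1, h2, h3⟩
      simp only at h2 h3
      subst h2
      obtain rfl : I = ∅ := Finset.eq_empty_of_forall_notMem fun i hi => by simpa using h3 i hi
      simp [Cell.degree] at h1
    rw [Finsupp.supported_empty] at hx'
    rw [(Submodule.mem_bot R).1 hx', map_zero]
  | succ m ih =>
    have hmn : m < n := hm
    set i : Fin n := ⟨m, hmn⟩ with hi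
    set y := dE R s i x with hy
    have hyS : y ∈ Finsupp.supported R R (koszulCells n s m q) := dE_koszulCells hmn hx
    have hx0 := sub_lE_dE_koszulCells hmn hx
    have hdy : tateD τ a y = 0 := by
      -- No t occurs in x, so the second half of ∂ does not contribute.
      have hz : ∑ j, a j i • dT R n j x = 0 := by
        have : x ∈ LinearMap.ker (∑ j, a j i • dT R n j) := by
          refine map_mem_of_gen (f := LinearMap.id) (fun c hc => ?_) hx
          have h2 := hc.2.1
          simp [LinearMap.sum_apply, dT_gen, h2]
        simpa [LinearMap.sum_apply] using this
      have := dE_tateD (τ := τ) (a := a) i x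
      rw [hd, map_zero, hz, add_zero] at this
      exact neg_eq_zero.1 this.symm
    have hx0d : tateD τ a (x - lE R s i y) = - (τ i • y) := by
      rw [map_sub, hd, tateD_lE, hdy, map_zero]; simp
    obtain ⟨u, huS, hu⟩ : ∃ u ∈ Finsupp.supported R R (koszulCells n s m (q + 1)),
        tateD τ a u = y := by
      -- For q = 0 the induction hypothesis does not apply, as y is a scalar. But ∂x₀ = −τ_m y puts
      -- τ_m y into the ideal of the earlier τ's, and regularity puts y there.
      rcases q with _ | q
      · have hyg := eq_smul_gen_of_mem_part_zero (koszulCells_le_part _ _ hyS)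
        rw [hyg]
        refine exists_tateD_eq_smul_gen (hτ i _ ?_)
        have := tateD_koszulCells_one (τ := τ) (a := a) hx0
        rw [hx0d] at this
        exact (Ideal.neg_mem_iff _).1 this
      · exact ih hmn.le q hyS hdy
    obtain ⟨v, hvS, hv⟩ := ih hmn.le q (x := x - lE R s i y + τ i • u)
      (add_mem hx0 (Submodule.smul_mem _ _ huS)) (by rw [map_add, hx0d, map_smul, hu]; simp)
    refine ⟨v - lE R s i u, sub_mem (koszulCells_mono _ _ hvS) (lE_koszulCells hmn huS), ?_⟩
    rw [map_sub, hv, tateD_lE, hu]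
    abel

end Koszul

/-! ### Adjoining the divided powers of the t_j one variable at a time. -/

section Tate

variable {R : Type*} [CommRing R] {n s : ℕ} {τ : Fin n → R} {a : Fin s → Fin n → R}
  {g : Fin s → R}

/-- The cells of degree `q` which involve only the `t_j` with `j < m`. -/
def tateCells (n s m q : ℕ) : Set (Cell n s) :=
  {c | c.degree = q ∧ ∀ j : Fin s, m ≤ (j : ℕ) → c.2 j = 0}

theorem tateCells_le_part (m q : ℕ) :
    Finsupp.supported R R (tateCells n s m q) ≤ part R q :=
  Finsupp.supported_mono fun _ hc => hc.1

theorem tateCells_mono (m q : ℕ) : Finsupp.supported R R (tateCells n s m q) ≤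
    Finsupp.supported R R (tateCells n s (m + 1) q) :=
  Finsupp.supported_mono fun _ hc => ⟨hc.1, fun j hj => hc.2 j (by omega)⟩

theorem tateD_tateCells {m q : ℕ} {x : Total R n s}
    (hx : x ∈ Finsupp.supported R R (tateCells n s m (q + 1))) :
    tateD τ a x ∈ Finsupp.supported R R (tateCells n s m q) := by
  refine tateD_mem (fun c hc i hi => ?_) (fun c hc j hj p hp => ?_) hx
  · obtain ⟨h1, h2⟩ := hc
    have : _ = Cell.degree c := Cell.degree_erase c.2 hi
    exact ⟨by omega, h2⟩
  · obtain ⟨h1, h2⟩ := hc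
    have h3 := Cell.degree_insert (Function.update c.2 j (c.2 j - 1)) hp
    have h4 : _ = Cell.degree c := Cell.degree_pred c.1 hj
    refine ⟨by omega, fun j' hj' => ?_⟩
    have : j' ≠ j := by rintro rfl; exact hj (h2 _ hj')
    simpa [this] using h2 j' hj'

theorem dT_tateCells {m q : ℕ} (j : Fin s) {x : Total R n s}
    (hx : x ∈ Finsupp.supported R R (tateCells n s m (q + 2))) :
    dT R n j x ∈ Finsupp.supported R R (tateCells n s m q) := by
  refine dT_mem (fun c hc hj => ?_) hx
  obtain ⟨h1, h2⟩ := hc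
  have h4 : _ = Cell.degree c := Cell.degree_pred c.1 hj
  refine ⟨by omega, fun j' hj' => ?_⟩
  have : j' ≠ j := by rintro rfl; exact hj (h2 _ hj')
  simpa [this] using h2 j' hj'

theorem sT_tateCells {m q : ℕ} (hm : m < s) {x : Total R n s}
    (hx : x ∈ Finsupp.supported R R (tateCells n s (m + 1) q)) :
    sT R n ⟨m, hm⟩ x ∈ Finsupp.supported R R (tateCells n s (m + 1) (q + 2)) := by
  refine sT_mem (fun c hc => ?_) hx
  obtain ⟨h1, h2⟩ := hc
  have h4 : _ = Cell.degree c + 2 := Cell.degree_succ c.1 c.2 ⟨m, hm⟩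
  refine ⟨by omega, fun j hj => ?_⟩
  have : j ≠ ⟨m, hm⟩ := by rintro rfl; simp at hj
  simpa [this] using h2 j hj

theorem sub_sT_dT_tateCells {m q : ℕ} (hm : m < s) {x : Total R n s}
    (hx : x ∈ Finsupp.supported R R (tateCells n s (m + 1) q)) :
    x - sT R n ⟨m, hm⟩ (dT R n ⟨m, hm⟩ x) ∈ Finsupp.supported R R (tateCells n s m q) := by
  refine map_mem_of_gen (f := LinearMap.id - sT R n ⟨m, hm⟩ ∘ₗ dT R n ⟨m, hm⟩)
    (fun c hc => ?_) hx
  obtain ⟨h1, h2⟩ := hc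
  simp only [LinearMap.sub_apply, LinearMap.id_apply, LinearMap.comp_apply, sT_dT_gen]
  split_ifs with h
  · rw [sub_zero]
    refine gen_mem_supported ⟨h1, fun j hj => ?_⟩
    rcases hj.eq_or_lt with hj | hj
    · obtain rfl : j = ⟨m, hm⟩ := Fin.ext hj.symm
      exact h
    · exact h2 j hj
  · simp

/-- A t has degree two, so none can occur in degree one. -/
theorem tateCells_one (m : ℕ) : Finsupp.supported R R (tateCells n s (m + 1) 1) ≤
    Finsupp.supported R R (tateCells n s m 1) := by
  refine Finsupp.supported_mono fun c hc => ⟨hc.1, fun j _ => ?_⟩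
  have h := hc.1
  have := Finset.single_le_sum (fun i _ => Nat.zero_le (c.2 i)) (Finset.mem_univ j)
  simp only [Cell.degree] at h
  omega

/-- The ideal generated by the first `m` members of a family. -/
def initialSpan (g : Fin s → R) (m : ℕ) : Ideal R := Ideal.span (g '' {i | (i : ℕ) < m})

theorem mem_initialSpan (g : Fin s → R) {m : ℕ} {j : Fin s} (hj : (j : ℕ) < m) :
    g j ∈ initialSpan g m := Ideal.subset_span (Set.mem_image_of_mem g hj)

theorem initialSpan_succ (g : Fin s → R) {m : ℕ} (hm : m < s) :
    initialSpan g (m + 1) = initialSpan g m ⊔ Ideal.span {g ⟨m, hm⟩} := by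
  rw [initialSpan, initialSpan, ← Ideal.span_union, ← Set.image_singleton, ← Set.image_union]
  congr 2
  ext i
  simp only [Set.mem_ofPred, Set.mem_union, Set.mem_singleton_iff, Fin.ext_iff]
  omega

theorem initialSpan_top (g : Fin s → R) : initialSpan g s = Ideal.span (Set.range g) := by
  rw [initialSpan, ← Set.image_univ]
  congr 2
  ext i
  simp

/-- The derivatives ∂/∂t_j with j ≥ m vanish on these cells, so ∂² only involves g_j with j < m:
modulo those, ∂ is an honest differential. -/
theorem tateD_tateD_mem (hag : ∀ j, ∑ p, a j p * τ p = g j) {m q : ℕ} {x : Total R n s}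
    (hx : x ∈ Finsupp.supported R R (tateCells n s m q)) :
    tateD τ a (tateD τ a x) ∈ coeffIn (initialSpan g m) := by
  rw [tateD_tateD]
  refine Submodule.sum_mem _ fun j _ => ?_
  rw [hag]
  by_cases hj : (j : ℕ) < m
  · exact smul_mem_coeffIn (mem_initialSpan g hj) _
  · have : dT R n j x = 0 := by
      refine map_mem_of_gen (P := ⊥) (fun c hc => ?_) hx
      rw [Submodule.mem_bot, dT_gen, if_pos (hc.2 j (not_lt.1 hj))]
    rw [this, smul_zero]
    exact zero_mem _

theorem mem_coeffIn_of_smul_mem (hg : IsRegularFamily g) {m : ℕ} (hm : m < s) {x : Total R n s}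
    (h : g ⟨m, hm⟩ • x ∈ coeffIn (initialSpan g m)) : x ∈ coeffIn (initialSpan g m) :=
  fun c => hg ⟨m, hm⟩ (x c) (h c)

/-- Exactness of the part of the Koszul–Tate complex which involves only the first `m` of the
variables `t_j`, modulo the first `m` elements of the family `g`. -/
def ExactBelow (τ : Fin n → R) (a : Fin s → Fin n → R) (g : Fin s → R) (m : ℕ) : Prop :=
  ∀ (q : ℕ) (x : Total R n s), x ∈ Finsupp.supported R R (tateCells n s m (q + 1)) →
    tateD τ a x ∈ coeffIn (initialSpan g m) →
    ∃ y ∈ Finsupp.supported R R (tateCells n s m (q + 2)),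
      x - tateD τ a y ∈ coeffIn (initialSpan g m)

theorem exactBelow_zero (hτ : IsRegularFamily τ) : ExactBelow τ a g 0 := by
  intro q x hx hd
  have hS : ∀ q, tateCells n s 0 q = koszulCells n s n q := fun q => by
    ext c
    refine ⟨fun h => ⟨h.1, funext fun j => h.2 j (Nat.zero_le _), fun i _ => i.2⟩,
      fun h => ⟨h.1, fun j _ => congrFun h.2.1 j⟩⟩
  have h0 : initialSpan g 0 = ⊥ := by simp [initialSpan]
  rw [hS] at hx
  rw [h0] at hd ⊢
  obtain ⟨y, hy, hyx⟩ := koszul_exact (a := a) hτ le_rfl q hx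
    (Finsupp.ext fun c => by simpa using hd c)
  exact ⟨y, by rwa [hS], by rw [hyx, sub_self]; exact zero_mem _⟩

section Step

variable {m : ℕ}

theorem smul_mem_coeffIn_initialSpan (hm : m < s) (x : Total R n s) :
    g ⟨m, hm⟩ • x ∈ coeffIn (initialSpan g (m + 1)) :=
  smul_mem_coeffIn (mem_initialSpan g (Nat.lt_succ_self m)) x

theorem coeffIn_initialSpan_le : (coeffIn (initialSpan g m) : Submodule R (Total R n s)) ≤
    coeffIn (initialSpan g (m + 1)) :=
  coeffIn_mono (Ideal.span_mono (Set.image_mono fun _ (h : _ < _) => Nat.lt_succ_of_lt h))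

/-- The long exact sequence for multiplication by g = g_m, modulo the earlier members. If ∂u ≡ g v,
then g ∂v ≡ ∂²u ≡ 0, so ∂v ≡ 0 by regularity. As u has degree at least two, v has positive degree
and v ≡ ∂w; then u − g w is a cycle already modulo the earlier members. -/
theorem exists_boundary_of_degree_ge_two (hm : m < s) (hg : IsRegularFamily g)
    (hag : ∀ j, ∑ p, a j p * τ p = g j) (ih : ExactBelow τ a g m) {q : ℕ} {u : Total R n s}
    (hu : u ∈ Finsupp.supported R R (tateCells n s m (q + 2)))
    (hd : tateD τ a u ∈ coeffIn (initialSpan g (m + 1))) :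
    ∃ w ∈ Finsupp.supported R R (tateCells n s m (q + 3)),
      u - tateD τ a w ∈ coeffIn (initialSpan g (m + 1)) := by
  rw [initialSpan_succ g hm] at hd
  obtain ⟨v, hv, hvd⟩ := exists_sub_smul_mem_coeffIn (tateD_tateCells hu) hd
  have h1 : tateD τ a v ∈ coeffIn (initialSpan g m) := by
    refine mem_coeffIn_of_smul_mem hg hm ?_
    have h2 := map_mem_coeffIn (tateD τ a) hvd
    rw [map_sub, map_smul] at h2
    simpa using sub_mem (tateD_tateD_mem hag hu) h2
  obtain ⟨w, hw, hvw⟩ := ih q v hv h1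
  obtain ⟨y, hy, hyu⟩ := ih (q + 1) (u - g ⟨m, hm⟩ • w)
    (sub_mem hu (Submodule.smul_mem _ _ hw)) (by
      have h3 := add_mem hvd (Submodule.smul_mem _ (g ⟨m, hm⟩) hvw)
      rw [map_sub, map_smul]
      convert h3 using 1
      module)
  refine ⟨y, hy, ?_⟩
  have := add_mem (coeffIn_initialSpan_le hyu) (smul_mem_coeffIn_initialSpan hm w)
  convert this using 1
  module

/-- Here the v with ∂u ≡ g v is a scalar r and need not be a boundary. But z = ∑ₚ a_p e_p satisfies
∂z = g, so u − r z is a cycle modulo the earlier members. Thus z generates the first homology modulo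
g. -/
theorem exists_boundary_of_degree_one (hm : m < s)
    (hag : ∀ j, ∑ p, a j p * τ p = g j) (ih : ExactBelow τ a g m) {u : Total R n s}
    (hu : u ∈ Finsupp.supported R R (tateCells n s m 1))
    (hd : tateD τ a u ∈ coeffIn (initialSpan g (m + 1))) :
    ∃ (r : R), ∃ w ∈ Finsupp.supported R R (tateCells n s m 2),
      u - tateD τ a w - r • ∑ p, a ⟨m, hm⟩ p • gen R {p} 0 ∈
        coeffIn (initialSpan g (m + 1)) := by
  rw [initialSpan_succ g hm] at hd
  obtain ⟨v, hv, hvd⟩ := exists_sub_smul_mem_coeffIn (tateD_tateCells hu) hd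
  have hvg := eq_smul_gen_of_mem_part_zero (tateCells_le_part _ _ hv)
  set r := v (∅, 0) with hr
  have hz : tateD τ a (∑ p, a ⟨m, hm⟩ p • gen R {p} (0 : Fin s → ℕ)) =
      g ⟨m, hm⟩ • gen R ∅ 0 := by
    simp only [map_sum, map_smul, tateD_gen_singleton, smul_smul, ← Finset.sum_smul, hag]
  have hzS : (∑ p, a ⟨m, hm⟩ p • gen R {p} (0 : Fin s → ℕ)) ∈
      Finsupp.supported R R (tateCells n s m 1) :=
    Submodule.sum_mem _ fun p _ => Submodule.smul_mem _ _
      (gen_mem_supported ⟨by simp [Cell.degree], fun _ _ => rfl⟩)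
  obtain ⟨w, hw, hwu⟩ := ih 0 (u - r • ∑ p, a ⟨m, hm⟩ p • gen R {p} 0)
    (sub_mem hu (Submodule.smul_mem _ _ hzS)) (by
      rw [map_sub, map_smul, hz]
      rw [hvg] at hvd
      convert hvd using 1
      module)
  refine ⟨r, w, hw, ?_⟩
  convert coeffIn_initialSpan_le hwu using 1
  module

/-- Injectivity of the connecting map, which sends the class of r z to that of r. If r z − ∂w ≡ g y,
then applying ∂ gives g (r − ∂y) ≡ 0, and g cancels by regularity. -/
theorem exists_boundary_of_smul_cycle (hm : m < s) (hg : IsRegularFamily g)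
    (hag : ∀ j, ∑ p, a j p * τ p = g j) {r : R} {w : Total R n s}
    (hw : w ∈ Finsupp.supported R R (tateCells n s m 2))
    (h : r • ∑ p, a ⟨m, hm⟩ p • gen R {p} 0 - tateD τ a w ∈ coeffIn (initialSpan g (m + 1))) :
    ∃ y ∈ Finsupp.supported R R (tateCells n s m 1),
      r • gen R ∅ 0 - tateD τ a y ∈ coeffIn (initialSpan g m) := by
  have hz : tateD τ a (∑ p, a ⟨m, hm⟩ p • gen R {p} (0 : Fin s → ℕ)) =
      g ⟨m, hm⟩ • gen R ∅ 0 := by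
    simp only [map_sum, map_smul, tateD_gen_singleton, smul_smul, ← Finset.sum_smul, hag]
  have hzS : (∑ p, a ⟨m, hm⟩ p • gen R {p} (0 : Fin s → ℕ)) ∈
      Finsupp.supported R R (tateCells n s m 1) :=
    Submodule.sum_mem _ fun p _ => Submodule.smul_mem _ _
      (gen_mem_supported ⟨by simp [Cell.degree], fun _ _ => rfl⟩)
  rw [initialSpan_succ g hm] at h
  obtain ⟨y, hy, hyd⟩ := exists_sub_smul_mem_coeffIn
    (sub_mem (Submodule.smul_mem _ _ hzS) (tateD_tateCells hw)) h
  refine ⟨y, hy, mem_coeffIn_of_smul_mem hg hm ?_⟩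
  have h1 := add_mem (map_mem_coeffIn (tateD τ a) hyd) (tateD_tateD_mem hag hw)
  rw [map_sub, map_sub, map_smul, map_smul, hz] at h1
  convert h1 using 1
  module

/-- Write t for the new variable. The derivation ∂/∂t maps the enlarged complex onto its own shift
by two, with kernel the old complex. So one inducts on the degree: the cycle ∂x/∂t has degree two
less and bounds some y; subtracting from x the boundary of the shift of y makes ∂x/∂t vanish modulo
the ideal, and what is left is handled in the old complex. In degree one, t itself bounds z. -/
theorem exactBelow_succ (hm : m < s) (hg : IsRegularFamily g)
    (hag : ∀ j, ∑ p, a j p * τ p = g j) (ih : ExactBelow τ a g m) :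
    ExactBelow τ a g (m + 1) := by
  intro q
  have hS : ∀ {x : Total R n s}, x ∈ coeffIn (initialSpan g (m + 1)) →
      ∀ f : Total R n s →ₗ[R] Total R n s, f x ∈ coeffIn (initialSpan g (m + 1)) :=
    fun h f => map_mem_coeffIn f h
  set j : Fin s := ⟨m, hm⟩ with hj
  have hz : tateD τ a (sT R n j (gen R ∅ 0)) = ∑ p, a j p • gen R {p} 0 := by
    rw [sT_gen]; exact tateD_gen_t j
  induction q using Nat.strong_induction_on with
  | _ q ihq =>
  intro x hx hd
  rcases q with _ | q
  · obtain ⟨r, w, hw, h⟩ := exists_boundary_of_degree_one hm hag ih (tateCells_one m hx) hd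
    refine ⟨w + r • sT R n j (gen R ∅ 0), add_mem (tateCells_mono _ _ hw)
      (Submodule.smul_mem _ _ (sT_tateCells hm (gen_mem_supported ⟨by simp [Cell.degree],
        fun _ _ => rfl⟩))), ?_⟩
    rw [map_add, map_smul, hz]
    convert h using 1
    module
  · obtain ⟨y, hy, hyv⟩ : ∃ y ∈ Finsupp.supported R R (tateCells n s (m + 1) (q + 1)),
        dT R n j x - tateD τ a y ∈ coeffIn (initialSpan g (m + 1)) := by
      have hv : dT R n j x ∈ Finsupp.supported R R (tateCells n s (m + 1) q) := dT_tateCells j hx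
      -- For x of degree two, ∂x/∂t is a scalar r and exactness says nothing. However, ∂x ≡ 0 says
      -- that r z is, up to sign, the boundary of the part of x free of t, and then r is a boundary.
      rcases q with _ | q
      · have hvg := eq_smul_gen_of_mem_part_zero (tateCells_le_part _ _ hv)
        set r := (dT R n j x) (∅, 0) with hr
        obtain ⟨y, hy, hyr⟩ := exists_boundary_of_smul_cycle hm hg hag (r := r)
          (w := - (x - sT R n j (dT R n j x))) (neg_mem (sub_sT_dT_tateCells hm hx)) (by
            rw [map_neg, map_sub, hvg, map_smul, map_smul, hz]
            convert hd using 1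
            module)
        refine ⟨y, tateCells_mono _ _ hy, ?_⟩
        rw [hvg]
        exact coeffIn_initialSpan_le hyr
      · refine ihq q (by omega) _ hv ?_
        rw [← dT_tateD]
        exact hS hd _
    set x' := x - tateD τ a (sT R n j y) with hx'
    have hsy := sT_tateCells hm hy
    have hx'S : x' ∈ Finsupp.supported R R (tateCells n s (m + 1) (q + 2)) :=
      sub_mem hx (tateD_tateCells hsy)
    -- As ∂/∂t commutes with ∂ and undoes the shift, this derivative is ∂x/∂t minus the boundary of
    -- y.
    have hdx' : dT R n j x' ∈ coeffIn (initialSpan g (m + 1)) := by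
      rw [hx', map_sub, dT_tateD, dT_sT]
      exact hyv
    obtain ⟨w, hw, hwu⟩ := exists_boundary_of_degree_ge_two hm hg hag ih
      (sub_sT_dT_tateCells hm hx'S) (by
        rw [map_sub, hx', map_sub, ← hx']
        exact sub_mem (sub_mem hd (tateD_tateD_mem hag hsy)) (hS (hS hdx' _) _))
    refine ⟨w + sT R n j y, add_mem (tateCells_mono _ _ hw) hsy, ?_⟩
    have := add_mem hwu (hS hdx' (sT R n j))
    rw [map_add]
    convert this using 1
    rw [hx']
    abel

end Step

theorem tate_exact (hτ : IsRegularFamily τ) (hg : IsRegularFamily g)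
    (hag : ∀ j, ∑ p, a j p * τ p = g j) {q : ℕ} {x : Total R n s} (hx : x ∈ part R (q + 1))
    (hd : tateD τ a x ∈ coeffIn (Ideal.span (Set.range g))) :
    ∃ y ∈ part R (q + 2), x - tateD τ a y ∈ coeffIn (Ideal.span (Set.range g)) := by
  have h : ∀ m ≤ s, ExactBelow τ a g m := by
    intro m
    induction m with
    | zero => exact fun _ => exactBelow_zero hτ
    | succ m ih => exact fun hm => exactBelow_succ hm hg hag (ih (Nat.le_of_succ_le hm))
  have hS : ∀ q, (part R q : Submodule R (Total R n s)) =
      Finsupp.supported R R (tateCells n s s q) := fun q => by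
    refine congrArg (Finsupp.supported R R) (Set.ext fun c => ⟨fun h => ⟨h, fun j hj => absurd j.2 hj.not_gt⟩, And.left⟩)
  rw [← initialSpan_top] at hd ⊢
  rw [hS] at hx
  obtain ⟨y, hy, h'⟩ := h s le_rfl q x hx hd
  exact ⟨y, by rwa [hS], h'⟩

end Tate

/-! ### Change of the coefficient ring. -/

section BaseChange

variable {R R' : Type*} [CommRing R] [CommRing R'] (φ : R →+* R') {n s : ℕ}

/-- Application of a ring homomorphism to all coefficients. -/
noncomputable def mapTotal : Total R n s →+ Total R' n s :=
  Finsupp.mapRange.addMonoidHom φ.toAddMonoidHom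

theorem mapTotal_apply (x : Total R n s) (c : Cell n s) : mapTotal φ x c = φ (x c) := rfl

theorem mapTotal_smul (r : R) (x : Total R n s) : mapTotal φ (r • x) = φ r • mapTotal φ x := by
  ext c; simp [mapTotal_apply]

theorem mapTotal_gen (I : Finset (Fin n)) (l : Fin s → ℕ) :
    mapTotal φ (gen R I l) = gen R' I l := by
  simp [mapTotal, gen]

theorem mapTotal_comm {f : Total R n s →ₗ[R] Total R n s} {f' : Total R' n s →ₗ[R'] Total R' n s}
    (h : ∀ I l, mapTotal φ (f (gen R I l)) = f' (gen R' I l)) (x : Total R n s) :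
    mapTotal φ (f x) = f' (mapTotal φ x) := by
  induction x using Finsupp.induction_linear with
  | zero => simp
  | add x y hx hy => rw [map_add, map_add, map_add, hx, hy, map_add]
  | single c r => rw [single_eq_smul_gen, map_smul, mapTotal_smul, h, mapTotal_smul, map_smul,
      mapTotal_gen]

theorem map_sgn (i : Fin n) (I : Finset (Fin n)) : φ (sgn R i I) = sgn R' i I := by
  simp [sgn]

theorem mapTotal_tateD (τ : Fin n → R) (a : Fin s → Fin n → R) (x : Total R n s) :
    mapTotal φ (tateD τ a x) =
      tateD (fun i => φ (τ i)) (fun j p => φ (a j p)) (mapTotal φ x) := by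
  have h1 : ∀ i (x : Total R n s), mapTotal φ (dE R s i x) = dE R' s i (mapTotal φ x) :=
    fun i => mapTotal_comm φ fun I l => by
      rw [dE_gen, dE_gen]; split_ifs <;> simp [mapTotal_smul, mapTotal_gen, map_sgn]
  have h2 : ∀ i (x : Total R n s), mapTotal φ (lE R s i x) = lE R' s i (mapTotal φ x) :=
    fun i => mapTotal_comm φ fun I l => by
      rw [lE_gen, lE_gen]; split_ifs <;> simp [mapTotal_smul, mapTotal_gen, map_sgn]
  have h3 : ∀ j (x : Total R n s), mapTotal φ (dT R n j x) = dT R' n j (mapTotal φ x) :=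
    fun i => mapTotal_comm φ fun I l => by
      rw [dT_gen, dT_gen]; split_ifs <;> simp [mapTotal_gen]
  simp only [tateD_apply, map_add, map_sum, mapTotal_smul, h1, h2, h3]

variable {φ}

theorem exists_mapTotal_eq (hφ : Function.Surjective φ) {S : Set (Cell n s)} {x : Total R' n s}
    (hx : x ∈ Finsupp.supported R' R' S) :
    ∃ y ∈ Finsupp.supported R R S, mapTotal φ y = x := by
  classical
  choose r hr using hφ
  refine ⟨Finsupp.onFinset x.support (fun c => if x c = 0 then 0 else r (x c)) (fun c => by
    simp +contextual), fun c hc => hx ?_, Finsupp.ext fun c => ?_⟩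
  · simp only [Finset.mem_coe, Finsupp.mem_support_iff, Finsupp.onFinset_apply] at hc ⊢
    exact fun h0 => hc (if_pos h0)
  · rw [mapTotal_apply, Finsupp.onFinset_apply]
    split_ifs with h
    · rw [h, map_zero]
    · exact hr _

theorem mapTotal_mem {S : Set (Cell n s)} {x : Total R n s}
    (hx : x ∈ Finsupp.supported R R S) : mapTotal φ x ∈ Finsupp.supported R' R' S := by
  intro c hc
  refine hx ?_
  simp only [Finset.mem_coe, Finsupp.mem_support_iff, mapTotal_apply] at hc ⊢
  exact fun h => hc (by rw [h, map_zero])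

theorem mapTotal_eq_zero_iff {J : Ideal R} (hJ : RingHom.ker φ = J) {x : Total R n s} :
    mapTotal φ x = 0 ↔ x ∈ coeffIn J := by
  subst hJ
  rw [Finsupp.ext_iff]
  rfl

/-- The Koszul–Tate complex over `R / (g)` is exact in positive degrees if `τ` and `g` are regular
sequences in `R` and `∑ₚ a j p * τ p = g j`. -/
theorem tate_exact_quotient (hφ : Function.Surjective φ) {τ : Fin n → R} {a : Fin s → Fin n → R}
    {g : Fin s → R} (hker : RingHom.ker φ = Ideal.span (Set.range g)) (hτ : IsRegularFamily τ)
    (hg : IsRegularFamily g) (hag : ∀ j, ∑ p, a j p * τ p = g j) {q : ℕ} {x : Total R' n s}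
    (hx : x ∈ part R' (q + 1)) (hd : tateD (fun i => φ (τ i)) (fun j p => φ (a j p)) x = 0) :
    ∃ y ∈ part R' (q + 2), tateD (fun i => φ (τ i)) (fun j p => φ (a j p)) y = x := by
  -- Coefficients are lifted without enlarging the support, so z keeps its degree; being a cycle
  -- downstairs means that the coefficients of ∂z lie in (g).
  obtain ⟨z, hz, rfl⟩ := exists_mapTotal_eq hφ hx
  rw [← mapTotal_tateD, mapTotal_eq_zero_iff hker] at hd
  obtain ⟨y, hy, h⟩ := tate_exact hτ hg hag hz hd
  refine ⟨mapTotal φ y, mapTotal_mem hy, ?_⟩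
  rw [← mapTotal_eq_zero_iff hker, map_sub, mapTotal_tateD, sub_eq_zero] at h
  exact h.symm

end BaseChange

/-! ### The product, its signs and binomial coefficients, and the Leibniz rules. -/

section Product

variable {R : Type*} [CommRing R] {n s : ℕ}

theorem Total.induction {p : Total R n s → Prop} (x : Total R n s) (zero : p 0)
    (add : ∀ x y, p x → p y → p (x + y)) (smul_gen : ∀ (r : R) I l, p (r • gen R I l)) : p x := by
  induction x using Finsupp.induction_linear with
  | zero => exact zero
  | add x y hx hy => exact add x y hx hy
  | single c r => rw [single_eq_smul_gen]; exact smul_gen r _ _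

variable (R) in
/-- The sign of the product of `e_I` and `e_J`. -/
def mulSgn (I J : Finset (Fin n)) : R := (-1) ^ ((I ×ˢ J).filter fun q => q.1 < q.2).card

/-- The coefficient of the product of `t^{(l)}` and `t^{(m)}`. -/
def mulCoeff (l m : Fin s → ℕ) : ℕ := ∏ j, (l j + m j).choose (l j)

theorem mul_gen_gen (I J : Finset (Fin n)) (l m : Fin s → ℕ) :
    mul R (gen R I l) (gen R J m) =
      if Disjoint I J then (mulSgn R I J * mulCoeff l m) • gen R (I ∪ J) (l + m) else 0 := by
  have h : mul R (gen R I l) = Finsupp.linearCombination R fun c' => mulCell R (I, l) c' :=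
    linearCombination_gen (fun c => Finsupp.linearCombination R fun c' => mulCell R c c') I l
  rw [h, linearCombination_gen]
  rfl

theorem mulSgn_empty_left (J : Finset (Fin n)) : mulSgn R ∅ J = 1 := by simp [mulSgn]

theorem mulSgn_empty_right (J : Finset (Fin n)) : mulSgn R J ∅ = 1 := by simp [mulSgn]

theorem mulSgn_union_left {I J : Finset (Fin n)} (K : Finset (Fin n)) (h : Disjoint I J) :
    mulSgn R (I ∪ J) K = mulSgn R I K * mulSgn R J K := by
  rw [mulSgn, Finset.union_product, Finset.filter_union, Finset.card_union_of_disjoint, pow_add]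
  · rfl
  · refine Finset.disjoint_filter_filter (Finset.disjoint_product.2 (Or.inl h))

theorem mulSgn_union_right {J K : Finset (Fin n)} (I : Finset (Fin n)) (h : Disjoint J K) :
    mulSgn R I (J ∪ K) = mulSgn R I J * mulSgn R I K := by
  rw [mulSgn, Finset.product_union, Finset.filter_union, Finset.card_union_of_disjoint, pow_add]
  · rfl
  · refine Finset.disjoint_filter_filter (Finset.disjoint_product.2 (Or.inr h))

theorem mulSgn_singleton_left (p : Fin n) (I : Finset (Fin n)) :
    mulSgn R {p} I = sgn R p I := by
  rw [mulSgn, sgn, Finset.singleton_product, Finset.filter_map, Finset.card_map]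
  rfl

/-- Disjointness excludes pairs with equal entries, so the pairs counted by the two signs partition
I × J. -/
theorem mulSgn_mul_mulSgn {I J : Finset (Fin n)} (h : Disjoint I J) :
    mulSgn R I J * mulSgn R J I = (-1) ^ (I.card * J.card) := by
  rw [mulSgn, mulSgn, ← pow_add, ← Finset.card_product]
  congr 1
  rw [← Finset.card_filter_add_card_filter_not (s := I ×ˢ J) (fun q => q.1 < q.2)]
  congr 1
  refine Finset.card_bij' (fun q _ => q.swap) (fun q _ => q.swap) ?_ ?_ ?_ ?_
  · rintro ⟨i, j⟩ hq
    simp only [Finset.mem_filter, Finset.mem_product] at hq ⊢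
    exact ⟨hq.1.symm, hq.2.not_gt⟩
  · rintro ⟨i, j⟩ hq
    simp only [Finset.mem_filter, Finset.mem_product] at hq ⊢
    refine ⟨hq.1.symm, lt_of_le_of_ne (not_lt.1 hq.2) ?_⟩
    rintro h'
    simp only [Prod.fst_swap, Prod.snd_swap] at h'
    exact (Finset.disjoint_left.1 h) hq.1.1 (h' ▸ hq.1.2)
  · simp
  · simp

theorem mulSgn_mul_self (I J : Finset (Fin n)) : mulSgn R I J * mulSgn R I J = 1 := by
  rw [mulSgn, ← mul_pow]; simp

theorem mulCoeff_comm (l m : Fin s → ℕ) : mulCoeff l m = mulCoeff m l := by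
  refine Finset.prod_congr rfl fun j _ => ?_
  rw [add_comm, Nat.choose_symm_add]

/-- Both sides are the product over j of the trinomial coefficients of (l j, m j, k j). -/
theorem mulCoeff_assoc (l m k : Fin s → ℕ) :
    mulCoeff l m * mulCoeff (l + m) k = mulCoeff m k * mulCoeff l (m + k) := by
  simp only [mulCoeff, ← Finset.prod_mul_distrib]
  refine Finset.prod_congr rfl fun j _ => ?_
  have h := Nat.choose_mul (n := l j + m j + k j) (k := l j + m j) (s := l j)
    (by omega)
  have e1 : l j + m j + k j - l j = m j + k j := by omega
  have e2 : l j + m j - l j = m j := by omega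
  rw [e1, e2] at h
  simp only [Pi.add_apply]
  rw [mul_comm, h, mul_comm, ← add_assoc]

theorem mul_assoc' (x y z : Total R n s) : mul R (mul R x y) z = mul R x (mul R y z) := by
  induction x using Total.induction with
  | zero => simp
  | add x x' hx hx' => simp [hx, hx']
  | smul_gen r I l =>
  induction y using Total.induction with
  | zero => simp
  | add x x' hx hx' => simp only [map_add, LinearMap.add_apply, hx, hx']
  | smul_gen r' J m =>
  induction z using Total.induction with
  | zero => simp
  | add x x' hx hx' => simp only [map_add, hx, hx']
  | smul_gen r'' K k =>
  simp only [map_smul, LinearMap.smul_apply]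
  congr 3
  rw [mul_gen_gen, mul_gen_gen]
  by_cases h1 : Disjoint I J
  · by_cases h2 : Disjoint J K
    · by_cases h3 : Disjoint I K
      · have h4 : Disjoint (I ∪ J) K := Finset.disjoint_union_left.2 ⟨h3, h2⟩
        have h5 : Disjoint I (J ∪ K) := Finset.disjoint_union_right.2 ⟨h1, h3⟩
        simp only [h1, h2, if_true, map_smul, LinearMap.smul_apply, mul_gen_gen, h4, h5, smul_smul,
          Finset.union_assoc, add_assoc, mulSgn_union_left K h1, mulSgn_union_right I h2]
        congr 1
        have := congrArg (Nat.cast : ℕ → R) (mulCoeff_assoc l m k)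
        push_cast at this
        linear_combination mulSgn R I J * mulSgn R I K * mulSgn R J K * this
      · simp [h1, h2, mul_gen_gen, h3, Finset.disjoint_union_left, Finset.disjoint_union_right]
    · simp [h1, h2, mul_gen_gen, Finset.disjoint_union_left]
  · simp only [h1, if_false, map_zero, LinearMap.zero_apply]
    split_ifs with h2
    · simp [mul_gen_gen, Finset.disjoint_union_right, h1]
    · simp

theorem one_mul' (x : Total R n s) : mul R (gen R ∅ 0) x = x := by
  suffices h : mul R (gen R (∅ : Finset (Fin n)) (0 : Fin s → ℕ)) = LinearMap.id from
    LinearMap.congr_fun h x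
  refine Total.hom_ext fun I l => ?_
  simp [mul_gen_gen, mulSgn_empty_left, mulCoeff]

theorem mul_one' (x : Total R n s) : mul R x (gen R ∅ 0) = x := by
  suffices h : (mul R).flip (gen R (∅ : Finset (Fin n)) (0 : Fin s → ℕ)) = LinearMap.id from
    LinearMap.congr_fun h x
  refine Total.hom_ext fun I l => ?_
  simp [mul_gen_gen, mulSgn_empty_right, mulCoeff]

theorem mul_mem_part {i j : ℕ} {x y : Total R n s} (hx : x ∈ part R i) (hy : y ∈ part R j) :
    mul R x y ∈ part R (i + j) := by
  refine map_mem_of_gen (f := (mul R).flip y) (fun c (hc : c.degree = i) => ?_) hx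
  refine map_mem_of_gen (f := mul R (gen R c.1 c.2)) (fun c' (hc' : c'.degree = j) => ?_) hy
  rw [mul_gen_gen]
  split_ifs with h
  · refine Submodule.smul_mem _ _ (gen_mem_supported ?_)
    change Cell.degree _ = _
    simp only [Cell.degree, Finset.card_union_of_disjoint h, Pi.add_apply,
      Finset.sum_add_distrib] at *
    omega
  · exact zero_mem _

theorem neg_one_pow_degree_mul (c c' : Cell n s) :
    (-1 : R) ^ (c.degree * c'.degree) = (-1) ^ (c.1.card * c'.1.card) := by
  have h : ∀ c : Cell n s, c.degree % 2 = c.1.card % 2 := fun c => by simp [Cell.degree]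
  rw [neg_one_pow_eq_pow_mod_two, Nat.mul_mod, h, h, ← Nat.mul_mod, ← neg_one_pow_eq_pow_mod_two]

theorem mul_gen_comm (c c' : Cell n s) :
    mul R (gen R c.1 c.2) (gen R c'.1 c'.2) =
      (-1 : R) ^ (c.degree * c'.degree) • mul R (gen R c'.1 c'.2) (gen R c.1 c.2) := by
  rw [mul_gen_gen, mul_gen_gen, neg_one_pow_degree_mul]
  by_cases h : Disjoint c.1 c'.1
  · rw [if_pos h, if_pos h.symm, smul_smul, Finset.union_comm, add_comm c.2, mulCoeff_comm,
      ← mulSgn_mul_mulSgn h]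
    congr 1
    linear_combination (-(mulCoeff c'.2 c.2 : R) * mulSgn R c.1 c'.1) *
      mulSgn_mul_self (R := R) c'.1 c.1
  · rw [if_neg h, if_neg (fun h' => h h'.symm), smul_zero]

theorem mul_graded_comm {i j : ℕ} {x y : Total R n s} (hx : x ∈ part R i) (hy : y ∈ part R j) :
    mul R x y = (-1 : R) ^ (i * j) • mul R y x := by
  have h : ((mul R).flip y - (-1 : R) ^ (i * j) • mul R y) x ∈ (⊥ : Submodule R (Total R n s)) := by
    refine map_mem_of_gen (fun c (hc : c.degree = i) => ?_) hx
    have h' : (mul R (gen R c.1 c.2) - (-1 : R) ^ (i * j) • (mul R).flip (gen R c.1 c.2)) y ∈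
        (⊥ : Submodule R (Total R n s)) := by
      refine map_mem_of_gen (fun c' (hc' : c'.degree = j) => ?_) hy
      subst hc hc'
      simp only [LinearMap.sub_apply, LinearMap.smul_apply, LinearMap.flip_apply]
      rw [mul_gen_comm c c', sub_self]
      exact zero_mem _
    simpa using h'
  simpa [sub_eq_zero] using h

/-- Graded commutativity only gives 2x² = 0. Strictness comes from the generators: one of odd degree
contains some e_i, hence squares to zero, and the cross terms cancel in pairs. -/
theorem mul_self_eq_zero_of_odd {i : ℕ} (hi : Odd i) {x : Total R n s} (hx : x ∈ part R i) :
    mul R x x = 0 := by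
  have hsum : mul R x x = ∑ c : x.support, ∑ c' : x.support, (x c * x c') •
      mul R (gen R (c : Cell n s).1 (c : Cell n s).2)
        (gen R (c' : Cell n s).1 (c' : Cell n s).2) := by
    have hx : x = ∑ c : x.support, x c • gen R (c : Cell n s).1 (c : Cell n s).2 := by
      conv_lhs => rw [← Finsupp.sum_single x]
      rw [Finsupp.sum, ← Finset.sum_coe_sort]
      exact Finset.sum_congr rfl fun c _ => single_eq_smul_gen _ _
    have : ∀ y z : Total R n s, y = x → z = x → mul R y z = mul R x x := by
      rintro _ _ rfl rfl; rfl
    rw [← this _ _ hx.symm hx.symm]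
    simp only [map_sum, LinearMap.sum_apply, map_smul, LinearMap.smul_apply, Finset.smul_sum,
      smul_smul]
    rw [Finset.sum_comm]
    exact Finset.sum_congr rfl fun c _ => Finset.sum_congr rfl fun c' _ => by rw [mul_comm]
  have hodd : ∀ c : x.support, Odd (c : Cell n s).degree := fun c => by
    have : Cell.degree c.1 = i := hx c.2
    rwa [this]
  rw [hsum]
  refine sum_sum_eq_zero_of_alternating _ (fun c => ?_) fun c c' => ?_
  · rw [mul_gen_gen, if_neg, smul_zero]
    rw [disjoint_self]
    intro h
    have h1 := hodd c
    have h0 : (c : Cell n s).1 = ∅ := h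
    rw [Cell.degree, h0] at h1
    rw [Finset.card_empty, zero_add] at h1
    exact (Nat.not_odd_iff_even.2 (even_two_mul _)) h1
  · rw [mul_gen_comm, ((hodd c).mul (hodd c')).neg_one_pow, neg_smul, one_smul, smul_neg, mul_comm]

theorem lE_eq_mul (p : Fin n) (x : Total R n s) : lE R s p x = mul R (gen R {p} 0) x := by
  suffices h : lE R s p = mul R (gen R {p} 0) from LinearMap.congr_fun h x
  refine Total.hom_ext fun I l => ?_
  rw [lE_gen, mul_gen_gen, mulSgn_singleton_left, Finset.singleton_union]
  by_cases h : p ∈ I <;> simp [h, mulCoeff]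

theorem lE_mul (p : Fin n) (x y : Total R n s) :
    lE R s p (mul R x y) = mul R (lE R s p x) y := by
  rw [lE_eq_mul, lE_eq_mul, mul_assoc']

theorem mul_lE {i : ℕ} (p : Fin n) {x : Total R n s} (hx : x ∈ part R i) (y : Total R n s) :
    mul R x (lE R s p y) = (-1 : R) ^ i • lE R s p (mul R x y) := by
  rw [lE_eq_mul, lE_eq_mul, ← mul_assoc', mul_graded_comm hx (j := 1) (gen_mem_supported
    (by change Cell.degree _ = 1; simp [Cell.degree])), map_smul, LinearMap.smul_apply,
    mul_assoc', mul_one]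

theorem mulCoeff_eq (l m : Fin s → ℕ) (j : Fin s) :
    mulCoeff l m = (l j + m j).choose (l j) *
      ∏ i ∈ Finset.univ.erase j, (l i + m i).choose (l i) :=
  (Finset.mul_prod_erase _ _ (Finset.mem_univ j)).symm

theorem mulCoeff_update_left (l m : Fin s → ℕ) (j : Fin s) (v : ℕ) :
    mulCoeff (Function.update l j v) m = (v + m j).choose v *
      ∏ i ∈ Finset.univ.erase j, (l i + m i).choose (l i) := by
  rw [mulCoeff_eq _ _ j, Function.update_self]
  congr 1
  refine Finset.prod_congr rfl fun i hi => ?_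
  rw [Function.update_of_ne (Finset.ne_of_mem_erase hi)]

theorem mulCoeff_update_right (l m : Fin s → ℕ) (j : Fin s) (v : ℕ) :
    mulCoeff l (Function.update m j v) = (l j + v).choose (l j) *
      ∏ i ∈ Finset.univ.erase j, (l i + m i).choose (l i) := by
  rw [mulCoeff_eq _ _ j, Function.update_self]
  congr 1
  refine Finset.prod_congr rfl fun i hi => ?_
  rw [Function.update_of_ne (Finset.ne_of_mem_erase hi)]

theorem update_add_left (l m : Fin s → ℕ) (j : Fin s) (v : ℕ) :
    Function.update l j v + m = Function.update (l + m) j (v + m j) := by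
  ext i; rcases eq_or_ne i j with rfl | h <;> simp [*]

theorem update_add_right (l m : Fin s → ℕ) (j : Fin s) (v : ℕ) :
    l + Function.update m j v = Function.update (l + m) j (l j + v) := by
  ext i; rcases eq_or_ne i j with rfl | h <;> simp [*]

/-- On divided powers the Leibniz rule is Pascal's rule for the structure constants. -/
theorem dT_mul (j : Fin s) (x y : Total R n s) :
    dT R n j (mul R x y) = mul R (dT R n j x) y + mul R x (dT R n j y) := by
  induction x using Total.induction with
  | zero => simp
  | add x x' hx hx' => simp only [map_add, LinearMap.add_apply, hx, hx']; abel
  | smul_gen r I l =>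
  induction y using Total.induction with
  | zero => simp
  | add x x' hx hx' => simp only [map_add, hx, hx']; abel
  | smul_gen r' J m =>
  simp only [map_smul, LinearMap.smul_apply, ← smul_add]
  congr 2
  by_cases hIJ : Disjoint I J
  · rw [mul_gen_gen, if_pos hIJ, map_smul, dT_gen, dT_gen, dT_gen]
    rcases hl : l j with _ | b <;> rcases hm : m j with _ | c
    · simp [hl, hm]
    · simp [hl, hm, mul_gen_gen, hIJ, update_add_right, mulCoeff_update_right, mulCoeff_eq l m j]
    · simp [hl, hm, mul_gen_gen, hIJ, update_add_left, mulCoeff_update_left, mulCoeff_eq l m j]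
    · simp only [Pi.add_apply, hl, hm, Nat.add_eq_zero_iff, Nat.succ_ne_zero, and_self, if_false,
        mul_gen_gen, hIJ, if_true, update_add_left, update_add_right, mulCoeff_update_left,
        mulCoeff_update_right, Nat.add_sub_cancel, mulCoeff_eq l m j]
      have e1 : b + 1 + (c + 1) - 1 = b + (c + 1) := by omega
      have e2 : b + 1 + c = b + (c + 1) := by omega
      have e3 : b + 1 + (c + 1) = (b + (c + 1)) + 1 := by omega
      rw [e1, e2, e3, ← add_smul, Nat.choose_succ_succ]
      congr 1
      push_cast
      ring
  · rw [mul_gen_gen, if_neg hIJ, map_zero, dT_gen, dT_gen]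
    split_ifs <;> simp [mul_gen_gen, hIJ]

/-- Peel one factor e_p off e_I: the anticommutator of ∂/∂e_i with e_p is δ_ip, and e_p passes
through the product by associativity, so the rule is inherited from the smaller set for arbitrary y.
-/
theorem dE_gen_mul (i : Fin n) (I : Finset (Fin n)) (l : Fin s → ℕ) (y : Total R n s) :
    dE R s i (mul R (gen R I l) y) =
      mul R (dE R s i (gen R I l)) y + (-1 : R) ^ I.card • mul R (gen R I l) (dE R s i y) := by
  induction I using Finset.induction_on generalizing y with
  | empty =>
    simp only [dE_gen, Finset.notMem_empty, if_false, map_zero, LinearMap.zero_apply, zero_add,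
      Finset.card_empty, pow_zero, one_smul]
    induction y using Total.induction with
    | zero => simp
    | add x x' hx hx' => simp only [map_add, hx, hx']
    | smul_gen r J m =>
      by_cases h : i ∈ J <;> 
        simp [mul_gen_gen, dE_gen, mulSgn_empty_left, h, smul_smul, mul_comm, mul_left_comm,
          mul_assoc]
  | insert p I hp ih =>
    have hgen : gen R (insert p I) l = sgn R p I • lE R s p (gen R I l) := by
      rw [lE_gen, if_neg hp, smul_smul, sgn_mul_self, one_smul]
    have hL : ∀ z, dE R s i (lE R s p z) =
        - lE R s p (dE R s i z) + (if p = i then (1 : R) else 0) • z := by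
      intro z
      split_ifs with h
      · subst h; rw [dE_lE_self, one_smul]; abel
      · rw [dE_lE i p (Ne.symm h), zero_smul, add_zero]
    rw [hgen, Finset.card_insert_of_notMem hp]
    simp only [map_smul, LinearMap.smul_apply, ← lE_mul, hL, ih, map_add, LinearMap.add_apply,
      map_neg, LinearMap.neg_apply]
    module

theorem neg_one_pow_degree (c : Cell n s) : (-1 : R) ^ c.degree = (-1) ^ c.1.card := by
  simp [Cell.degree, pow_add]

theorem dE_mul (i : Fin n) {q : ℕ} {x : Total R n s} (hx : x ∈ part R q) (y : Total R n s) :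
    dE R s i (mul R x y) =
      mul R (dE R s i x) y + (-1 : R) ^ q • mul R x (dE R s i y) := by
  have h : (dE R s i ∘ₗ (mul R).flip y - (mul R).flip y ∘ₗ dE R s i -
      (-1 : R) ^ q • (mul R).flip (dE R s i y)) x ∈ (⊥ : Submodule R (Total R n s)) := by
    refine map_mem_of_gen (fun c (hc : c.degree = q) => ?_) hx
    subst hc
    simp [dE_gen_mul, neg_one_pow_degree]
  rw [← sub_eq_zero, ← sub_sub]
  exact h

/-- Each ∂/∂e_i is an odd derivation. Each e_p ∂/∂t_j is an even derivation followed by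
multiplication by an odd element, and moving e_p past x produces the sign. -/
theorem tateD_mul (τ : Fin n → R) (a : Fin s → Fin n → R) {q : ℕ} {x : Total R n s}
    (hx : x ∈ part R q) (y : Total R n s) :
    tateD τ a (mul R x y) =
      mul R (tateD τ a x) y + (-1 : R) ^ q • mul R x (tateD τ a y) := by
  have h : ∀ (z : Total R n s) p, lE R s p (mul R x z) = (-1 : R) ^ q • mul R x (lE R s p z) := by
    intro z p
    rw [mul_lE p hx, smul_smul, ← mul_pow]; simp
  simp only [tateD_apply, dE_mul _ hx, dT_mul, map_add, h, ← lE_mul, map_sum, map_smul,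
    LinearMap.add_apply, LinearMap.sum_apply, LinearMap.smul_apply, smul_add,
    Finset.sum_add_distrib, Finset.smul_sum, smul_comm ((-1 : R) ^ q)]
  abel

theorem iSupIndep_part : iSupIndep (part R : ℕ → Submodule R (Total R n s)) := by
  rw [iSupIndep_def]
  intro i
  have : (⨆ (j) (_ : j ≠ i), part R j : Submodule R (Total R n s)) ≤
      Finsupp.supported R R {c | c.degree ≠ i} :=
    iSup₂_le fun j hj => Finsupp.supported_mono fun c (hc : c.degree = j) => by
      simpa [hc] using hj
  refine Disjoint.mono_right this (Finsupp.disjoint_supported_supported ?_)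
  rw [Set.disjoint_left]
  intro c hc hc'
  exact hc' hc

theorem iSup_part : ⨆ i, (part R i : Submodule R (Total R n s)) = ⊤ := by
  refine (Submodule.eq_top_iff'.2 fun x => ?_)
  induction x using Total.induction with
  | zero => exact zero_mem _
  | add x y hx hy => exact add_mem hx hy
  | smul_gen r I l =>
    exact Submodule.smul_mem _ _ (Submodule.mem_iSup_of_mem (Cell.degree (I, l))
      (gen_mem_supported rfl))

theorem isDGAlgebra_tateD (τ : Fin n → R) (a : Fin s → Fin n → R)
    (h : ∀ j, ∑ p, a j p * τ p = 0) :
    IsDGAlgebra (part R) (tateD τ a) (mul R) (gen R ∅ 0) where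
  independent := iSupIndep_part
  iSup_eq_top := iSup_part
  one_mem := gen_mem_supported (by change Cell.degree _ = 0; simp [Cell.degree])
  mul_mem _ _ _ hx _ hy := mul_mem_part hx hy
  mul_assoc := mul_assoc'
  one_mul := one_mul'
  mul_one := mul_one'
  graded_comm _ _ _ hx _ hy := mul_graded_comm hx hy
  sq_zero _ hi _ hx := mul_self_eq_zero_of_odd hi hx
  d_mem _ _ hx := tateD_part hx
  d_zero _ hx := tateD_part_zero hx
  d_d x := by simp [tateD_tateD, h]
  leibniz _ _ hx y := tateD_mul τ a hx y

end Product

/-! ### The differential of the statement is a Tate differential. -/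

section Diff

variable {k : Type*} [Field k] {n s : ℕ} (f : Fin s → MvPolynomial (Fin n) k)

/-- In e_I ∂(t^{(l)}) the factor e_p stands behind e_I. Moving it to the front costs (−1)^{|I|},
which cancels the sign of the Leibniz rule; what remains is e_p ∂/∂t_j without a sign. -/
theorem diff_eq_tateD : diff f = tateD (T f) fun j p => diffQuot f p (f j) := by
  refine Total.hom_ext fun I l => ?_
  rw [diff, linearCombination_gen, tateD_apply, dExt, dDiv]
  congr 1
  · simp only [map_sum, LinearMap.sum_apply, map_smul, LinearMap.smul_apply, dE_gen]
    rw [← Finset.sum_subset (Finset.subset_univ I)]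
    · refine Finset.sum_congr rfl fun i hi => ?_
      rw [if_pos hi, smul_smul, mul_gen_gen, if_pos (Finset.disjoint_empty_right _),
        mulSgn_empty_right]
      simp [mulCoeff, sgn, mul_comm]
    · intro i _ hi
      rw [if_neg hi, smul_zero]
  · simp only [map_sum, map_smul, Finset.smul_sum, dT_gen]
    rw [Finset.sum_filter]
    refine Finset.sum_congr rfl fun j _ => ?_
    by_cases hj : l j = 0
    · simp [hj]
    · rw [if_pos (Nat.pos_of_ne_zero hj)]
      refine Finset.sum_congr rfl fun p _ => ?_
      rw [if_neg hj, smul_comm]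
      congr 1
      have h1 : (-1 : Env k (Alg f)) ^ I.card = (-1) ^ (Cell.degree (I, (0 : Fin s → ℕ))) := by
        rw [neg_one_pow_degree]
      have h2 : gen (Env k (Alg f)) {p} (Function.update l j (l j - 1)) =
          lE _ s p (gen _ ∅ (Function.update l j (l j - 1))) := by
        simp [lE_gen, sgn]
      rw [h2, mul_lE p (i := Cell.degree (I, (0 : Fin s → ℕ))) (gen_mem_supported rfl), h1,
        smul_smul, ← mul_pow, mul_gen_gen, if_pos (Finset.disjoint_empty_right _),
        mulSgn_empty_right]
      simp [mulCoeff]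

end Diff

/-! ### Syzygies of regular sequences. -/

section RegularFamilies

variable {R : Type*} [CommRing R] {N : ℕ} {g : Fin N → R}

theorem mem_initialSpan_iff {m : ℕ} {r : R} : r ∈ initialSpan g m ↔
    ∃ c : Fin N → R, (∀ i : Fin N, m ≤ (i : ℕ) → c i = 0) ∧ ∑ i, c i * g i = r := by
  constructor
  · intro h
    induction h using Submodule.span_induction with
    | mem x h =>
      obtain ⟨i, hi, rfl⟩ := h
      refine ⟨Pi.single i 1, fun i' hi' => ?_, ?_⟩
      · rw [Pi.single_eq_of_ne]; rintro rfl; exact absurd hi hi'.not_gt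
      · rw [Finset.sum_eq_single i (fun b _ hb => by simp [hb]) (by simp)]; simp
    | zero => exact ⟨0, fun _ _ => rfl, by simp⟩
    | add x y _ _ hx hy =>
      obtain ⟨c, hc, rfl⟩ := hx
      obtain ⟨d, hd, rfl⟩ := hy
      exact ⟨c + d, fun i hi => by simp [hc i hi, hd i hi], by
        simp [add_mul, Finset.sum_add_distrib]⟩
    | smul t x _ hx =>
      obtain ⟨c, hc, rfl⟩ := hx
      exact ⟨fun i => t * c i, fun i hi => by simp [hc i hi], by
        simp [Finset.mul_sum, mul_assoc]⟩
  · rintro ⟨c, hc, rfl⟩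
    refine Ideal.sum_mem _ fun i _ => ?_
    by_cases hi : (i : ℕ) < m
    · exact Ideal.mul_mem_left _ _ (mem_initialSpan g hi)
    · rw [hc i (not_lt.1 hi), zero_mul]; exact Ideal.zero_mem _

/-- By regularity, the last coefficient a_j of a relation lies in the ideal of the earlier members,
say a_j = ∑ c_i g_i. Replacing a_i by a_i + c_i g_j absorbs the last term into a shorter relation,
to which induction applies; the correction c_i g_j lies in the larger ideal. -/
theorem syzygy_mem_initialSpan (hg : IsRegularFamily g) (m : ℕ) (hm : m ≤ N) (a : Fin N → R)
    (ha : ∀ i : Fin N, m ≤ (i : ℕ) → a i = 0) (h : ∑ i, a i * g i = 0) (i : Fin N) :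
    a i ∈ initialSpan g m := by
  induction m generalizing a i with
  | zero => rw [ha i (Nat.zero_le _)]; exact Ideal.zero_mem _
  | succ m ih =>
    set j : Fin N := ⟨m, hm⟩ with hj
    have hsplit : ∀ b : Fin N → R, ∑ i, b i * g i =
        b j * g j + ∑ i ∈ Finset.univ.erase j, b i * g i :=
      fun b => (Finset.add_sum_erase _ _ (Finset.mem_univ j)).symm
    have hm' : ∀ i : Fin N, i ≠ j → m ≤ (i : ℕ) → m + 1 ≤ (i : ℕ) := fun i hij hi =>
      Nat.lt_of_le_of_ne hi fun h' => hij (Fin.ext h'.symm)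
    have haj : a j ∈ initialSpan g m := by
      refine hg j _ (mem_initialSpan_iff.2 ⟨fun i => if i = j then 0 else - a i, fun i hi => ?_, ?_⟩)
      · by_cases hij : i = j
        · exact if_pos hij
        · simp only [hij, if_false, ha i (hm' i hij hi), neg_zero]
      · rw [hsplit] at h ⊢
        rw [if_pos rfl, zero_mul, zero_add, mul_comm, eq_neg_of_add_eq_zero_left h,
          ← Finset.sum_neg_distrib]
        refine Finset.sum_congr rfl fun i hi => ?_
        rw [if_neg (Finset.ne_of_mem_erase hi), neg_mul]
    obtain ⟨c, hc, hca⟩ := mem_initialSpan_iff.1 haj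
    have hle : initialSpan g m ≤ initialSpan g (m + 1) :=
      Ideal.span_mono (Set.image_mono fun _ (h : _ < _) => Nat.lt_succ_of_lt h)
    by_cases hij : i = j
    · rw [hij]; exact hle haj
    have key := ih (Nat.le_of_succ_le hm) (fun i => if i = j then 0 else a i + c i * g j)
      (fun i hi => by
        by_cases hij : i = j
        · exact if_pos hij
        · simp only [hij, if_false, ha i (hm' i hij hi), hc i hi, zero_mul, add_zero]) (by
        rw [hsplit] at h hca ⊢
        rw [hc j le_rfl, zero_mul, zero_add] at hca
        rw [if_pos rfl, zero_mul, zero_add, ← h, ← hca, Finset.sum_mul, ← Finset.sum_add_distrib]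
        refine Finset.sum_congr rfl fun i hi => ?_
        rw [if_neg (Finset.ne_of_mem_erase hi)]
        ring) i
    simp only [hij, if_false] at key
    have := sub_mem (hle key) (Ideal.mul_mem_left _ (c i) (mem_initialSpan g (Nat.lt_succ_self m) :
      g j ∈ initialSpan g (m + 1)))
    simpa using this

theorem IsRegularFamily.syzygy_mem (hg : IsRegularFamily g) {a : Fin N → R}
    (h : ∑ i, a i * g i = 0) (i : Fin N) : a i ∈ Ideal.span (Set.range g) := by
  rw [← initialSpan_top]
  exact syzygy_mem_initialSpan hg N le_rfl a (fun i hi => absurd i.2 hi.not_gt) h i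

theorem IsRegularFamily.map {R' : Type*} [CommRing R'] (hg : IsRegularFamily g) (e : R ≃+* R') :
    IsRegularFamily fun i => e (g i) := by
  intro j r hr
  have h : ∀ x, x ∈ Ideal.span ((fun i => e (g i)) '' {i | (i : ℕ) < j}) ↔
      e.symm x ∈ Ideal.span (g '' {i | (i : ℕ) < j}) := by
    intro x
    rw [show (fun i => e (g i)) '' {i | (i : ℕ) < j} = e '' (g '' {i | (i : ℕ) < j}) by
      rw [Set.image_image], ← Ideal.map_span, ← Ideal.comap_symm]
    rfl
  rw [h] at hr ⊢
  refine hg j _ ?_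
  simpa using hr

theorem isRegularFamily_of_isWeaklyRegular {rs : List R}
    (h : RingTheory.Sequence.IsWeaklyRegular R rs) : IsRegularFamily rs.get := by
  rw [RingTheory.Sequence.isWeaklyRegular_iff_Fin] at h
  intro j r hr
  have hS : Ideal.span (rs.get '' {i | (i : ℕ) < j}) =
      (Ideal.ofList (rs.take j) • ⊤ : Submodule R R) := by
    rw [Ideal.smul_eq_mul, Ideal.mul_top, Ideal.ofList]
    congr 1
    ext x
    simp only [Set.mem_image, Set.mem_ofPred, List.mem_take_iff_getElem]
    constructor
    · rintro ⟨i, hi, rfl⟩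
      exact ⟨i, by have := i.2; simp only [lt_inf_iff]; exact ⟨hi, this⟩, rfl⟩
    · rintro ⟨i, hi, rfl⟩
      simp only [lt_inf_iff] at hi
      exact ⟨⟨i, hi.2⟩, hi.1, rfl⟩
  rw [hS] at hr ⊢
  have h1 := h j
  refine (Submodule.Quotient.mk_eq_zero _).1 (h1 ?_)
  change rs[j] • (Submodule.Quotient.mk r : R ⧸ _) = rs[j] • 0
  rw [smul_zero, ← Submodule.Quotient.mk_smul, Submodule.Quotient.mk_eq_zero]
  exact hr

end RegularFamilies

/-! ### A complete intersection initial ideal has pairwise coprime leading monomials. -/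

section CompleteIntersection

variable {k : Type*} [Field k] {n s : ℕ}

/-- Write u = P r and r = Q u. Minimality of u gives P Q = 1 over k. Regularity of r gives Q P = 1
modulo the ideal I, hence also over k. So the matrices are square, and P Q = 1 modulo I as well. A
syzygy c of u yields the syzygy c P of r, whose entries lie in I; therefore c ≡ c P Q ≡ 0 modulo I.
-/
theorem syzygy_mem_of_isRegularFamily {S : Type*} [CommRing S] (ε : S →+* k) {N : ℕ}
    {r : Fin N → S} {u : Fin s → S} (hr : IsRegularFamily r)
    (hspan : Ideal.span (Set.range u) = Ideal.span (Set.range r)) (hε : ∀ j, ε (u j) = 0)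
    (hmin : ∀ c : Fin s → S, ∑ j, c j * u j = 0 → ∀ j, ε (c j) = 0) {c : Fin s → S}
    (hc : ∑ j, c j * u j = 0) (j : Fin s) : c j ∈ Ideal.span (Set.range u) := by
  set I := Ideal.span (Set.range u) with hI
  have hIε : ∀ x ∈ I, ε x = 0 := fun x hx => by
    have : I ≤ RingHom.ker ε := by
      rw [hI, Ideal.span_le]
      rintro _ ⟨j, rfl⟩
      exact hε j
    exact this hx
  have hP : ∀ j, ∃ p : Fin N → S, ∑ i, p i * r i = u j := fun j => by
    rw [← Ideal.mem_span_range_iff_exists_fun, ← hspan]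
    exact Ideal.subset_span ⟨j, rfl⟩
  have hQ : ∀ i, ∃ q : Fin s → S, ∑ j, q j * u j = r i := fun i => by
    rw [← Ideal.mem_span_range_iff_exists_fun, ← hI, hspan]
    exact Ideal.subset_span ⟨i, rfl⟩
  choose p hp using hP
  choose q hq using hQ
  let P : Matrix (Fin s) (Fin N) S := Matrix.of p
  let Q : Matrix (Fin N) (Fin s) S := Matrix.of q
  have hPQ : P.map ε * Q.map ε = 1 := by
    rw [← Matrix.map_mul]
    ext i j
    have h := hmin (fun j => (P * Q) i j - (1 : Matrix _ _ S) i j) (by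
      simp only [sub_mul, Finset.sum_sub_distrib, Matrix.mul_apply, Finset.sum_mul]
      rw [Finset.sum_comm]
      simp only [mul_assoc, ← Finset.mul_sum]
      simp [P, Q, hq, hp, Matrix.one_apply]) j
    rw [map_sub, sub_eq_zero] at h
    rw [Matrix.map_apply, h]
    simp [Matrix.one_apply, apply_ite ε]
  have hQP' : ∀ i i', (Q * P) i i' - (1 : Matrix _ _ S) i i' ∈ I := by
    intro i i'
    rw [hspan]
    refine hr.syzygy_mem (a := fun i' => (Q * P) i i' - (1 : Matrix _ _ S) i i') ?_ i'
    simp only [sub_mul, Finset.sum_sub_distrib, Matrix.mul_apply, Finset.sum_mul]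
    rw [Finset.sum_comm]
    simp only [mul_assoc, ← Finset.mul_sum]
    simp [P, Q, hq, hp, Matrix.one_apply]
  have hQP : Q.map ε * P.map ε = 1 := by
    rw [← Matrix.map_mul]
    ext i j
    have h := hIε _ (hQP' i j)
    rw [map_sub, sub_eq_zero] at h
    rw [Matrix.map_apply, h]
    simp [Matrix.one_apply, apply_ite ε]
  -- Inverse rectangular matrices over a field are square. Only then does a left inverse over the
  -- quotient by I become a two-sided one.
  have hcard : s = N := by
    simpa using Matrix.square_of_invertible (P.map ε) (Q.map ε) hPQ hQP
  subst hcard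
  let π := Ideal.Quotient.mk I
  have hQPI : Q.map π * P.map π = 1 := by
    rw [← Matrix.map_mul]
    ext i j
    rw [Matrix.map_apply, (Ideal.Quotient.mk_eq_mk_iff_sub_mem _ _).2 (hQP' i j)]
    simp [Matrix.one_apply, apply_ite π, π]
  have hPQI : P.map π * Q.map π = 1 := mul_eq_one_comm.1 hQPI
  have hcP : ∀ i, π ((Matrix.vecMul c P) i) = 0 := fun i => by
    rw [Ideal.Quotient.eq_zero_iff_mem, hspan]
    refine hr.syzygy_mem (a := Matrix.vecMul c P) ?_ i
    simp only [Matrix.vecMul, dotProduct, Finset.sum_mul]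
    rw [Finset.sum_comm]
    simp only [mul_assoc, ← Finset.mul_sum]
    simpa [P, hp] using hc
  rw [← Ideal.Quotient.eq_zero_iff_mem]
  have h1 : Matrix.vecMul (fun j => π (c j)) (P.map π) = 0 := by
    ext i
    rw [Pi.zero_apply, ← hcP i, RingHom.map_vecMul]
    rfl
  have h2 : Matrix.vecMul (Matrix.vecMul (fun j => π (c j)) (P.map π)) (Q.map π) =
      fun j => π (c j) := by
    rw [Matrix.vecMul_vecMul, hPQI, Matrix.vecMul_one]
  rw [h1, Matrix.zero_vecMul] at h2
  exact (congrFun h2 j).symm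

variable {f : Fin s → MvPolynomial (Fin n) k}

theorem IsReducedGroebnerBasis.eq_of_leadExp_le (hf : IsReducedGroebnerBasis f) {i j : Fin s}
    (h : leadExp (f i) ≤ leadExp (f j)) : i = j := by
  by_contra hij
  refine hf.reduced j i (Ne.symm hij) _ ?_ h
  rw [mem_support_iff, hf.monic]
  exact one_ne_zero

/-- With m the exponent of the gcd, the relation between the two leading monomials has coefficients
x^{γ_j − m} and −x^{γ_i − m}, and these must lie in the initial ideal. So some x^{γ_l} divides
x^{γ_i − m}; reducedness forces l = i, and then m = 0. -/
theorem leadExp_inf_eq_zero (hf : IsReducedGroebnerBasis f)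
    (hci : IsCompleteIntersection (initialIdeal (Ideal.span (Set.range f)))) {i j : Fin s}
    (hij : i ≠ j) : leadExp (f i) ⊓ leadExp (f j) = 0 := by
  classical
  obtain ⟨rs, hrs, hI⟩ := hci
  rw [← hf.span_lead] at hI
  set u : Fin s → MvPolynomial (Fin n) k := fun j => monomial (leadExp (f j)) 1 with hu
  have hmem : ∀ α, monomial α (1 : k) ∈ Ideal.span (Set.range u) → ∃ l, leadExp (f l) ≤ α := by
    intro α hα
    have hset : Set.range u = (fun β => monomial β (1 : k)) '' Set.range fun j => leadExp (f j) := by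
      rw [← Set.range_comp]; rfl
    rw [hset, mem_ideal_span_monomial_image] at hα
    obtain ⟨_, ⟨l, rfl⟩, hl⟩ := hα α (by rw [mem_support_iff, coeff_monomial, if_pos rfl]; simp)
    exact ⟨l, hl⟩
  have hspan : Ideal.span (Set.range u) = Ideal.span (Set.range rs.get) := by
    rw [← hI, Ideal.ofList]
    congr 1
    exact (Set.range_list_get rs).symm
  have hne : Ideal.span (Set.range u) ≠ ⊤ := by
    intro h
    have := hrs.top_ne_smul
    rw [hI, h] at this
    simp at this
  have h0 : ∀ j, leadExp (f j) ≠ 0 := by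
    intro j hj
    refine hne ((Ideal.eq_top_iff_one _).2 (Ideal.subset_span ⟨j, ?_⟩))
    simp [hu, hj]
  have key := fun c hc => syzygy_mem_of_isRegularFamily (u := u)
    (constantCoeff : MvPolynomial (Fin n) k →+* k)
    (isRegularFamily_of_isWeaklyRegular hrs.toIsWeaklyRegular) hspan
    (fun j => by simp [hu, constantCoeff_monomial, h0 j]) (fun c hc j => by
      -- Minimality of the generators: no other leading monomial divides x^{γ_j}, so the coefficient
      -- of x^{γ_j} in the relation is the constant term of c_j.
      have h1 := congrArg (coeff (leadExp (f j))) hc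
      rw [coeff_sum, Finset.sum_eq_single j] at h1
      · simpa [hu, coeff_mul_monomial', ← constantCoeff_eq] using h1
      · intro i _ hi
        rw [hu, coeff_mul_monomial', if_neg]
        exact fun h => hi (hf.eq_of_leadExp_le h)
      · simp) (c := c) hc
  set m := leadExp (f i) ⊓ leadExp (f j) with hm
  have hmi : m ≤ leadExp (f i) := inf_le_left
  have hmj : m ≤ leadExp (f j) := inf_le_right
  have h1 := key (fun l => if l = i then monomial (leadExp (f j) - m) 1 else
    if l = j then - monomial (leadExp (f i) - m) 1 else 0) (by
      rw [← Finset.add_sum_erase _ _ (Finset.mem_univ i), Finset.sum_eq_single j]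
      · simp only [if_true, hij.symm, if_false, hu, neg_mul, monomial_mul, mul_one]
        rw [tsub_add_eq_add_tsub hmj, tsub_add_eq_add_tsub hmi, add_comm (leadExp (f j)), add_neg_cancel]
      · intro b hb hbj
        simp [Finset.ne_of_mem_erase hb, hbj]
      · intro h
        exact absurd (Finset.mem_erase.2 ⟨hij.symm, Finset.mem_univ j⟩) h) j
  simp only [hij.symm, if_false, if_true] at h1
  obtain ⟨l, hl⟩ := hmem _ ((Ideal.neg_mem_iff _).1 h1)
  obtain rfl := hf.eq_of_leadExp_le (hl.trans tsub_le_self)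
  ext p
  have h2 := hl p
  have h3 := hmi p
  simp only [Finsupp.tsub_apply, Finsupp.zero_apply] at h2 ⊢
  omega

/-- Otherwise 1 would be the leading monomial of an element of the ideal, while an ideal generated
by a regular sequence is proper. -/
theorem Alg.nontrivial
    (hci : IsCompleteIntersection (initialIdeal (Ideal.span (Set.range f)))) :
    Nontrivial (Alg f) := by
  refine Ideal.Quotient.nontrivial_iff.2 fun h => ?_
  obtain ⟨rs, hrs, hI⟩ := hci
  have := hrs.top_ne_smul
  have h1 : (1 : MvPolynomial (Fin n) k) ∈ initialIdeal (Ideal.span (Set.range f)) := by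
    refine Ideal.subset_span ⟨1, by simp [h], one_ne_zero, ?_⟩
    simp [leadExp]
  rw [hI, (Ideal.eq_top_iff_one _).2 h1] at this
  simp at this

end CompleteIntersection

/-! ### Coprime leading monomials give a regular sequence. -/

section CoprimeLeads

variable {B : Type*} [CommRing B] {n s : ℕ} (mo : MonomialOrder (Fin n))
  {f : Fin s → MvPolynomial (Fin n) B}

theorem exists_sub_mem_initialSpan_reduced (hf : ∀ j, mo.leadingCoeff (f j) = 1) (m : ℕ)
    (h : MvPolynomial (Fin n) B) : ∃ r, h - r ∈ initialSpan f m ∧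
      ∀ c ∈ r.support, ∀ i : Fin s, (i : ℕ) < m → ¬ mo.degree (f i) ≤ c := by
  obtain ⟨q, r, h1, -, h3⟩ := mo.div (b := fun i : {i : Fin s // (i : ℕ) < m} => f i)
    (fun i => by rw [hf]; exact isUnit_one) h
  refine ⟨r, ?_, fun c hc i hi => h3 c hc ⟨i, hi⟩⟩
  rw [h1, add_sub_cancel_right, Finsupp.linearCombination_apply, Finsupp.sum]
  exact Ideal.sum_mem _ fun i _ => Ideal.mul_mem_left _ _ (mem_initialSpan f i.2)

theorem degree_mul_of_leadingCoeff_eq_one {r g : MvPolynomial (Fin n) B} (hr : r ≠ 0)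
    (hg : mo.leadingCoeff g = 1) : mo.degree (r * g) = mo.degree r + mo.degree g :=
  mo.degree_mul_of_right_mem_nonZeroDivisors hr (by rw [hg]; exact one_mem _)

theorem le_of_le_add_of_inf_eq_zero {α β γ : Fin n →₀ ℕ} (h : α ≤ β + γ) (h0 : α ⊓ γ = 0) :
    α ≤ β := by
  intro p
  have h1 := h p
  have h2 := DFunLike.congr_fun h0 p
  simp only [Finsupp.add_apply, Finsupp.inf_apply, Finsupp.zero_apply] at h1 h2
  omega

/-- Buchberger's coprimality criterion, by induction on the number of generators. Write h = h₂ + r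
f_j with h₂ in the smaller ideal and r reduced modulo the earlier f_i. The leading monomials of the
summands cannot agree: some γ_i would divide deg r + γ_j, hence deg r by coprimality, although r is
reduced. So one of the two leads h. -/
theorem exists_degree_le_of_mem_initialSpan (hf : ∀ j, mo.leadingCoeff (f j) = 1)
    (hcop : ∀ i j, i ≠ j → mo.degree (f i) ⊓ mo.degree (f j) = 0) (m : ℕ) (hm : m ≤ s)
    {h : MvPolynomial (Fin n) B} (hh : h ∈ initialSpan f m) (h0 : h ≠ 0) :
    ∃ i : Fin s, (i : ℕ) < m ∧ mo.degree (f i) ≤ mo.degree h := by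
  induction m generalizing h with
  | zero => simp [initialSpan] at hh; exact absurd hh h0
  | succ m ih =>
    set j : Fin s := ⟨m, hm⟩
    rw [initialSpan_succ f hm] at hh
    obtain ⟨h1, hh1, y, hy, rfl⟩ := Submodule.mem_sup.1 hh
    obtain ⟨q, rfl⟩ := Ideal.mem_span_singleton'.1 hy
    obtain ⟨r, hr, hred⟩ := exists_sub_mem_initialSpan_reduced mo hf m q
    have hd : h1 + q * f j = (h1 + (q - r) * f j) + r * f j := by ring
    have hmem : h1 + (q - r) * f j ∈ initialSpan f m := add_mem hh1 (Ideal.mul_mem_right _ _ hr)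
    change h1 + q * f j ≠ 0 at h0
    change ∃ i : Fin s, (i : ℕ) < m + 1 ∧ mo.degree (f i) ≤ mo.degree (h1 + q * f j)
    rw [hd] at h0 ⊢
    set h2 := h1 + (q - r) * f j with hh2
    by_cases hr0 : r = 0
    · rw [hr0, zero_mul, add_zero] at h0 ⊢
      obtain ⟨i, hi, hi'⟩ := ih (Nat.le_of_succ_le hm) hmem h0
      exact ⟨i, Nat.lt_succ_of_lt hi, hi'⟩
    have hdr := degree_mul_of_leadingCoeff_eq_one mo hr0 (hf j)
    by_cases hh20 : h2 = 0
    · rw [hh20, zero_add, hdr]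
      exact ⟨j, Nat.lt_succ_self m, le_add_self⟩
    obtain ⟨i, hi, hi'⟩ := ih (Nat.le_of_succ_le hm) hmem hh20
    have hne : mo.degree h2 ≠ mo.degree (r * f j) := by
      intro he
      rw [he, hdr] at hi'
      have hij : i ≠ j := by rintro rfl; exact lt_irrefl _ hi
      exact hred _ (mo.degree_mem_support hr0) i hi
        (le_of_le_add_of_inf_eq_zero hi' (hcop i j hij))
    rcases lt_or_gt_of_ne (fun h => hne (mo.toSyn.injective h)) with hlt | hlt
    · refine ⟨j, Nat.lt_succ_self m, ?_⟩
      rw [mo.degree_add_eq_right_of_lt hlt, hdr]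
      exact le_add_self
    · refine ⟨i, Nat.lt_succ_of_lt hi, ?_⟩
      rw [mo.degree_add_of_lt hlt]
      exact hi'

/-- Let r be the remainder of q modulo the earlier members. If r ≠ 0, the leading monomial of r f_j
is divisible by an earlier leading monomial, which by coprimality divides that of r; this
contradicts that r is reduced. -/
theorem isRegularFamily_of_coprime (hf : ∀ j, mo.leadingCoeff (f j) = 1)
    (hcop : ∀ i j, i ≠ j → mo.degree (f i) ⊓ mo.degree (f j) = 0) : IsRegularFamily f := by
  intro j q hq
  change q ∈ initialSpan f j
  change f j * q ∈ initialSpan f j at hq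
  obtain ⟨r, hr, hred⟩ := exists_sub_mem_initialSpan_reduced mo hf j q
  have hrf : r * f j ∈ initialSpan f j := by
    have := sub_mem hq (Ideal.mul_mem_right (f j) _ hr)
    convert this using 1
    ring
  suffices r = 0 by simpa [this] using hr
  by_contra hr0
  by_cases h0 : r * f j = 0
  · refine hr0 ?_
    have := mo.leadingCoeff_mul_of_right_mem_nonZeroDivisors (f := r) (g := f j)
      (by rw [hf]; exact one_mem _)
    rw [h0, hf, mul_one, mo.leadingCoeff_zero] at this
    exact mo.leadingCoeff_eq_zero_iff.1 this.symm
  obtain ⟨i, hi, hi'⟩ := exists_degree_le_of_mem_initialSpan mo hf hcop j j.2.le hrf h0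
  rw [degree_mul_of_leadingCoeff_eq_one mo hr0 (hf j)] at hi'
  have hij : i ≠ j := by rintro rfl; exact lt_irrefl _ hi
  exact hred _ (mo.degree_mem_support hr0) i hi (le_of_le_add_of_inf_eq_zero hi' (hcop i j hij))

/-- Membership is tested on monomials, and multiplication by x_j does not change the exponents of
the earlier variables. -/
theorem isRegularFamily_X : IsRegularFamily (X : Fin n → MvPolynomial (Fin n) B) := by
  intro j q hq
  rw [mem_ideal_span_X_image] at hq ⊢
  intro m hm
  obtain ⟨i, hi, him⟩ := hq (Finsupp.single j 1 + m) (by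
    rw [mem_support_iff, coeff_X_mul]
    exact mem_support_iff.1 hm)
  refine ⟨i, hi, ?_⟩
  have : i ≠ j := by rintro rfl; exact lt_irrefl (i : ℕ) hi
  simpa [Finsupp.single_apply, this.symm] using him

end CoprimeLeads

/-! ### Difference quotients of polynomials between two points. -/

section DifferenceQuotients

variable {k : Type*} [Field k] {n : ℕ} {R : Type*} [CommRing R] [Algebra k R]

/-- The `p`-th difference quotient of `g` between the points `u` and `v` of a `k`-algebra. -/
noncomputable def diffQuotAt (u v : Fin n → R) (p : Fin n) (g : MvPolynomial (Fin n) k) : R :=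
  ∑ α ∈ g.support, coeff α g • ∑ j ∈ Finset.range (α p),
    ((∏ i ∈ Finset.Iio p, u i ^ α i) * u p ^ j) *
      (v p ^ (α p - 1 - j) * ∏ i ∈ Finset.Ioi p, v i ^ α i)

theorem map_diffQuotAt {R' : Type*} [CommRing R'] [Algebra k R'] (φ : R →ₐ[k] R')
    (u v : Fin n → R) (p : Fin n) (g : MvPolynomial (Fin n) k) :
    φ (diffQuotAt u v p g) = diffQuotAt (fun i => φ (u i)) (fun i => φ (v i)) p g := by
  simp [diffQuotAt, map_sum, map_prod]

theorem prod_Iio_mul_Ioi (F : Fin n → R) (p : Fin n) :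
    (∏ i ∈ Finset.Iio p, F i) * F p * ∏ i ∈ Finset.Ioi p, F i = ∏ i, F i := by
  rw [← Finset.mul_prod_erase Finset.univ F (Finset.mem_univ p)]
  have : Finset.univ.erase p = Finset.Iio p ∪ Finset.Ioi p := by
    ext i; simp
  rw [this, Finset.prod_union]
  · ring
  · rw [Finset.disjoint_left]
    intro i hi hi'
    exact lt_asymm (Finset.mem_Iio.1 hi) (Finset.mem_Ioi.1 hi')

/-- One moves from v to u by replacing one coordinate at a time; the p-th step of this telescoping
sum is a geometric sum in u_p and v_p. -/
theorem sum_diffQuotAt_mul (u v : Fin n → R) (g : MvPolynomial (Fin n) k) :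
    ∑ p, diffQuotAt u v p g * (u p - v p) = aeval u g - aeval v g := by
  have hα : ∀ α : Fin n →₀ ℕ, ∑ p, (∑ j ∈ Finset.range (α p),
      ((∏ i ∈ Finset.Iio p, u i ^ α i) * u p ^ j) *
      (v p ^ (α p - 1 - j) * ∏ i ∈ Finset.Ioi p, v i ^ α i)) * (u p - v p) =
      ∏ i, u i ^ α i - ∏ i, v i ^ α i := by
    intro α
    -- The value of the monomial at the point whose first q coordinates are those of u and whose
    -- others are those of v.
    let W : ℕ → R := fun q => ∏ i : Fin n, (if (i : ℕ) < q then u i else v i) ^ α i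
    have hW : ∀ p : Fin n, (∑ j ∈ Finset.range (α p),
        ((∏ i ∈ Finset.Iio p, u i ^ α i) * u p ^ j) *
        (v p ^ (α p - 1 - j) * ∏ i ∈ Finset.Ioi p, v i ^ α i)) * (u p - v p) =
        W (p + 1) - W p := by
      intro p
      have h1 : ∀ q : ℕ, (p : ℕ) ≤ q → q ≤ p + 1 →
          W q = (∏ i ∈ Finset.Iio p, u i ^ α i) *
            (if (p : ℕ) < q then u p else v p) ^ α p * ∏ i ∈ Finset.Ioi p, v i ^ α i := by
        intro q hq hq'
        rw [show W q = ∏ i : Fin n, (if (i : ℕ) < q then u i else v i) ^ α i from rfl,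
          ← prod_Iio_mul_Ioi _ p]
        congr 1
        · congr 1
          refine Finset.prod_congr rfl fun i hi => ?_
          have : (i : ℕ) < p := Fin.lt_def.1 (Finset.mem_Iio.1 hi)
          rw [if_pos (by omega)]
        · refine Finset.prod_congr rfl fun i hi => ?_
          have : (p : ℕ) < i := Fin.lt_def.1 (Finset.mem_Ioi.1 hi)
          rw [if_neg (by omega)]
      rw [h1 _ (Nat.le_succ _) le_rfl, h1 _ le_rfl (Nat.le_succ _), if_pos (Nat.lt_succ_self _),
        if_neg (lt_irrefl _), ← sub_mul, ← mul_sub, ← geom_sum₂_mul, Finset.sum_mul,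
        Finset.sum_mul, Finset.mul_sum, Finset.sum_mul]
      exact Finset.sum_congr rfl fun j _ => by ring
    rw [Finset.sum_congr rfl fun p _ => hW p,
      Fin.sum_univ_eq_sum_range (fun q => W (q + 1) - W q) n, Finset.sum_range_sub]
    simp [W]
  simp only [diffQuotAt, Finset.sum_mul, smul_mul_assoc]
  rw [Finset.sum_comm]
  have hR : ∀ w : Fin n → R, aeval w g = ∑ α ∈ g.support, coeff α g • ∏ i, w i ^ α i := by
    intro w
    rw [aeval_eq_eval₂Hom, coe_eval₂Hom, eval₂_eq']
    simp [Algebra.smul_def]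
  rw [hR, hR, ← Finset.sum_sub_distrib]
  refine Finset.sum_congr rfl fun α _ => ?_
  rw [← Finset.smul_sum, ← smul_sub, ← hα]
  simp only [Finset.sum_mul]

/-- Since 0^0 = 1, a summand survives at the origin exactly when no variable is left after removing
one x_p, that is, for the monomial x_p. -/
theorem diffQuotAt_zero (p : Fin n) (g : MvPolynomial (Fin n) k) :
    diffQuotAt (0 : Fin n → R) 0 p g = algebraMap k R (coeff (Finsupp.single p 1) g) := by
  have h : ∀ α : Fin n →₀ ℕ, (∑ j ∈ Finset.range (α p),
      ((∏ i ∈ Finset.Iio p, (0 : R) ^ α i) * (0 : R) ^ j) *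
      ((0 : R) ^ (α p - 1 - j) * ∏ i ∈ Finset.Ioi p, (0 : R) ^ α i)) =
      if α = Finsupp.single p 1 then 1 else 0 := by
    intro α
    split_ifs with hα
    · subst hα
      have h1 : ∀ i ∈ Finset.Iio p, (0 : R) ^ (Finsupp.single p 1 i) = 1 := fun i hi => by
        rw [Finsupp.single_eq_of_ne (Finset.mem_Iio.1 hi).ne, pow_zero]
      have h2 : ∀ i ∈ Finset.Ioi p, (0 : R) ^ (Finsupp.single p 1 i) = 1 := fun i hi => by
        rw [Finsupp.single_eq_of_ne (Finset.mem_Ioi.1 hi).ne', pow_zero]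
      simp [Finset.prod_congr rfl h1, Finset.prod_congr rfl h2]
    · refine Finset.sum_eq_zero fun j hj => ?_
      have hj' := Finset.mem_range.1 hj
      by_cases h0 : j = 0 ∧ α p - 1 - j = 0
      · have h1 : α p = 1 := by omega
        obtain ⟨i, hi⟩ : ∃ i, α i ≠ Finsupp.single p 1 i := by
          by_contra! h
          exact hα (Finsupp.ext h)
        have hip : i ≠ p := by
          rintro rfl
          simp [h1] at hi
        rw [Finsupp.single_eq_of_ne hip] at hi
        rcases lt_or_gt_of_ne hip with h | h
        · rw [Finset.prod_eq_zero (Finset.mem_Iio.2 h) (zero_pow hi)]; simp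
        · rw [Finset.prod_eq_zero (Finset.mem_Ioi.2 h) (zero_pow hi)]; simp
      · rcases not_and_or.1 h0 with h | h
        · rw [zero_pow h]; simp
        · rw [zero_pow h]; simp
  simp only [diffQuotAt, Pi.zero_apply, h, smul_ite, smul_zero]
  rw [Finset.sum_ite_eq']
  split_ifs with h'
  · rw [Algebra.smul_def, mul_one]
  · rw [notMem_support_iff.1 h', map_zero]

end DifferenceQuotients

/-! ### The enveloping algebra as a coproduct of two copies of A. -/

section EnvelopingAlgebra

variable {k A : Type*} [Field k] [CommRing A] [Algebra k A]

variable (k A) in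
/-- The left inclusion `a ↦ a ⊗ 1`. -/
noncomputable def Env.inl : A →ₐ[k] Env k A :=
  (Algebra.TensorProduct.includeLeft : A →ₐ[k] A ⊗[k] Aᵐᵒᵖ)

variable (k A) in
/-- The right inclusion `a ↦ 1 ⊗ a`. -/
noncomputable def Env.inr : A →ₐ[k] Env k A :=
  (Algebra.TensorProduct.includeRight : Aᵐᵒᵖ →ₐ[k] A ⊗[k] Aᵐᵒᵖ).comp
    (AlgEquiv.toOpposite k A).toAlgHom

theorem Env.inl_apply (a : A) : Env.inl k A a = Env.tmul k a 1 := rfl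

theorem Env.inr_apply (a : A) : Env.inr k A a = Env.tmul k 1 a := rfl

theorem Env.tmul_eq (a b : A) : Env.tmul k a b = Env.inl k A a * Env.inr k A b := by
  rw [Env.inl_apply, Env.inr_apply, Env.tmul_mul_tmul, mul_one, mul_one]

theorem Env.induction {p : Env k A → Prop} (r : Env k A) (zero : p 0)
    (add : ∀ x y, p x → p y → p (x + y)) (tmul : ∀ a b, p (Env.tmul k a b)) : p r := by
  refine TensorProduct.induction_on (motive := p) r zero (fun a b => ?_) add
  exact tmul a b.unop

/-- The algebra homomorphism `a ⊗ b ↦ φ a * ψ b`. -/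
noncomputable def Env.lift {B : Type*} [CommRing B] [Algebra k B] (φ ψ : A →ₐ[k] B) :
    Env k A →ₐ[k] B :=
  (Algebra.TensorProduct.productMap φ (ψ.comp (AlgEquiv.toOpposite k A).symm.toAlgHom) :
    A ⊗[k] Aᵐᵒᵖ →ₐ[k] B)

theorem Env.lift_tmul {B : Type*} [CommRing B] [Algebra k B] (φ ψ : A →ₐ[k] B) (a b : A) :
    Env.lift φ ψ (Env.tmul k a b) = φ a * ψ b :=
  Algebra.TensorProduct.productMap_apply_tmul _ _ _ _

theorem Env.lift_inl {B : Type*} [CommRing B] [Algebra k B] (φ ψ : A →ₐ[k] B) (a : A) :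
    Env.lift φ ψ (Env.inl k A a) = φ a := by
  rw [Env.inl_apply, Env.lift_tmul, map_one, mul_one]

theorem Env.lift_inr {B : Type*} [CommRing B] [Algebra k B] (φ ψ : A →ₐ[k] B) (a : A) :
    Env.lift φ ψ (Env.inr k A a) = ψ a := by
  rw [Env.inr_apply, Env.lift_tmul, map_one, one_mul]

theorem Env.smul_eq (r : Env k A) (c : A) :
    r • c = Env.lift (AlgHom.id k A) (AlgHom.id k A) r * c := by
  induction r using Env.induction with
  | zero => rw [zero_smul, map_zero, zero_mul]
  | add x y hx hy => rw [add_smul, map_add, add_mul, hx, hy]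
  | tmul a b => rw [Env.tmul_smul, Env.lift_tmul, AlgHom.id_apply, AlgHom.id_apply]; ring

end EnvelopingAlgebra

/-! ### The complex is a free resolution of A. -/

section Resolution

variable {k : Type*} [Field k] {n s : ℕ} (f : Fin s → MvPolynomial (Fin n) k)

theorem T_eq (i : Fin n) :
    T f i = Env.inl k _ (cls f (X i)) - Env.inr k _ (cls f (X i)) := rfl

theorem diffQuot_eq (p : Fin n) (g : MvPolynomial (Fin n) k) :
    diffQuot f p g = diffQuotAt (fun i => Env.inl k _ (cls f (X i)))
      (fun i => Env.inr k _ (cls f (X i))) p g := by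
  simp [diffQuot, diffQuotAt, Env.tmul_eq, map_prod]

theorem cls_apply_eq_zero (j : Fin s) : cls f (f j) = 0 :=
  Ideal.Quotient.eq_zero_iff_mem.2 (Ideal.subset_span ⟨j, rfl⟩)

theorem cls_surjective : Function.Surjective (cls f) := Ideal.Quotient.mk_surjective

/-- The factorization through `A` of an algebra homomorphism which kills the `f j`. -/
noncomputable def Alg.lift {B : Type*} [CommRing B] [Algebra k B]
    (φ : MvPolynomial (Fin n) k →ₐ[k] B) (h : ∀ j, φ (f j) = 0) : Alg f →ₐ[k] B :=
  Ideal.Quotient.liftₐ (Ideal.span (Set.range f)) φ fun g hg => by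
    have hle : Ideal.span (Set.range f) ≤ RingHom.ker φ := by
      rw [Ideal.span_le]
      rintro _ ⟨j, rfl⟩
      exact h j
    exact hle hg

theorem Alg.lift_cls {B : Type*} [CommRing B] [Algebra k B]
    (φ : MvPolynomial (Fin n) k →ₐ[k] B) (h : ∀ j, φ (f j) = 0) (g : MvPolynomial (Fin n) k) :
    Alg.lift f φ h (cls f g) = φ g := rfl

theorem comp_cls_eq_aeval {B : Type*} [CommRing B] [Algebra k B] (φ : Alg f →ₐ[k] B) :
    φ.comp (cls f) = aeval fun i => φ (cls f (X i)) :=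
  MvPolynomial.algHom_ext fun i => by simp

theorem aeval_cls (φ : Alg f →ₐ[k] Env k (Alg f)) (j : Fin s) :
    aeval (fun i => φ (cls f (X i))) (f j) = 0 := by
  rw [← comp_cls_eq_aeval, AlgHom.comp_apply, cls_apply_eq_zero, map_zero]

theorem sum_diffQuot_mul_T (j : Fin s) : ∑ p, diffQuot f p (f j) * T f p = 0 := by
  simp only [diffQuot_eq, T_eq, sum_diffQuotAt_mul, aeval_cls, sub_self]

theorem isDGAlgebra_diff : IsDGAlgebra (part (Env k (Alg f))) (diff f) (mul (Env k (Alg f)))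
    (gen (Env k (Alg f)) ∅ 0) := by
  rw [diff_eq_tateD]
  exact isDGAlgebra_tateD _ _ (sum_diffQuot_mul_T f)

/-- The presentation of the enveloping algebra as a quotient of `A[x₁, ..., xₙ]`. -/
noncomputable def envPres : MvPolynomial (Fin n) (Alg f) →ₐ[k] Env k (Alg f) where
  toRingHom := eval₂Hom (Env.inl k (Alg f)).toRingHom fun i => Env.inr k _ (cls f (X i))
  commutes' r := by
    change eval₂Hom _ _ (C (algebraMap k (Alg f) r)) = _
    rw [coe_eval₂Hom, eval₂_C]
    exact (Env.inl k (Alg f)).commutes r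

theorem envPres_C (a : Alg f) : envPres f (C a) = Env.inl k _ a :=
  eval₂_C _ _ _

theorem envPres_X (i : Fin n) : envPres f (X i) = Env.inr k _ (cls f (X i)) :=
  eval₂_X _ _ _

/-- The coefficientwise inclusion `k[x] → A[x]`. -/
noncomputable def polyIncl : MvPolynomial (Fin n) k →ₐ[k] MvPolynomial (Fin n) (Alg f) :=
  MvPolynomial.mapAlgHom (Algebra.ofId k (Alg f))

theorem polyIncl_eq : polyIncl f = aeval X := MvPolynomial.algHom_ext fun i => by simp [polyIncl]

theorem envPres_polyIncl (g : MvPolynomial (Fin n) k) :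
    envPres f (polyIncl f g) = Env.inr k _ (cls f g) := by
  have : (envPres f).comp (polyIncl f) = (Env.inr k _).comp (cls f) :=
    MvPolynomial.algHom_ext fun i => by simp [polyIncl, envPres_X]
  exact DFunLike.congr_fun this g

theorem envPres_surjective : Function.Surjective (envPres f) := by
  intro r
  induction r using Env.induction with
  | zero => exact ⟨0, map_zero _⟩
  | add x y hx hy =>
    obtain ⟨u, rfl⟩ := hx
    obtain ⟨v, rfl⟩ := hy
    exact ⟨u + v, map_add _ _ _⟩
  | tmul a b =>
    obtain ⟨g, rfl⟩ := cls_surjective f b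
    exact ⟨C a * polyIncl f g, by rw [map_mul, envPres_C, envPres_polyIncl, Env.tmul_eq]⟩

/-- The coproduct property provides a map back to A[x]/J: constants on the left factor, x̄_i ↦ x_i
on the right one, which is well defined because J contains the f_j(x). Composed with the
presentation it is the quotient map, so nothing outside J is killed. -/
theorem ker_envPres : RingHom.ker (envPres f).toRingHom =
    Ideal.span (Set.range fun j => polyIncl f (f j)) := by
  set J := Ideal.span (Set.range fun j => polyIncl f (f j)) with hJ
  refine le_antisymm (fun p hp => ?_) ?_
  · let φ : Alg f →ₐ[k] MvPolynomial (Fin n) (Alg f) ⧸ J :=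
      (Ideal.Quotient.mkₐ k J).comp (IsScalarTower.toAlgHom k (Alg f) _)
    let ψ : Alg f →ₐ[k] MvPolynomial (Fin n) (Alg f) ⧸ J :=
      Alg.lift f ((Ideal.Quotient.mkₐ k J).comp (polyIncl f)) fun j =>
        Ideal.Quotient.eq_zero_iff_mem.2 (Ideal.subset_span ⟨j, rfl⟩)
    have h : (Env.lift φ ψ).toRingHom.comp (envPres f).toRingHom = Ideal.Quotient.mk J := by
      refine MvPolynomial.ringHom_ext (fun a => ?_) fun i => ?_
      · change Env.lift φ ψ (envPres f (C a)) = _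
        rw [envPres_C, Env.lift_inl]
        rfl
      · change Env.lift φ ψ (envPres f (X i)) = _
        rw [envPres_X, Env.lift_inr, show ψ (cls f (X i)) =
          (Ideal.Quotient.mkₐ k J).comp (polyIncl f) (X i) from Alg.lift_cls f _ _ _]
        simp [polyIncl]
    rw [← Ideal.Quotient.eq_zero_iff_mem, ← h, RingHom.comp_apply, (RingHom.mem_ker).1 hp,
      map_zero]
  · rw [hJ, Ideal.span_le]
    rintro _ ⟨j, rfl⟩
    change envPres f (polyIncl f (f j)) = 0
    rw [envPres_polyIncl, cls_apply_eq_zero, map_zero]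

theorem initialSpan_neg {R : Type*} [CommRing R] {N : ℕ} (g : Fin N → R) (m : ℕ) :
    initialSpan (fun i => - g i) m = initialSpan g m := by
  refine le_antisymm ?_ ?_ <;> rw [initialSpan, Ideal.span_le] <;> rintro _ ⟨j, hj, rfl⟩
  · exact (Ideal.neg_mem_iff _).2 (mem_initialSpan g hj)
  · exact (Ideal.neg_mem_iff _).1 (mem_initialSpan (fun i => - g i) hj)

theorem IsRegularFamily.neg {R : Type*} [CommRing R] {N : ℕ} {g : Fin N → R}
    (hg : IsRegularFamily g) : IsRegularFamily fun i => - g i := by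
  intro j r hr
  change r ∈ initialSpan _ _
  change _ ∈ initialSpan (fun i => - g i) _ at hr
  rw [initialSpan_neg] at hr ⊢
  refine hg j r ?_
  rw [neg_mul] at hr
  exact (Ideal.neg_mem_iff _).1 hr

/-- The coefficient map is injective and the leading coefficients are 1, so the leading monomials
survive in B[x]. It is needed for B = A (resolution of A) and B = k (resolution of k). -/
theorem isRegularFamily_map {B : Type*} [CommRing B] [Nontrivial B] [Algebra k B]
    {f : Fin s → MvPolynomial (Fin n) k} (hf : IsReducedGroebnerBasis f)
    (hci : IsCompleteIntersection (initialIdeal (Ideal.span (Set.range f)))) :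
    IsRegularFamily fun j => map (algebraMap k B) (f j) := by
  have hdeg : ∀ j, MonomialOrder.degLex.degree (map (algebraMap k B) (f j)) = leadExp (f j) := by
    intro j
    rw [leadExp, MonomialOrder.degree, MonomialOrder.degree,
      support_map_of_injective _ (algebraMap k B).injective]
  refine isRegularFamily_of_coprime MonomialOrder.degLex (fun j => ?_) fun i j hij => ?_
  · rw [MonomialOrder.leadingCoeff, hdeg, coeff_map, hf.monic, map_one]
  · rw [hdeg, hdeg]
    exact leadExp_inf_eq_zero hf hci hij

/-- The reflection `xᵢ ↦ aᵢ - xᵢ` of a polynomial ring. -/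
noncomputable def reflection {B : Type*} [CommRing B] (a : Fin n → B) :
    MvPolynomial (Fin n) B ≃ₐ[B] MvPolynomial (Fin n) B :=
  AlgEquiv.ofAlgHom (aeval fun i => C (a i) - X i) (aeval fun i => C (a i) - X i)
    (MvPolynomial.algHom_ext fun i => by simp [← algebraMap_eq])
    (MvPolynomial.algHom_ext fun i => by simp [← algebraMap_eq])

theorem isRegularFamily_C_sub_X {B : Type*} [CommRing B] (a : Fin n → B) :
    IsRegularFamily fun i => (C (a i) - X i : MvPolynomial (Fin n) B) := by
  have := isRegularFamily_X.map (reflection a).toRingEquiv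
  convert this using 2 with i
  simp [reflection]

theorem diff_exact {f : Fin s → MvPolynomial (Fin n) k} (hf : IsReducedGroebnerBasis f)
    (hci : IsCompleteIntersection (initialIdeal (Ideal.span (Set.range f)))) {q : ℕ}
    {x : Res f} (hx : x ∈ part (Env k (Alg f)) (q + 1)) (hd : diff f x = 0) :
    ∃ y ∈ part (Env k (Alg f)) (q + 2), diff f y = x := by
  have := Alg.nontrivial hci
  have h1 : T f = fun i => (envPres f).toRingHom (C (cls f (X i)) - X i) := by
    funext i
    change _ = envPres f _
    rw [map_sub, envPres_C, envPres_X, T_eq]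
  have h2 : (fun j p => diffQuot f p (f j)) = fun j p => (envPres f).toRingHom
      (diffQuotAt (fun i => C (cls f (X i))) (fun i => X i) p (f j)) := by
    funext j p
    change _ = envPres f _
    rw [map_diffQuotAt, diffQuot_eq]
    simp only [envPres_C, envPres_X]
  rw [diff_eq_tateD, h1, h2] at hd ⊢
  -- The sign in −f_j: the difference quotients between x̄ and x give f_j(x̄) − f_j(x), whose first
  -- term vanishes in A.
  refine tate_exact_quotient (envPres_surjective f) (g := fun j => - polyIncl f (f j)) ?_
    (isRegularFamily_C_sub_X _) (isRegularFamily_map hf hci).neg (fun j => ?_) hx hd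
  · rw [ker_envPres, ← initialSpan_top, ← initialSpan_top, initialSpan_neg]
  · rw [sum_diffQuotAt_mul, polyIncl_eq, sub_eq_neg_self]
    have : (aeval fun i => C (cls f (X i)) : MvPolynomial (Fin n) k →ₐ[k] _) =
        (IsScalarTower.toAlgHom k (Alg f) (MvPolynomial (Fin n) (Alg f))).comp (cls f) :=
      MvPolynomial.algHom_ext fun i => by simp [algebraMap_eq]
    rw [this, AlgHom.comp_apply, cls_apply_eq_zero, map_zero]

/-- Modulo the T(x_i) the two inclusions of A agree, so a ⊗ b ≡ ab ⊗ 1. Consequently the T(x_i)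
generate the kernel of the multiplication, which is exactness at F_0. -/
theorem inl_lift_sub_mem (r : Env k (Alg f)) :
    r - Env.inl k _ (Env.lift (AlgHom.id k _) (AlgHom.id k _) r) ∈
      Ideal.span (Set.range (T f)) := by
  set I := Ideal.span (Set.range (T f)) with hI
  have h : (Ideal.Quotient.mkₐ k I).comp ((Env.inl k _).comp (cls f)) =
      (Ideal.Quotient.mkₐ k I).comp ((Env.inr k _).comp (cls f)) := by
    refine MvPolynomial.algHom_ext fun i => ?_
    refine (Ideal.Quotient.mk_eq_mk_iff_sub_mem _ _).2 ?_
    exact Ideal.subset_span ⟨i, T_eq f i⟩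
  induction r using Env.induction with
  | zero => simp
  | add x y hx hy =>
    rw [map_add, map_add, add_sub_add_comm]
    exact add_mem hx hy
  | tmul a b =>
    obtain ⟨g, rfl⟩ := cls_surjective f b
    rw [Env.lift_tmul, map_mul, Env.tmul_eq, AlgHom.id_apply, AlgHom.id_apply, ← mul_sub]
    refine Ideal.mul_mem_left _ _ ((Ideal.Quotient.mk_eq_mk_iff_sub_mem _ _).1 ?_)
    exact (DFunLike.congr_fun h g).symm

theorem isFreeResolution_diff {f : Fin s → MvPolynomial (Fin n) k}
    (hf : IsReducedGroebnerBasis f)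
    (hci : IsCompleteIntersection (initialIdeal (Ideal.span (Set.range f)))) :
    IsFreeResolution (part (Env k (Alg f))) (diff f) (aug f) where
  free i := Module.Free.of_equiv (Finsupp.supportedEquivFinsupp _).symm
  d_mem i x hx := (isDGAlgebra_diff f).d_mem i x hx
  d_d x := (isDGAlgebra_diff f).d_d x
  exact i x hx hd := diff_exact hf hci hx hd
  aug_surjective a := ⟨Env.inl k _ a • gen _ ∅ 0, Submodule.smul_mem _ _
    (isDGAlgebra_diff f).one_mem, by
      rw [map_smul, aug, linearCombination_gen, if_pos rfl, Env.smul_eq, Env.lift_inl, mul_one]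
      rfl⟩
  aug_exact x hx := by
    have haug : ∀ r, aug f (r • gen _ ∅ 0) = Env.lift (AlgHom.id k _) (AlgHom.id k _) r := by
      intro r
      rw [map_smul, aug, linearCombination_gen, if_pos rfl, Env.smul_eq, mul_one]
    constructor
    · intro h
      rw [eq_smul_gen_of_mem_part_zero hx] at h ⊢
      rw [haug] at h
      have h1 := inl_lift_sub_mem f (x (∅, 0))
      rw [h, map_zero, sub_zero, ← initialSpan_top] at h1
      obtain ⟨y, hy, hyx⟩ := exists_tateD_eq_smul_gen (a := fun j p => diffQuot f p (f j)) h1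
      exact ⟨y, koszulCells_le_part _ _ hy, by rw [diff_eq_tateD, hyx]⟩
    · rintro ⟨y, hy, rfl⟩
      refine map_mem_of_gen (f := aug f ∘ₗ diff f) (P := ⊥)
        (fun c (hc : c.degree = 1) => ?_) hy
      obtain ⟨I, l⟩ := c
      simp only [Cell.degree] at hc
      have hl : l = 0 := by
        funext j
        have := Finset.single_le_sum (fun i _ => Nat.zero_le (l i)) (Finset.mem_univ j)
        simp only [Pi.zero_apply]
        omega
      subst hl
      obtain ⟨i, rfl⟩ := Finset.card_eq_one.1 (by simpa using hc : I.card = 1)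
      rw [LinearMap.comp_apply, diff_eq_tateD, tateD_gen_singleton, haug, T_eq, map_sub,
        Env.lift_inl, Env.lift_inr, sub_self]
      exact zero_mem _

end Resolution

/-! ### Coactions of a commutative monoid. -/

section Coaction

/-- The μ-component of ρ is the identity on 𝒱 μ and zero on every other part. No cancellation in M
is involved. -/
theorem iSupIndep_of_coaction {k M V : Type*} [Field k] [AddCommGroup V] [Module k V] {𝒱 : M → Submodule k V}
    (ρ : V →ₗ[k] (M →₀ V)) (hρ : ∀ μ, ∀ v ∈ 𝒱 μ, ρ v = Finsupp.single μ v) : iSupIndep 𝒱 := by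
  rw [iSupIndep_def]
  intro μ
  rw [Submodule.disjoint_def]
  intro v hv hv'
  have h : ρ v μ = 0 := by
    clear hv
    induction hv' using Submodule.iSup_induction' with
    | mem ν v hv =>
      by_cases hν : ν = μ
      · subst hν
        have hv0 : v = 0 := by simpa using hv
        rw [hv0, map_zero]; rfl
      · simp only [ne_eq, hν, not_false_eq_true, iSup_pos] at hv
        rw [hρ ν v hv, Finsupp.single_eq_of_ne (Ne.symm hν)]
    | zero => rw [map_zero]; rfl
    | add x y _ _ hx hy => rw [map_add, Finsupp.add_apply, hx, hy, add_zero]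
  rwa [hρ μ v hv, Finsupp.single_eq_same] at h

variable {k M : Type*} [Field k] [AddCommMonoid M] {n : ℕ} (w : Fin n → M) {B : Type*} [CommRing B] [Algebra k B] (u : Fin n → B)

/-- The algebra homomorphism `xᵢ ↦ x^{w i} uᵢ` into the monoid algebra. -/
noncomputable def coact : MvPolynomial (Fin n) k →ₐ[k] AddMonoidAlgebra B M :=
  aeval fun i => AddMonoidAlgebra.single (w i) (u i)

theorem coact_monomial (α : Fin n →₀ ℕ) (c : k) : coact w u (monomial α c) =
    AddMonoidAlgebra.single (Finsupp.weight w α) (aeval u (monomial α c)) := by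
  induction α using Finsupp.induction_linear generalizing c with
  | zero =>
    have h : (monomial 0 c : MvPolynomial (Fin n) k) = algebraMap k _ c := rfl
    rw [h, AlgHom.commutes, AlgHom.commutes, map_zero]
    rfl
  | add α β hα hβ =>
    have : (monomial (α + β) c : MvPolynomial (Fin n) k) = monomial α c * monomial β 1 := by
      rw [monomial_mul, mul_one]
    rw [this, map_mul, map_mul, hα, hβ, AddMonoidAlgebra.single_mul_single, map_add]
  | single i m =>
    have : (monomial (Finsupp.single i m) c : MvPolynomial (Fin n) k) = c • X i ^ m := by
      rw [X_pow_eq_monomial, smul_monomial, smul_eq_mul, mul_one]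
    rw [this, map_smul, map_smul, map_pow, map_pow, coact, aeval_X, aeval_X,
      AddMonoidAlgebra.single_pow, AddMonoidAlgebra.smul_single, Finsupp.weight_single]

theorem coact_of_isWeightedHomogeneous {g : MvPolynomial (Fin n) k} {μ : M}
    (hg : IsWeightedHomogeneous w g μ) :
    coact w u g = AddMonoidAlgebra.single μ (aeval u g) := by
  conv_lhs => rw [g.as_sum]
  conv_rhs => rw [g.as_sum]
  rw [map_sum, map_sum, ← AddMonoidAlgebra.singleAddHom_apply, map_sum]
  refine Finset.sum_congr rfl fun α hα => ?_
  rw [coact_monomial, hg (mem_support_iff.1 hα), AddMonoidAlgebra.singleAddHom_apply]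

end Coaction

/-! ### Gradings of free modules on weighted generators. -/

section GradedTotal

variable {k R M : Type*} [Field k] [CommRing R] [Algebra k R] [AddCommMonoid M]
  {ℛ : M → Submodule k R}

section Finsupp

variable {ι : Type*} {wt : ι → M}

variable (ℛ wt) in
/-- The homogeneous parts of the free module on generators of degrees `wt`. -/
noncomputable def totalPart (μ : M) : Submodule k (ι →₀ R) :=
  Submodule.span k {x | ∃ (c : ι) (ν : M), ν + wt c = μ ∧ ∃ r ∈ ℛ ν, x = Finsupp.single c r}

theorem single_mem_totalPart {ν μ : M} {r : R} (hr : r ∈ ℛ ν) {c : ι} (h : ν + wt c = μ) :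
    Finsupp.single c r ∈ totalPart ℛ wt μ :=
  Submodule.subset_span ⟨c, ν, h, r, hr, rfl⟩

theorem iSup_totalPart (h : ⨆ μ, ℛ μ = ⊤) : ⨆ μ, totalPart ℛ wt μ = ⊤ := by
  refine Submodule.eq_top_iff'.2 fun x => ?_
  induction x using Finsupp.induction_linear with
  | zero => exact zero_mem _
  | add x y hx hy => exact add_mem hx hy
  | single c r =>
    have hr : r ∈ ⨆ μ, ℛ μ := h ▸ Submodule.mem_top
    induction hr using Submodule.iSup_induction' with
    | mem ν r hr => exact Submodule.mem_iSup_of_mem _ (single_mem_totalPart hr rfl)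
    | zero => rw [Finsupp.single_zero]; exact zero_mem _
    | add r r' _ _ h h' => rw [Finsupp.single_add]; exact add_mem h h'

/-- On the summand of the generator c, the coaction of R is shifted by the degree of c. -/
theorem exists_totalPart_coaction {ρ : R →ₗ[k] (M →₀ R)}
    (hρ : ∀ μ, ∀ r ∈ ℛ μ, ρ r = Finsupp.single μ r) :
    ∃ σ : (ι →₀ R) →ₗ[k] (M →₀ (ι →₀ R)),
      ∀ μ, ∀ x ∈ totalPart ℛ wt μ, σ x = Finsupp.single μ x := by
  let F : (ι →₀ R) →ₗ[k] (M →₀ (ι →₀ R)) := Finsupp.lsum k fun c =>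
    Finsupp.mapRange.linearMap (Finsupp.lsingle c) ∘ₗ
      Finsupp.lmapDomain R k (fun ν => ν + wt c) ∘ₗ ρ
  refine ⟨F, fun μ x hx => ?_⟩
  have : totalPart ℛ wt μ ≤ LinearMap.eqLocus F (Finsupp.lsingle μ) := by
    rw [totalPart, Submodule.span_le]
    rintro _ ⟨c, ν, rfl, r, hr, rfl⟩
    simp only [SetLike.mem_coe, LinearMap.mem_eqLocus, F, Finsupp.lsum_single,
      LinearMap.comp_apply, hρ ν r hr, Finsupp.lmapDomain_apply, Finsupp.mapDomain_single,
      Finsupp.mapRange.linearMap_apply, Finsupp.mapRange_single, Finsupp.lsingle_apply]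
  exact this hx

theorem map_mem_of_totalPart_single {N : Type*} [AddCommGroup N] [Module k N]
    (F : (ι →₀ R) →ₗ[k] N) {P : Submodule k N} {μ : M}
    (h : ∀ c ν, ∀ r ∈ ℛ ν, ν + wt c = μ → F (Finsupp.single c r) ∈ P) {x : ι →₀ R}
    (hx : x ∈ totalPart ℛ wt μ) : F x ∈ P := by
  have : totalPart ℛ wt μ ≤ P.comap F := by
    rw [totalPart, Submodule.span_le]
    rintro _ ⟨c, ν, hν, r, hr, rfl⟩
    exact h c ν r hr hν
  exact this hx

theorem smul_mem_totalPart (hmul : ∀ μ ν, ∀ r ∈ ℛ μ, ∀ r' ∈ ℛ ν, r * r' ∈ ℛ (μ + ν)) {ν μ : M}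
    {r : R} (hr : r ∈ ℛ ν) {x : ι →₀ R} (hx : x ∈ totalPart ℛ wt μ) :
    r • x ∈ totalPart ℛ wt (ν + μ) := by
  refine map_mem_of_totalPart_single ((LinearMap.lsmul R (ι →₀ R) r).restrictScalars k)
    (fun c ν' r' hr' h => ?_) hx
  rw [LinearMap.restrictScalars_apply, LinearMap.lsmul_apply, Finsupp.smul_single, smul_eq_mul]
  exact single_mem_totalPart (hmul _ _ _ hr _ hr') (by rw [add_assoc, h])

end Finsupp

variable {n s : ℕ} {wt : Cell n s → M}

theorem smul_gen_mem_totalPart {ν μ : M} {r : R} (hr : r ∈ ℛ ν) {I : Finset (Fin n)}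
    {l : Fin s → ℕ} (h : ν + wt (I, l) = μ) : r • gen R I l ∈ totalPart ℛ wt μ := by
  have := single_mem_totalPart hr h
  rwa [single_eq_smul_gen] at this

theorem map_mem_of_totalPart {N : Type*} [AddCommGroup N] [Module R N] [Module k N]
    [IsScalarTower k R N] (F : Total R n s →ₗ[R] N) {P : Submodule k N} {μ : M}
    (h : ∀ I l ν, ∀ r ∈ ℛ ν, ν + wt (I, l) = μ → r • F (gen R I l) ∈ P) {x : Total R n s}
    (hx : x ∈ totalPart ℛ wt μ) : F x ∈ P :=
  map_mem_of_totalPart_single (F.restrictScalars k) (fun c ν r hr hν => by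
    rw [LinearMap.restrictScalars_apply, single_eq_smul_gen, map_smul]
    exact h c.1 c.2 ν r hr hν) hx

/-- The homogeneous parts are only k-subspaces; the sign preserves them because it comes from k. -/
theorem sgn_smul_mem {N : Type*} [AddCommGroup N] [Module R N] [Module k N]
    [IsScalarTower k R N] (P : Submodule k N) (i : Fin n) (I : Finset (Fin n)) {x : N}
    (hx : x ∈ P) : sgn R i I • x ∈ P := by
  have : sgn R i I = algebraMap k R (sgn k i I) := by simp [sgn]
  rw [this, algebraMap_smul]
  exact Submodule.smul_mem _ _ hx

/-- The degrees of the generators for degrees `w i` of `e_i` and `δ j` of `t_j`. -/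
def weightOf (w : Fin n → M) (δ : Fin s → M) (c : Cell n s) : M :=
  ∑ i ∈ c.1, w i + ∑ j, c.2 j • δ j

variable {w : Fin n → M} {δ : Fin s → M}

theorem weightOf_erase {I : Finset (Fin n)} {i : Fin n} (l : Fin s → ℕ) (h : i ∈ I) :
    w i + weightOf w δ (I.erase i, l) = weightOf w δ (I, l) := by
  simp only [weightOf]
  rw [← add_assoc, Finset.add_sum_erase _ _ h]

theorem weightOf_insert {I : Finset (Fin n)} {i : Fin n} (l : Fin s → ℕ) (h : i ∉ I) :
    weightOf w δ (insert i I, l) = w i + weightOf w δ (I, l) := by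
  simp only [weightOf]
  rw [Finset.sum_insert h, add_assoc]

theorem weightOf_succ (I : Finset (Fin n)) (l : Fin s → ℕ) (j : Fin s) :
    weightOf w δ (I, Function.update l j (l j + 1)) = δ j + weightOf w δ (I, l) := by
  simp only [weightOf]
  rw [add_left_comm]
  congr 1
  rw [← Finset.add_sum_erase _ _ (Finset.mem_univ j),
    ← Finset.add_sum_erase _ (fun j => l j • δ j) (Finset.mem_univ j), Function.update_self,
    succ_nsmul', add_assoc]
  congr 2
  refine Finset.sum_congr rfl fun i hi => ?_
  rw [Function.update_of_ne (Finset.ne_of_mem_erase hi)]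

theorem weightOf_pred (I : Finset (Fin n)) {l : Fin s → ℕ} {j : Fin s} (h : l j ≠ 0) :
    δ j + weightOf w δ (I, Function.update l j (l j - 1)) = weightOf w δ (I, l) := by
  rw [← weightOf_succ, Function.update_idem, Function.update_self,
    Nat.sub_add_cancel (Nat.pos_of_ne_zero h), Function.update_eq_self]

theorem weightOf_mul {I J : Finset (Fin n)} (l m : Fin s → ℕ) (h : Disjoint I J) :
    weightOf w δ (I ∪ J, l + m) = weightOf w δ (I, l) + weightOf w δ (J, m) := by
  simp only [weightOf, Finset.sum_union h, Pi.add_apply, add_smul, Finset.sum_add_distrib]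
  abel

/-- The degree of a j p ought to be δ j − w p. In a general monoid there may be several such ν or
none, hence the supremum over all ν with ν + w p = δ j. -/
theorem tateD_mem_totalPart (hmul : ∀ μ ν, ∀ r ∈ ℛ μ, ∀ r' ∈ ℛ ν, r * r' ∈ ℛ (μ + ν))
    {τ : Fin n → R} {a : Fin s → Fin n → R} (hτ : ∀ i, τ i ∈ ℛ (w i))
    (ha : ∀ j p, a j p ∈ ⨆ (ν : M) (_ : ν + w p = δ j), ℛ ν) {μ : M} {x : Total R n s}
    (hx : x ∈ totalPart ℛ (weightOf w δ) μ) : tateD τ a x ∈ totalPart ℛ (weightOf w δ) μ := by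
  refine map_mem_of_totalPart (tateD τ a) (fun I l ν r hr h => ?_) hx
  rw [tateD_apply, smul_add, Finset.smul_sum, Finset.smul_sum]
  refine add_mem (Submodule.sum_mem _ fun i _ => ?_) (Submodule.sum_mem _ fun j _ => ?_)
  · rw [dE_gen]
    split_ifs with hi
    · rw [smul_comm (τ i), smul_comm r]
      refine sgn_smul_mem _ i I ?_
      rw [smul_smul]
      refine smul_gen_mem_totalPart (hmul _ _ _ hr _ (hτ i)) ?_
      rw [add_assoc, weightOf_erase l hi, h]
    · simp
  · rw [Finset.smul_sum]
    refine Submodule.sum_mem _ fun p _ => ?_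
    rw [dT_gen]
    split_ifs with hj
    · simp
    rw [lE_gen]
    split_ifs with hp
    · simp
    rw [smul_comm (a j p), smul_comm r]
    refine sgn_smul_mem _ p I ?_
    have key : ∀ b ∈ ⨆ (ν : M) (_ : ν + w p = δ j), ℛ ν, r • b • gen R (insert p I)
        (Function.update l j (l j - 1)) ∈ totalPart ℛ (weightOf w δ) μ := by
      intro b hb
      induction hb using Submodule.iSup_induction' with
      | mem ν' b hb =>
        by_cases hν' : ν' + w p = δ j
        · rw [smul_smul]
          have hb' : b ∈ ℛ ν' := by simpa [hν'] using hb
          refine smul_gen_mem_totalPart (hmul _ _ _ hr _ hb') ?_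
          rw [weightOf_insert _ hp, ← h, ← weightOf_pred I hj, ← hν']
          abel
        · have hb' : b = 0 := by simpa [hν'] using hb
          simp [hb']
      | zero => simp
      | add x y _ _ hx hy => rw [add_smul, smul_add]; exact add_mem hx hy
    exact key _ (ha j p)

theorem mul_mem_totalPart (hmul : ∀ μ ν, ∀ r ∈ ℛ μ, ∀ r' ∈ ℛ ν, r * r' ∈ ℛ (μ + ν)) {μ ν : M}
    {x y : Total R n s} (hx : x ∈ totalPart ℛ (weightOf w δ) μ)
    (hy : y ∈ totalPart ℛ (weightOf w δ) ν) : mul R x y ∈ totalPart ℛ (weightOf w δ) (μ + ν) := by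
  refine map_mem_of_totalPart ((mul R).flip y) (fun I l μ' r hr h => ?_) hx
  refine map_mem_of_totalPart (r • mul R (gen R I l)) (fun J m ν' r' hr' h' => ?_) hy
  rw [LinearMap.smul_apply, mul_gen_gen]
  split_ifs with hIJ
  · have : (mulSgn R I J * mulCoeff l m : R) =
        algebraMap k R (mulSgn k I J * mulCoeff l m : k) := by simp [mulSgn]
    rw [this, algebraMap_smul, smul_comm r, smul_comm r']
    refine Submodule.smul_mem _ _ ?_
    rw [smul_smul]
    refine smul_gen_mem_totalPart (hmul _ _ _ hr' _ hr) ?_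
    rw [weightOf_mul l m hIJ, ← h, ← h']
    abel
  · simp

end GradedTotal

/-! ### Homogeneity of difference quotients. -/

section GradedRing

variable {k R M : Type*} [Field k] [CommRing R] [Algebra k R] [AddCommMonoid M] {n : ℕ}
  {ℛ : M → Submodule k R} {w : Fin n → M}

theorem prod_pow_mem (hone : 1 ∈ ℛ 0) (hmul : ∀ μ ν, ∀ r ∈ ℛ μ, ∀ r' ∈ ℛ ν, r * r' ∈ ℛ (μ + ν))
    {u : Fin n → R} (hu : ∀ i, u i ∈ ℛ (w i)) (α : Fin n → ℕ) (S : Finset (Fin n)) :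
    ∏ i ∈ S, u i ^ α i ∈ ℛ (∑ i ∈ S, α i • w i) := by
  have hpow : ∀ i m, u i ^ m ∈ ℛ (m • w i) := by
    intro i m
    induction m with
    | zero => simpa using hone
    | succ m ih => rw [pow_succ, succ_nsmul]; exact hmul _ _ _ ih _ (hu i)
  induction S using Finset.induction_on with
  | empty => simpa using hone
  | insert i S hi ih =>
    rw [Finset.prod_insert hi, Finset.sum_insert hi]
    exact hmul _ _ _ (hpow i _) _ ih

theorem pow_mem_nsmul (hone : 1 ∈ ℛ 0)
    (hmul : ∀ μ ν, ∀ r ∈ ℛ μ, ∀ r' ∈ ℛ ν, r * r' ∈ ℛ (μ + ν))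
    {u : Fin n → R} (hu : ∀ i, u i ∈ ℛ (w i)) (p : Fin n) (m : ℕ) : u p ^ m ∈ ℛ (m • w p) := by
  simpa using prod_pow_mem hone hmul hu (fun _ => m) {p}

theorem weight_eq_sum (α : Fin n →₀ ℕ) : Finsupp.weight w α = ∑ i, α i • w i := by
  rw [Finsupp.weight_apply, Finsupp.sum_fintype]
  simp

/-- Every summand is a monomial of g with one factor x_p removed, so its degree ν satisfies ν + w p
= d; distinct summands may have distinct ν if M is not cancellative. -/
theorem diffQuotAt_mem (hone : 1 ∈ ℛ 0)
    (hmul : ∀ μ ν, ∀ r ∈ ℛ μ, ∀ r' ∈ ℛ ν, r * r' ∈ ℛ (μ + ν))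
    {u v : Fin n → R} (hu : ∀ i, u i ∈ ℛ (w i)) (hv : ∀ i, v i ∈ ℛ (w i)) {d : M}
    {g : MvPolynomial (Fin n) k} (hg : IsWeightedHomogeneous w g d) (p : Fin n) :
    diffQuotAt u v p g ∈ ⨆ (ν : M) (_ : ν + w p = d), ℛ ν := by
  refine Submodule.sum_mem _ fun α hα => Submodule.smul_mem _ _
    (Submodule.sum_mem _ fun j hj => ?_)
  have hj' := Finset.mem_range.1 hj
  refine Submodule.mem_iSup_of_mem ((∑ i ∈ Finset.Iio p, α i • w i + j • w p) +
    ((α p - 1 - j) • w p + ∑ i ∈ Finset.Ioi p, α i • w i)) (Submodule.mem_iSup_of_mem ?_ ?_)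
  · rw [← hg (mem_support_iff.1 hα), weight_eq_sum]
    rw [← Finset.add_sum_erase Finset.univ _ (Finset.mem_univ p)]
    have h1 : Finset.univ.erase p = Finset.Iio p ∪ Finset.Ioi p := by
      ext i; simp
    have h2 : Disjoint (Finset.Iio p) (Finset.Ioi p) := by
      rw [Finset.disjoint_left]
      intro i hi hi'
      exact lt_asymm (Finset.mem_Iio.1 hi) (Finset.mem_Ioi.1 hi')
    have h3 : α p = j + (α p - 1 - j) + 1 := by omega
    rw [h1, Finset.sum_union h2]
    conv_rhs => rw [h3, add_smul, add_smul, one_smul]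
    abel
  · exact hmul _ _ _ (hmul _ _ _ (prod_pow_mem hone hmul hu _ _) _ (pow_mem_nsmul hone hmul hu _ _))
      _ (hmul _ _ _ (pow_mem_nsmul hone hmul hv _ _) _ (prod_pow_mem hone hmul hv _ _))

end GradedRing

/-! ### The multigrading of A, of the enveloping algebra and of the complex. -/

section Multigraded

variable {k : Type*} [Field k] {n s : ℕ} {M : Type*} [AddCommMonoid M]
  (f : Fin s → MvPolynomial (Fin n) k) (w : Fin n → M)

theorem one_mem_algPart : 1 ∈ algPart f w 0 :=
  ⟨1, isWeightedHomogeneous_one k w, map_one (cls f)⟩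

theorem mul_mem_algPart {μ ν : M} {a b : Alg f} (ha : a ∈ algPart f w μ)
    (hb : b ∈ algPart f w ν) : a * b ∈ algPart f w (μ + ν) := by
  obtain ⟨g, hg, rfl⟩ := ha
  obtain ⟨h, hh, rfl⟩ := hb
  exact ⟨g * h, IsWeightedHomogeneous.mul hg hh, map_mul (cls f) _ _⟩

theorem cls_X_mem_algPart (i : Fin n) : cls f (X i) ∈ algPart f w (w i) :=
  ⟨X i, isWeightedHomogeneous_X k w i, rfl⟩

theorem iSup_algPart : ⨆ μ, algPart f w μ = ⊤ := by
  refine Submodule.eq_top_iff'.2 fun a => ?_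
  obtain ⟨g, rfl⟩ := cls_surjective f a
  rw [g.as_sum, map_sum]
  exact Submodule.sum_mem _ fun α _ => Submodule.mem_iSup_of_mem (Finsupp.weight w α)
    ⟨_, isWeightedHomogeneous_monomial w α _ rfl, rfl⟩

theorem tmul_mem_envPart {μ ν : M} {a b : Alg f} (ha : a ∈ algPart f w μ)
    (hb : b ∈ algPart f w ν) : Env.tmul k a b ∈ envPart f w (μ + ν) :=
  Submodule.subset_span ⟨μ, ν, rfl, a, ha, b, hb, rfl⟩

theorem one_mem_envPart : 1 ∈ envPart f w 0 := by
  have := tmul_mem_envPart f w (one_mem_algPart f w) (one_mem_algPart f w)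
  rwa [add_zero, ← Env.one_def] at this

theorem mul_mem_envPart (μ ν : M) (r : Env k (Alg f)) (hr : r ∈ envPart f w μ)
    (r' : Env k (Alg f)) (hr' : r' ∈ envPart f w ν) : r * r' ∈ envPart f w (μ + ν) := by
  have h1 : envPart f w μ * envPart f w ν ≤ envPart f w (μ + ν) := by
    rw [envPart, envPart, Submodule.span_mul_span, Submodule.span_le]
    rintro _ ⟨_, ⟨μ₁, μ₂, rfl, a, ha, b, hb, rfl⟩, _, ⟨ν₁, ν₂, rfl, a', ha', b', hb', rfl⟩, rfl⟩
    simp only [SetLike.mem_coe, Env.tmul_mul_tmul]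
    rw [add_add_add_comm, add_comm μ₂]
    exact tmul_mem_envPart f w (mul_mem_algPart f w ha ha') (mul_mem_algPart f w hb' hb)
  exact h1 (Submodule.mul_mem_mul hr hr')

theorem inl_mem_envPart {μ : M} {a : Alg f} (ha : a ∈ algPart f w μ) :
    Env.inl k _ a ∈ envPart f w μ := by
  have := tmul_mem_envPart f w ha (one_mem_algPart f w)
  rwa [add_zero] at this

theorem inr_mem_envPart {μ : M} {a : Alg f} (ha : a ∈ algPart f w μ) :
    Env.inr k _ a ∈ envPart f w μ := by
  have := tmul_mem_envPart f w (one_mem_algPart f w) ha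
  rwa [zero_add] at this

theorem iSup_envPart : ⨆ μ, envPart f w μ = ⊤ := by
  refine Submodule.eq_top_iff'.2 fun r => ?_
  induction r using Env.induction with
  | zero => exact zero_mem _
  | add x y hx hy => exact add_mem hx hy
  | tmul a b =>
    have h1 : ∀ a, Env.inl k (Alg f) a ∈ ⨆ μ, envPart f w μ := fun a => by
      have ha : a ∈ ⨆ μ, algPart f w μ := iSup_algPart f w ▸ Submodule.mem_top
      induction ha using Submodule.iSup_induction' with
      | mem μ a ha => exact Submodule.mem_iSup_of_mem μ (inl_mem_envPart f w ha)
      | zero => rw [map_zero]; exact zero_mem _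
      | add x y _ _ hx hy => rw [map_add]; exact add_mem hx hy
    have h2 : ∀ b, Env.inr k (Alg f) b ∈ ⨆ μ, envPart f w μ := fun a => by
      have ha : a ∈ ⨆ μ, algPart f w μ := iSup_algPart f w ▸ Submodule.mem_top
      induction ha using Submodule.iSup_induction' with
      | mem μ a ha => exact Submodule.mem_iSup_of_mem μ (inr_mem_envPart f w ha)
      | zero => rw [map_zero]; exact zero_mem _
      | add x y _ _ hx hy => rw [map_add]; exact add_mem hx hy
    have h3 : ∀ x ∈ ⨆ μ, envPart f w μ, ∀ y ∈ ⨆ μ, envPart f w μ, x * y ∈ ⨆ μ, envPart f w μ := by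
      intro x hx y hy
      induction hx using Submodule.iSup_induction' with
      | mem μ x hx =>
        induction hy using Submodule.iSup_induction' with
        | mem ν y hy => exact Submodule.mem_iSup_of_mem _ (mul_mem_envPart f w _ _ x hx y hy)
        | zero => rw [mul_zero]; exact zero_mem _
        | add y z _ _ hy hz => rw [mul_add]; exact add_mem hy hz
      | zero => rw [zero_mul]; exact zero_mem _
      | add y z _ _ hy hz => rw [add_mul]; exact add_mem hy hz
    rw [Env.tmul_eq]
    exact h3 _ (h1 a) _ (h2 b)

variable {f w}

/-- Here the homogeneity of the relations enters: the coaction sends f_j to a single term whose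
coefficient is the image of the class of f_j, which is zero. Hence it descends to A. -/
theorem coact_apply_eq_zero {B : Type*} [CommRing B] [Algebra k B]
    (hw : ∀ j, IsWeightedHomogeneous w (f j) (Finsupp.weight w (leadExp (f j))))
    (φ : Alg f →ₐ[k] B) (j : Fin s) : coact w (fun i => φ (cls f (X i))) (f j) = 0 := by
  rw [coact_of_isWeightedHomogeneous w _ (hw j), ← comp_cls_eq_aeval, AlgHom.comp_apply,
    cls_apply_eq_zero, map_zero, AddMonoidAlgebra.single_zero]

/-- The coaction `a ↦ x^μ φ(a)`, for `a` of degree `μ`. -/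
noncomputable def algCoact {B : Type*} [CommRing B] [Algebra k B]
    (hw : ∀ j, IsWeightedHomogeneous w (f j) (Finsupp.weight w (leadExp (f j))))
    (φ : Alg f →ₐ[k] B) : Alg f →ₐ[k] AddMonoidAlgebra B M :=
  Alg.lift f (coact w fun i => φ (cls f (X i))) (coact_apply_eq_zero hw φ)

theorem algCoact_apply {B : Type*} [CommRing B] [Algebra k B]
    (hw : ∀ j, IsWeightedHomogeneous w (f j) (Finsupp.weight w (leadExp (f j))))
    (φ : Alg f →ₐ[k] B) {μ : M} {a : Alg f} (ha : a ∈ algPart f w μ) :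
    algCoact hw φ a = AddMonoidAlgebra.single μ (φ a) := by
  obtain ⟨g, hg, rfl⟩ := ha
  refine (coact_of_isWeightedHomogeneous w _ hg).trans ?_
  rw [← comp_cls_eq_aeval]
  rfl

/-- The coefficients of an element of the monoid algebra, as a linear map. -/
noncomputable def coeffLinear (k B M : Type*) [Field k] [CommRing B] [Algebra k B] :
    AddMonoidAlgebra B M →ₗ[k] (M →₀ B) where
  toFun := AddMonoidAlgebra.coeff
  map_add' _ _ := rfl
  map_smul' _ _ := rfl

theorem exists_algPart_coaction
    (hw : ∀ j, IsWeightedHomogeneous w (f j) (Finsupp.weight w (leadExp (f j)))) :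
    ∃ ρ : Alg f →ₗ[k] (M →₀ Alg f), ∀ μ, ∀ a ∈ algPart f w μ, ρ a = Finsupp.single μ a :=
  ⟨coeffLinear k (Alg f) M ∘ₗ (algCoact hw (AlgHom.id k _)).toLinearMap, fun μ a ha => by
    change (algCoact hw (AlgHom.id k _) a).coeff = _
    rw [algCoact_apply hw _ ha]
    rfl⟩

theorem exists_envPart_coaction
    (hw : ∀ j, IsWeightedHomogeneous w (f j) (Finsupp.weight w (leadExp (f j)))) :
    ∃ ρ : Env k (Alg f) →ₗ[k] (M →₀ Env k (Alg f)),
      ∀ μ, ∀ r ∈ envPart f w μ, ρ r = Finsupp.single μ r := by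
  let Φ := Env.lift (algCoact hw (Env.inl k (Alg f))) (algCoact hw (Env.inr k (Alg f)))
  let ρ := coeffLinear k (Env k (Alg f)) M ∘ₗ Φ.toLinearMap
  refine ⟨ρ, fun μ r hr => ?_⟩
  have : envPart f w μ ≤ LinearMap.eqLocus ρ (Finsupp.lsingle μ) := by
    rw [envPart, Submodule.span_le]
    rintro _ ⟨μ₁, μ₂, rfl, a, ha, b, hb, rfl⟩
    change (Φ (Env.tmul k a b)).coeff = _
    rw [Env.lift_tmul, algCoact_apply hw _ ha, algCoact_apply hw _ hb,
      AddMonoidAlgebra.single_mul_single, Env.tmul_eq]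
    rfl
  exact this hr

instance {A : Type*} [CommRing A] [Algebra k A] : IsScalarTower k (Env k A) A :=
  ⟨fun t r c => by rw [Env.smul_eq, Env.smul_eq, map_smul, smul_mul_assoc]⟩

theorem isMultigraded
    (hw : ∀ j, IsWeightedHomogeneous w (f j) (Finsupp.weight w (leadExp (f j)))) :
    IsMultigraded f w where
  alg_independent := by
    obtain ⟨ρ, hρ⟩ := exists_algPart_coaction hw
    exact iSupIndep_of_coaction ρ hρ
  alg_iSup := iSup_algPart f w
  res_independent := by
    obtain ⟨ρ, hρ⟩ := exists_envPart_coaction hw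
    obtain ⟨σ, hσ⟩ := exists_totalPart_coaction hρ
    exact iSupIndep_of_coaction σ hσ
  res_iSup := iSup_totalPart (iSup_envPart f w)
  smul_mem ν μ r hr x hx := smul_mem_totalPart (mul_mem_envPart f w) hr hx
  diff_mem μ x hx := by
    rw [diff_eq_tateD]
    refine tateD_mem_totalPart (mul_mem_envPart f w) (fun i => ?_) (fun j p => ?_) hx
    · exact sub_mem (inl_mem_envPart f w (cls_X_mem_algPart f w i))
        (inr_mem_envPart f w (cls_X_mem_algPart f w i))
    · rw [diffQuot_eq]
      exact diffQuotAt_mem (one_mem_envPart f w) (mul_mem_envPart f w)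
        (fun i => inl_mem_envPart f w (cls_X_mem_algPart f w i))
        (fun i => inr_mem_envPart f w (cls_X_mem_algPart f w i)) (hw j) p
  aug_mem μ x hx := by
    refine map_mem_of_totalPart (ℛ := envPart f w) (aug f) (fun I l ν r hr h => ?_) hx
    rw [aug, linearCombination_gen]
    split_ifs with hc
    · rw [hc] at h
      have h0 : ν = μ := by simpa [weightOf, cellWeight] using h
      subst h0
      rw [Env.smul_eq, mul_one]
      have : envPart f w ν ≤ (algPart f w ν).comap
          (Env.lift (AlgHom.id k (Alg f)) (AlgHom.id k (Alg f))).toLinearMap := by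
        rw [envPart, Submodule.span_le]
        rintro _ ⟨μ₁, μ₂, rfl, a, ha, b, hb, rfl⟩
        rw [SetLike.mem_coe, Submodule.mem_comap, AlgHom.toLinearMap_apply, Env.lift_tmul]
        exact mul_mem_algPart f w ha hb
      exact this hr
    · simp
  mul_mem μ ν x hx y hy := mul_mem_totalPart (mul_mem_envPart f w) hx hy

end Multigraded

/-! ### Minimality and linear terms. -/

section Minimality

variable {R : Type*} [CommRing R] {n s : ℕ}

theorem coeff_mem_of_mem_smul_top {I : Ideal R} {x : Total R n s}
    (hx : x ∈ I • (⊤ : Submodule R (Total R n s))) (c : Cell n s) : x c ∈ I := by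
  have h : I • (⊤ : Submodule R (Total R n s)) ≤ coeffIn I := by
    rw [Submodule.smul_le]
    intro r hr y _ c
    exact I.mul_mem_right _ hr
  exact h hx c

theorem tateD_mem_smul_top {I : Ideal R} {τ : Fin n → R} {a : Fin s → Fin n → R}
    (hτ : ∀ i, τ i ∈ I) (ha : ∀ j p, a j p ∈ I) (x : Total R n s) :
    tateD τ a x ∈ I • (⊤ : Submodule R (Total R n s)) := by
  rw [tateD_apply]
  exact add_mem (Submodule.sum_mem _ fun i _ => Submodule.smul_mem_smul (hτ i) trivial)
    (Submodule.sum_mem _ fun j _ => Submodule.sum_mem _ fun p _ =>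
      Submodule.smul_mem_smul (ha j p) trivial)

variable {k : Type*} [Field k] (f : Fin s → MvPolynomial (Fin n) k)

theorem inl_X_mem_augIdeal (i : Fin n) : Env.inl k _ (cls f (X i)) ∈ augIdeal f :=
  Ideal.subset_span (Or.inl ⟨i, rfl⟩)

theorem inr_X_mem_augIdeal (i : Fin n) : Env.inr k _ (cls f (X i)) ∈ augIdeal f :=
  Ideal.subset_span (Or.inr ⟨i, rfl⟩)

theorem diffQuot_mem_augIdeal {p : Fin n} {g : MvPolynomial (Fin n) k}
    (h : coeff (Finsupp.single p 1) g = 0) : diffQuot f p g ∈ augIdeal f := by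
  rw [← Ideal.Quotient.eq_zero_iff_mem, ← Ideal.Quotient.mkₐ_eq_mk k, diffQuot_eq, map_diffQuotAt]
  have h1 : (fun i => Ideal.Quotient.mkₐ k (augIdeal f) (Env.inl k _ (cls f (X i)))) = 0 :=
    funext fun i => Ideal.Quotient.eq_zero_iff_mem.2 (inl_X_mem_augIdeal f i)
  have h2 : (fun i => Ideal.Quotient.mkₐ k (augIdeal f) (Env.inr k _ (cls f (X i)))) = 0 :=
    funext fun i => Ideal.Quotient.eq_zero_iff_mem.2 (inr_X_mem_augIdeal f i)
  rw [h1, h2, diffQuotAt_zero, h, map_zero]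

theorem augmentation_cls (h₀ : ∀ j, constantCoeff (f j) = 0) (g : MvPolynomial (Fin n) k) :
    augmentation f h₀ (cls f g) = constantCoeff g := by
  have : augmentation f h₀ (cls f g) = aeval (fun _ => (0 : k)) g := rfl
  rw [this, aeval_zero']
  rfl

theorem augmentation_X (h₀ : ∀ j, constantCoeff (f j) = 0) (i : Fin n) :
    augmentation f h₀ (cls f (X i)) = 0 := by
  rw [augmentation_cls, constantCoeff_X]

theorem lift_augmentation_diffQuot (h₀ : ∀ j, constantCoeff (f j) = 0) (p : Fin n)
    (g : MvPolynomial (Fin n) k) :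
    Env.lift (augmentation f h₀) (augmentation f h₀) (diffQuot f p g) =
      coeff (Finsupp.single p 1) g := by
  rw [diffQuot_eq, map_diffQuotAt]
  simp only [Env.lift_inl, Env.lift_inr, augmentation_X]
  exact diffQuotAt_zero p g

theorem augIdeal_le_ker (h₀ : ∀ j, constantCoeff (f j) = 0) :
    augIdeal f ≤ RingHom.ker (Env.lift (augmentation f h₀) (augmentation f h₀)) := by
  rw [augIdeal, Ideal.span_le]
  rintro _ (⟨i, rfl⟩ | ⟨i, rfl⟩)
  · exact (Env.lift_inl _ _ _).trans (augmentation_X f h₀ i)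
  · exact (Env.lift_inr _ _ _).trans (augmentation_X f h₀ i)

/-- The coefficient of e_p in ∂t_j is a difference quotient of f_j, and ε ⊗ ε, which kills 𝔪, sends
it to the coefficient of x_p in f_j. Conversely, modulo 𝔪 the difference quotients are evaluated at
the origin, where they equal these coefficients. -/
theorem isMinimal_iff (h₀ : ∀ j, constantCoeff (f j) = 0) :
    IsMinimal f ↔ ∀ j p, coeff (Finsupp.single p 1) (f j) = 0 := by
  constructor
  · intro h j p
    have h1 := coeff_mem_of_mem_smul_top (h (gen _ ∅ (Function.update 0 j 1))) ({p}, 0)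
    rw [diff_eq_tateD, tateD_gen_t, Finsupp.finsetSum_apply, Finset.sum_eq_single p] at h1
    · have h2 := augIdeal_le_ker f h₀ h1
      rw [Finsupp.smul_apply, gen, Finsupp.single_eq_same, smul_eq_mul, mul_one,
        RingHom.mem_ker, lift_augmentation_diffQuot] at h2
      exact h2
    · intro q _ hq
      rw [Finsupp.smul_apply, gen, Finsupp.single_eq_of_ne, smul_zero]
      simpa [eq_comm] using hq
    · simp
  · intro h x
    rw [diff_eq_tateD]
    exact tateD_mem_smul_top
      (fun i => sub_mem (inl_X_mem_augIdeal f i) (inr_X_mem_augIdeal f i))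
      (fun j p => diffQuot_mem_augIdeal f (h j p)) x

end Minimality

/-! ### Comparison of graded free resolutions of k over A. -/

section Comparison

variable {k A M : Type*} [Field k] [CommRing A] [Algebra k A] [AddCommMonoid M]

/-- A graded free module `P = A ⊗ V` over a graded augmented algebra `A`, where `V` is a graded
vector space. -/
structure GradedFreeModule (ε : A →ₐ[k] k) (𝒜 : M → Submodule k A) (P V : Type*)
    [AddCommGroup P] [Module A P] [Module k P] [IsScalarTower k A P] [AddCommGroup V]
    [Module k V] where
  /-- The inclusion of the generators. -/
  ι : V →ₗ[k] P
  /-- The reduction modulo the augmentation ideal. -/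
  π : P →ₗ[k] V
  /-- The homogeneous parts of the module. -/
  parts : M → Submodule k P
  /-- The homogeneous parts of the space of generators. -/
  genParts : M → Submodule k V
  isBaseChange : IsBaseChange A ι
  π_smul : ∀ a x, π (a • x) = ε a • π x
  π_ι : ∀ v, π (ι v) = v
  ι_mem : ∀ μ, ∀ v ∈ genParts μ, ι v ∈ parts μ
  π_mem : ∀ μ, ∀ x ∈ parts μ, π x ∈ genParts μ
  smul_mem : ∀ ν μ, ∀ a ∈ 𝒜 ν, ∀ x ∈ parts μ, a • x ∈ parts (ν + μ)
  parts_le : ∀ μ, parts μ ≤ Submodule.span k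
    {x | ∃ ν μ', ν + μ' = μ ∧ ∃ a ∈ 𝒜 ν, ∃ v ∈ genParts μ', x = a • ι v}

variable {ε : A →ₐ[k] k} {𝒜 : M → Submodule k A}

namespace GradedFreeModule

variable {P V P' V' : Type*}
  [AddCommGroup P] [Module A P] [Module k P] [IsScalarTower k A P] [AddCommGroup V] [Module k V]
  [AddCommGroup P'] [Module A P'] [Module k P'] [IsScalarTower k A P'] [AddCommGroup V']
  [Module k V']
  (X : GradedFreeModule ε 𝒜 P V) (Y : GradedFreeModule ε 𝒜 P' V')

theorem map_mem (F : P →ₗ[A] P') (hF : ∀ μ, ∀ v ∈ X.genParts μ, F (X.ι v) ∈ Y.parts μ)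
    {μ : M} {x : P} (hx : x ∈ X.parts μ) : F x ∈ Y.parts μ := by
  have h : Submodule.span k {x | ∃ ν μ', ν + μ' = μ ∧ ∃ a ∈ 𝒜 ν, ∃ v ∈ X.genParts μ',
      x = a • X.ι v} ≤ (Y.parts μ).comap (F.restrictScalars k) := by
    rw [Submodule.span_le]
    rintro _ ⟨ν, μ', rfl, a, ha, v, hv, rfl⟩
    rw [SetLike.mem_coe, Submodule.mem_comap, LinearMap.restrictScalars_apply, map_smul]
    exact Y.smul_mem _ _ _ ha _ (hF _ _ hv)
  exact h (X.parts_le μ hx)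

/-- It suffices to compare the two sides on generators, because ε makes both of them semilinear.
Hence the reduction of F x depends only on that of x. -/
theorem π_map_eq (F : P →ₗ[A] P') (x : P) : Y.π (F x) = Y.π (F (X.ι (X.π x))) := by
  induction x using X.isBaseChange.inductionOn with
  | zero => simp only [map_zero]
  | tmul v => rw [X.π_ι]
  | smul a x h => rw [map_smul, Y.π_smul, X.π_smul, h, map_smul, LinearMap.map_smul_of_tower,
      map_smul]
  | add x y hx hy => rw [map_add, map_add, hx, hy, map_add, map_add, map_add, map_add]

/-- The reduction of a homomorphism of free modules. -/
noncomputable def reduce (F : P →ₗ[A] P') : V →ₗ[k] V' :=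
  Y.π ∘ₗ F.restrictScalars k ∘ₗ X.ι

end GradedFreeModule

/-- A graded free resolution of `k = A / ker ε`, with a contraction `h`. -/
structure GradedResolution {P V : ℕ → Type*} [∀ i, AddCommGroup (P i)] [∀ i, Module A (P i)]
    [∀ i, Module k (P i)] [∀ i, IsScalarTower k A (P i)] [∀ i, AddCommGroup (V i)]
    [∀ i, Module k (V i)] (X : ∀ i, GradedFreeModule ε 𝒜 (P i) (V i)) where
  /-- The differential. -/
  d : ∀ i, P (i + 1) →ₗ[A] P i
  /-- The contraction. -/
  h : ∀ i, P i →ₗ[k] P (i + 1)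
  d_mem : ∀ i μ, ∀ x ∈ (X (i + 1)).parts μ, d i x ∈ (X i).parts μ
  h_mem : ∀ i μ, ∀ x ∈ (X i).parts μ, h i x ∈ (X (i + 1)).parts μ
  d_d : ∀ i x, d i (d (i + 1) x) = 0
  π_d : ∀ x, (X 0).π (d 0 x) = 0
  d_h_zero : ∀ x, (X 0).π x = 0 → d 0 (h 0 x) = x
  d_h : ∀ i x, d i x = 0 → d (i + 1) (h (i + 1) x) = x

namespace GradedResolution

variable {P V P' V' : ℕ → Type*} [∀ i, AddCommGroup (P i)] [∀ i, Module A (P i)]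
    [∀ i, Module k (P i)] [∀ i, IsScalarTower k A (P i)] [∀ i, AddCommGroup (V i)]
    [∀ i, Module k (V i)] {X : ∀ i, GradedFreeModule ε 𝒜 (P i) (V i)}
    [∀ i, AddCommGroup (P' i)] [∀ i, Module A (P' i)]
    [∀ i, Module k (P' i)] [∀ i, IsScalarTower k A (P' i)] [∀ i, AddCommGroup (V' i)]
    [∀ i, Module k (V' i)] {Y : ∀ i, GradedFreeModule ε 𝒜 (P' i) (V' i)}
    (R : GradedResolution X) (S : GradedResolution Y)

/-- The morphism of resolutions extending a given map in degree zero. -/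
noncomputable def lift (f₀ : P 0 →ₗ[A] P' 0) : ∀ i, P i →ₗ[A] P' i
  | 0 => f₀
  | i + 1 => (X (i + 1)).isBaseChange.lift
      (S.h i ∘ₗ (lift f₀ i).restrictScalars k ∘ₗ (R.d i).restrictScalars k ∘ₗ (X (i + 1)).ι)

theorem lift_succ_ι (f₀ : P 0 →ₗ[A] P' 0) (i : ℕ) (v : V (i + 1)) :
    R.lift S f₀ (i + 1) ((X (i + 1)).ι v) = S.h i (R.lift S f₀ i (R.d i ((X (i + 1)).ι v))) :=
  IsBaseChange.lift_eq _ _ _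

theorem lift_mem {f₀ : P 0 →ₗ[A] P' 0} (h₀ : ∀ μ, ∀ x ∈ (X 0).parts μ, f₀ x ∈ (Y 0).parts μ)
    (i : ℕ) {μ : M} {x : P i} (hx : x ∈ (X i).parts μ) : R.lift S f₀ i x ∈ (Y i).parts μ := by
  induction i generalizing μ with
  | zero => exact h₀ μ x hx
  | succ i ih =>
    refine (X (i + 1)).map_mem (Y (i + 1)) _ (fun μ v hv => ?_) hx
    rw [lift_succ_ι]
    exact S.h_mem _ _ _ (ih (R.d_mem _ _ _ ((X (i + 1)).ι_mem _ _ hv)))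

/-- On a generator the lift contracts the image of its boundary. This image is a cycle by
commutativity one degree lower, so applying d to the contraction gives it back. -/
theorem d_lift {f₀ : P 0 →ₗ[A] P' 0} (h₀ : ∀ x, (X 0).π x = 0 → (Y 0).π (f₀ x) = 0) (i : ℕ)
    (x : P (i + 1)) : S.d i (R.lift S f₀ (i + 1) x) = R.lift S f₀ i (R.d i x) := by
  suffices S.d i ∘ₗ R.lift S f₀ (i + 1) = R.lift S f₀ i ∘ₗ R.d i from LinearMap.congr_fun this x
  induction i with
  | zero =>
    refine (X 1).isBaseChange.algHom_ext _ _ fun v => ?_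
    rw [LinearMap.comp_apply, lift_succ_ι, LinearMap.comp_apply]
    exact S.d_h_zero _ (h₀ _ (R.π_d _))
  | succ i ih =>
    refine (X (i + 2)).isBaseChange.algHom_ext _ _ fun v => ?_
    rw [LinearMap.comp_apply, lift_succ_ι, LinearMap.comp_apply]
    refine S.d_h _ _ ?_
    have := LinearMap.congr_fun (ih (R.d (i + 1) ((X (i + 2)).ι v))) (R.d (i + 1) ((X (i + 2)).ι v))
    rw [LinearMap.comp_apply, LinearMap.comp_apply, R.d_d, map_zero] at this
    exact this

/-- The homotopy between zero and a morphism of resolutions that vanishes in degree zero. -/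
noncomputable def homotopy (e : ∀ i, P i →ₗ[A] P' i) : ∀ i, P i →ₗ[A] P' (i + 1)
  | 0 => 0
  | i + 1 => (X (i + 1)).isBaseChange.lift (S.h (i + 1) ∘ₗ
      (e (i + 1) - homotopy e i ∘ₗ R.d i).restrictScalars k ∘ₗ (X (i + 1)).ι)

theorem homotopy_succ_ι (e : ∀ i, P i →ₗ[A] P' i) (i : ℕ) (v : V (i + 1)) :
    R.homotopy S e (i + 1) ((X (i + 1)).ι v) =
      S.h (i + 1) (e (i + 1) ((X (i + 1)).ι v) - R.homotopy S e i (R.d i ((X (i + 1)).ι v))) :=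
  IsBaseChange.lift_eq _ _ _

theorem homotopy_mem {e : ∀ i, P i →ₗ[A] P' i}
    (he : ∀ i μ, ∀ x ∈ (X i).parts μ, e i x ∈ (Y i).parts μ)
    (i : ℕ) {μ : M} {x : P i} (hx : x ∈ (X i).parts μ) :
    R.homotopy S e i x ∈ (Y (i + 1)).parts μ := by
  induction i generalizing μ with
  | zero => exact zero_mem _
  | succ i ih =>
    refine (X (i + 1)).map_mem (Y (i + 2)) _ (fun μ v hv => ?_) hx
    rw [homotopy_succ_ι]
    have h1 := (X (i + 1)).ι_mem _ _ hv
    exact S.h_mem _ _ _ (sub_mem (he _ _ _ h1) (ih (R.d_mem _ _ _ h1)))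

/-- The homotopy may start with zero because e vanishes in degree zero. Above that, the error e − ηd
is a cycle on generators by the previous degree, and contracting it defines the next η. -/
theorem homotopy_spec {e : ∀ i, P i →ₗ[A] P' i} (e_zero : e 0 = 0)
    (he : ∀ i x, S.d i (e (i + 1) x) = e i (R.d i x)) (i : ℕ) (x : P (i + 1)) :
    e (i + 1) x = S.d (i + 1) (R.homotopy S e (i + 1) x) + R.homotopy S e i (R.d i x) := by
  suffices e (i + 1) = S.d (i + 1) ∘ₗ R.homotopy S e (i + 1) + R.homotopy S e i ∘ₗ R.d i from
    LinearMap.congr_fun this x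
  have key : ∀ i v, S.d i (e (i + 1) ((X (i + 1)).ι v) -
      R.homotopy S e i (R.d i ((X (i + 1)).ι v))) = 0 →
      e (i + 1) ((X (i + 1)).ι v) = S.d (i + 1) (R.homotopy S e (i + 1) ((X (i + 1)).ι v)) +
        R.homotopy S e i (R.d i ((X (i + 1)).ι v)) := by
    intro i v h
    rw [homotopy_succ_ι, S.d_h _ _ h, sub_add_cancel]
  induction i with
  | zero =>
    refine (X 1).isBaseChange.algHom_ext _ _ fun v => key 0 v ?_
    have : R.homotopy S e 0 = 0 := rfl
    rw [this, LinearMap.zero_apply, sub_zero, he, e_zero, LinearMap.zero_apply]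
  | succ i ih =>
    refine (X (i + 2)).isBaseChange.algHom_ext _ _ fun v => key (i + 1) v ?_
    have := LinearMap.congr_fun (ih (R.d (i + 1) ((X (i + 2)).ι v))) (R.d (i + 1) ((X (i + 2)).ι v))
    rw [LinearMap.add_apply, LinearMap.comp_apply, LinearMap.comp_apply, R.d_d, map_zero,
      add_zero] at this
    rw [map_sub, he, this, sub_self]

/-- The cycles of the reduced complex. -/
noncomputable def cycles (R : GradedResolution X) : ∀ i, Submodule k (V i)
  | 0 => ⊤
  | i + 1 => LinearMap.ker ((X (i + 1)).reduce (X i) (R.d i))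

theorem sub_lift_lift_eq {f₀ : P 0 →ₗ[A] P' 0} {g₀ : P' 0 →ₗ[A] P 0}
    (hf : ∀ x, (X 0).π x = 0 → (Y 0).π (f₀ x) = 0) (hg : ∀ y, (Y 0).π y = 0 → (X 0).π (g₀ y) = 0)
    (hgf : ∀ x, g₀ (f₀ x) = x)
    (hf' : ∀ μ, ∀ x ∈ (X 0).parts μ, f₀ x ∈ (Y 0).parts μ)
    (hg' : ∀ μ, ∀ y ∈ (Y 0).parts μ, g₀ y ∈ (X 0).parts μ) :
    ∃ η : ∀ i, P i →ₗ[A] P (i + 1),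
      (∀ i μ, ∀ x ∈ (X i).parts μ, η i x ∈ (X (i + 1)).parts μ) ∧
      ∀ i x, x - S.lift R g₀ (i + 1) (R.lift S f₀ (i + 1) x) =
        R.d (i + 1) (η (i + 1) x) + η i (R.d i x) := by
  let e : ∀ i, P i →ₗ[A] P i := fun i => LinearMap.id - S.lift R g₀ i ∘ₗ R.lift S f₀ i
  have he : ∀ i x, e i x = x - S.lift R g₀ i (R.lift S f₀ i x) := fun i x => rfl
  refine ⟨R.homotopy R e, fun i μ x hx => R.homotopy_mem R (fun i μ x hx => ?_) i hx,
    fun i x => ?_⟩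
  · rw [he]
    exact sub_mem hx (S.lift_mem R hg' i (R.lift_mem S hf' i hx))
  · rw [← he]
    refine R.homotopy_spec R (LinearMap.ext fun x => ?_) (fun i x => ?_) i x
    · rw [he]
      exact sub_eq_zero.2 (hgf x).symm
    · rw [he, he, map_sub, S.d_lift R hg, R.d_lift S hf]

/-- The reduction of Y has zero differential, so its homology is its space of generators. Let Φ and
Ψ be the reductions of the two lifts. Both terms of the homotopy on Y reduce to zero, so Φ Ψ = id;
on X, the homotopy makes z − Ψ Φ z a boundary for every cycle z. The lifts and the homotopy on X are
homogeneous, so this works in each degree μ. -/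
theorem nonempty_homology_equiv {f₀ : P 0 →ₗ[A] P' 0} {g₀ : P' 0 →ₗ[A] P 0}
    (hf : ∀ x, (X 0).π x = 0 → (Y 0).π (f₀ x) = 0) (hg : ∀ y, (Y 0).π y = 0 → (X 0).π (g₀ y) = 0)
    (hgf : ∀ x, g₀ (f₀ x) = x) (hfg : ∀ y, f₀ (g₀ y) = y)
    (hf' : ∀ μ, ∀ x ∈ (X 0).parts μ, f₀ x ∈ (Y 0).parts μ)
    (hg' : ∀ μ, ∀ y ∈ (Y 0).parts μ, g₀ y ∈ (X 0).parts μ)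
    (hS : ∀ i y, (Y i).π (S.d i y) = 0) (i : ℕ) (μ : M) :
    Nonempty ((↥(R.cycles i ⊓ (X i).genParts μ) ⧸
      (((X (i + 1)).genParts μ).map ((X (i + 1)).reduce (X i) (R.d i))).submoduleOf
        (R.cycles i ⊓ (X i).genParts μ)) ≃ₗ[k] (Y i).genParts μ) := by
  obtain ⟨η, hη, hη'⟩ := R.sub_lift_lift_eq S hf hg hgf hf' hg'
  obtain ⟨θ, -, hθ'⟩ := S.sub_lift_lift_eq R hg hf hfg hg' hf'
  let Φ := (X i).reduce (Y i) (R.lift S f₀ i)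
  let Ψ := (Y i).reduce (X i) (S.lift R g₀ i)
  have hΦ : ∀ v, Φ v = (Y i).π (R.lift S f₀ i ((X i).ι v)) := fun v => rfl
  have hΨ : ∀ v, Ψ v = (X i).π (S.lift R g₀ i ((Y i).ι v)) := fun v => rfl
  have hΦ_mem : ∀ v ∈ (X i).genParts μ, Φ v ∈ (Y i).genParts μ := fun v hv =>
    (Y i).π_mem _ _ (R.lift_mem S hf' i ((X i).ι_mem _ _ hv))
  have hΨ_mem : ∀ v ∈ (Y i).genParts μ, Ψ v ∈ (X i).genParts μ := fun v hv =>
    (X i).π_mem _ _ (S.lift_mem R hg' i ((Y i).ι_mem _ _ hv))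
  have hΦΨ : ∀ v, Φ (Ψ v) = (Y i).π (R.lift S f₀ i (S.lift R g₀ i ((Y i).ι v))) := fun v => by
    rw [hΦ, hΨ, ← (X i).π_map_eq]
  have hΨΦ : ∀ v, Ψ (Φ v) = (X i).π (S.lift R g₀ i (R.lift S f₀ i ((X i).ι v))) := fun v => by
    rw [hΦ, hΨ, ← (Y i).π_map_eq]
  have hΨ_cyc : ∀ v, Ψ v ∈ R.cycles i := by
    intro v
    cases i with
    | zero => exact Submodule.mem_top
    | succ i =>
      change (X i).π (R.d i ((X (i + 1)).ι (Ψ v))) = 0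
      rw [hΨ, ← (X (i + 1)).π_map_eq, S.d_lift R hg, (Y i).π_map_eq, hS, map_zero, map_zero,
        map_zero]
  have hΦΨ_id : ∀ v, Φ (Ψ v) = v := by
    intro v
    rw [hΦΨ]
    -- The homotopy formula is available only in positive degrees; in degree zero the maps are
    -- inverse to each other on the nose.
    cases i with
    | zero => exact (congrArg _ (hfg _)).trans ((Y 0).π_ι v)
    | succ i =>
      have h := congrArg (Y (i + 1)).π (hθ' i ((Y (i + 1)).ι v))
      rw [map_sub, map_add, hS, (Y i).π_map_eq, hS, map_zero, map_zero, map_zero, add_zero,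
        (Y (i + 1)).π_ι, sub_eq_zero] at h
      exact h.symm
  let B := ((X (i + 1)).genParts μ).map ((X (i + 1)).reduce (X i) (R.d i))
  let Z := R.cycles i ⊓ (X i).genParts μ
  let F : Z →ₗ[k] (Y i).genParts μ := (Φ ∘ₗ Z.subtype).codRestrict _ fun z => hΦ_mem _ z.2.2
  have hF_surj : Function.Surjective F := fun v =>
    ⟨⟨Ψ v, hΨ_cyc v, hΨ_mem _ v.2⟩, Subtype.ext (hΦΨ_id v)⟩
  have hF_ker : LinearMap.ker F = B.submoduleOf Z := by
    ext ⟨z, hz, hzμ⟩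
    rw [LinearMap.mem_ker, Submodule.submoduleOf, Submodule.mem_comap]
    constructor
    · intro h0
      have h0 : Φ z = 0 := congrArg Subtype.val h0
      have h1 := hΨΦ z
      rw [h0, map_zero] at h1
      cases i with
      | zero =>
        have h2 : (X 0).π (S.lift R g₀ 0 (R.lift S f₀ 0 ((X 0).ι z))) = z :=
          (congrArg _ (hgf _)).trans ((X 0).π_ι z)
        rw [h2] at h1
        change z ∈ B
        rw [← h1]
        exact zero_mem B
      | succ i =>
        refine ⟨(X (i + 2)).π (η (i + 1) ((X (i + 1)).ι z)),
          (X (i + 2)).π_mem _ _ (hη _ _ _ ((X (i + 1)).ι_mem _ _ hzμ)), ?_⟩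
        change (X (i + 1)).π (R.d (i + 1) ((X (i + 2)).ι _)) = z
        have h2 : (X i).π (R.d i ((X (i + 1)).ι z)) = 0 := hz
        have h := congrArg (X (i + 1)).π (hη' i ((X (i + 1)).ι z))
        rw [map_sub, map_add, ← h1, (X i).π_map_eq (X (i + 1)) (η i), h2, map_zero, map_zero,
          map_zero, add_zero, sub_zero, (X (i + 1)).π_ι] at h
        rw [← (X (i + 2)).π_map_eq, ← h]
    · rintro ⟨u, hu, h⟩
      refine Subtype.ext ?_
      change Φ z = 0
      change (X i).π (R.d i ((X (i + 1)).ι u)) = z at h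
      rw [hΦ, ← h, ← (X i).π_map_eq, ← R.d_lift S hf, hS]
  exact ⟨(Submodule.quotEquivOfEq _ _ hF_ker.symm).trans (F.quotKerEquivOfSurjective hF_surj)⟩

end GradedResolution

end Comparison

/-! ### The bar resolution and the Hochschild complex as its reduction. -/

section Bar

variable {k A : Type*} [Field k] [CommRing A] [Algebra k A] (ε : A →ₐ[k] k)

/-- `[a₀|⋯|aᵢ] ↦ a₀ ⊗ [a₁|⋯|aᵢ]`. -/
noncomputable def barSplit (k A : Type*) [Field k] [CommRing A] [Algebra k A] (i : ℕ) :
    HChain k A (i + 1) →ₗ[k] A ⊗[k] HChain k A i :=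
  PiTensorProduct.lift
    { toFun := fun a => a 0 ⊗ₜ[k] PiTensorProduct.tprod k (Fin.tail a)
      map_update_add' := by
        intro inst a m x y
        obtain rfl : inst = instDecidableEqFin _ := Subsingleton.elim _ _
        cases m using Fin.cases <;>
          simp [Fin.tail_update_zero, Fin.tail_update_succ, TensorProduct.add_tmul,
            TensorProduct.tmul_add, Function.update_of_ne (Fin.succ_ne_zero _).symm]
      map_update_smul' := by
        intro inst a m t x
        obtain rfl : inst = instDecidableEqFin _ := Subsingleton.elim _ _
        cases m using Fin.cases <;>
          simp [Fin.tail_update_zero, Fin.tail_update_succ, TensorProduct.smul_tmul',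
            Function.update_of_ne (Fin.succ_ne_zero _).symm] }

theorem barSplit_tprod (i : ℕ) (a : Fin (i + 1) → A) :
    barSplit k A i (PiTensorProduct.tprod k a) =
      a 0 ⊗ₜ[k] PiTensorProduct.tprod k (Fin.tail a) :=
  PiTensorProduct.lift.tprod _

/-- `a₀ ⊗ [a₁|⋯|aᵢ] ↦ [a₀|⋯|aᵢ]`. -/
noncomputable def barCons (k A : Type*) [Field k] [CommRing A] [Algebra k A] (i : ℕ) :
    A ⊗[k] HChain k A i →ₗ[k] HChain k A (i + 1) :=
  TensorProduct.lift (PiTensorProduct.lift.toLinearMap ∘ₗ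
    (PiTensorProduct.tprod k (s := fun _ : Fin (i + 1) => A)).curryLeft)

theorem barCons_tmul_tprod (i : ℕ) (a : A) (v : Fin i → A) :
    barCons k A i (a ⊗ₜ[k] PiTensorProduct.tprod k v) =
      PiTensorProduct.tprod k (Fin.cons a v : Fin (i + 1) → A) := by
  change PiTensorProduct.lift ((PiTensorProduct.tprod k (s := fun _ : Fin (i + 1) => A)).curryLeft a)
    (PiTensorProduct.tprod k v) = _
  rw [PiTensorProduct.lift.tprod]
  rfl

theorem hChain_induction {i : ℕ} {p : HChain k A i → Prop} (x : HChain k A i)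
    (tprod : ∀ (a : Fin i → A), p (PiTensorProduct.tprod k a)) (smul : ∀ (r : k) x, p x → p (r • x))
    (add : ∀ x y, p x → p y → p (x + y)) : p x := by
  induction x using PiTensorProduct.induction_on with
  | smul_tprod r a => exact smul r _ (tprod a)
  | add x y hx hy => exact add x y hx hy

theorem bar_induction {i : ℕ} {p : A ⊗[k] HChain k A i → Prop} (y : A ⊗[k] HChain k A i)
    (tmul : ∀ a (v : Fin i → A), p (a ⊗ₜ PiTensorProduct.tprod k v))
    (add : ∀ x y, p x → p y → p (x + y)) : p y := by
  induction y using TensorProduct.induction_on with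
  | zero => simpa using tmul 0 0
  | tmul a x =>
    induction x using hChain_induction generalizing a with
    | tprod v => exact tmul a v
    | smul r x h => rw [← TensorProduct.smul_tmul]; exact h _
    | add x y hx hy => rw [TensorProduct.tmul_add]; exact add _ _ (hx a) (hy a)
  | add x y hx hy => exact add x y hx hy

theorem barSplit_barCons (i : ℕ) (y : A ⊗[k] HChain k A i) :
    barSplit k A i (barCons k A i y) = y := by
  induction y using bar_induction with
  | tmul a v => rw [barCons_tmul_tprod, barSplit_tprod, Fin.cons_zero, Fin.tail_cons]
  | add x y hx hy => rw [map_add, map_add, hx, hy]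

theorem barCons_barSplit (i : ℕ) (x : HChain k A (i + 1)) :
    barCons k A i (barSplit k A i x) = x := by
  induction x using hChain_induction with
  | tprod a => rw [barSplit_tprod, barCons_tmul_tprod, Fin.cons_self_tail]
  | smul r x h => rw [map_smul, map_smul, h]
  | add x y hx hy => rw [map_add, map_add, hx, hy]

/-- The faces of the bar complex except for the first one. -/
noncomputable def barTail (i : ℕ) : HChain k A (i + 1) →ₗ[k] HChain k A i :=
  hDiff ε i - firstFace ε i

/-- The differential of the bar resolution. -/
noncomputable def barD (i : ℕ) : A ⊗[k] HChain k A (i + 1) →ₗ[A] A ⊗[k] HChain k A i :=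
  LinearMap.liftBaseChange A (barSplit k A i + TensorProduct.mk k A _ 1 ∘ₗ barTail ε i)

theorem barD_tmul (i : ℕ) (a : A) (x : HChain k A (i + 1)) :
    barD ε i (a ⊗ₜ x) = a • barSplit k A i x + a ⊗ₜ barTail ε i x := by
  rw [barD, LinearMap.liftBaseChange_tmul, LinearMap.add_apply, smul_add, LinearMap.comp_apply,
    TensorProduct.mk_apply, TensorProduct.smul_tmul', smul_eq_mul, mul_one]

/-- The contraction of the bar resolution. -/
noncomputable def barH (k A : Type*) [Field k] [CommRing A] [Algebra k A] (i : ℕ) :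
    A ⊗[k] HChain k A i →ₗ[k] A ⊗[k] HChain k A (i + 1) :=
  TensorProduct.mk k A _ 1 ∘ₗ barCons k A i

theorem barH_apply (i : ℕ) (y : A ⊗[k] HChain k A i) :
    barH k A i y = 1 ⊗ₜ barCons k A i y := rfl

/-- The reduction `A ⊗ V → V`. -/
noncomputable def baseReduce (V : Type*) [AddCommGroup V] [Module k V] : A ⊗[k] V →ₗ[k] V :=
  TensorProduct.lift (LinearMap.lsmul k V ∘ₗ ε.toLinearMap)

theorem baseReduce_tmul {V : Type*} [AddCommGroup V] [Module k V] (a : A) (v : V) :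
    baseReduce ε V (a ⊗ₜ v) = ε a • v := rfl

theorem baseReduce_smul {V : Type*} [AddCommGroup V] [Module k V] (a : A) (x : A ⊗[k] V) :
    baseReduce ε V (a • x) = ε a • baseReduce ε V x := by
  induction x using TensorProduct.induction_on with
  | zero => simp only [smul_zero, map_zero]
  | tmul b v => rw [TensorProduct.smul_tmul', baseReduce_tmul, baseReduce_tmul, smul_eq_mul,
      map_mul, mul_smul]
  | add x y hx hy => rw [smul_add, map_add, hx, hy, map_add, smul_add]

theorem barTail_tprod (i : ℕ) (a : Fin (i + 1) → A) :
    barTail ε i (PiTensorProduct.tprod k a) =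
      ∑ j : Fin i, (-1 : k) ^ ((j : ℕ) + 1) •
        PiTensorProduct.tprod k (j.castSucc.contractNth (· * ·) a) +
      (-1 : k) ^ (i + 1) • ε (a (Fin.last i)) • PiTensorProduct.tprod k (Fin.init a) := by
  have h1 : ∀ j : Fin i, innerFace k A j (PiTensorProduct.tprod k a) =
      PiTensorProduct.tprod k (j.castSucc.contractNth (· * ·) a) := fun j =>
    PiTensorProduct.lift.tprod _
  have h2 : lastFace ε i (PiTensorProduct.tprod k a) =
      ε (a (Fin.last i)) • PiTensorProduct.tprod k (Fin.init a) := PiTensorProduct.lift.tprod _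
  simp only [barTail, hDiff, LinearMap.sub_apply, LinearMap.add_apply, LinearMap.sum_apply,
    LinearMap.smul_apply, h1, h2]
  abel

theorem contractNth_zero_cons {i : ℕ} (a : A) (v : Fin (i + 1) → A) :
    (0 : Fin (i + 1)).castSucc.contractNth (· * ·) (Fin.cons a v : Fin (i + 2) → A) =
      Fin.cons (a * v 0) (Fin.tail v) := by
  ext l
  cases l using Fin.cases with
  | zero => simp [Fin.contractNth]
  | succ l => simp [Fin.contractNth, Fin.tail]

theorem contractNth_succ_cons {i : ℕ} (j : Fin i) (a : A) (v : Fin (i + 1) → A) :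
    j.succ.castSucc.contractNth (· * ·) (Fin.cons a v : Fin (i + 2) → A) =
      Fin.cons a (j.castSucc.contractNth (· * ·) v) := by
  ext l
  cases l using Fin.cases with
  | zero => simp [Fin.contractNth]
  | succ l =>
    simp only [Fin.contractNth, Fin.cons_succ, Fin.val_succ, Fin.val_castSucc,
      Nat.add_lt_add_iff_right, Nat.add_right_cancel_iff]
    rw [← Fin.succ_castSucc, Fin.cons_succ]

/-- The first inner face of [a|v] multiplies v 0 by a; the remaining faces are those of v, with the
index shifted by one and hence the opposite sign. -/
theorem barTail_barCons (i : ℕ) (y : A ⊗[k] HChain k A (i + 1)) :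
    barTail ε (i + 1) (barCons k A (i + 1) y) = - barCons k A i (barD ε i y) := by
  induction y using bar_induction with
  | tmul a v =>
    rw [barCons_tmul_tprod, barTail_tprod, barD_tmul, barSplit_tprod, barTail_tprod,
      Fin.sum_univ_succ, contractNth_zero_cons, TensorProduct.smul_tmul', map_add,
      barCons_tmul_tprod, TensorProduct.tmul_add, TensorProduct.tmul_sum, map_add, map_sum]
    simp only [contractNth_succ_cons, TensorProduct.tmul_smul, map_smul, barCons_tmul_tprod,
      smul_eq_mul, Fin.val_succ, Fin.val_zero]
    have h1 : (Fin.cons a v : Fin (i + 2) → A) (Fin.last (i + 1)) = v (Fin.last i) := by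
      rw [← Fin.succ_last, Fin.cons_succ]
    have h2 : Fin.init (Fin.cons a v : Fin (i + 2) → A) =
        (Fin.cons a (Fin.init v) : Fin (i + 1) → A) := by
      ext l
      cases l using Fin.cases with
      | zero => rfl
      | succ l => simp only [Fin.init, Fin.cons_succ, ← Fin.succ_castSucc]
    rw [h1, h2, pow_succ _ (i + 1)]
    simp only [pow_succ _ (_ + 1), mul_neg_one, neg_smul, Finset.sum_neg_distrib, zero_add, pow_one,
      one_smul]
    abel
  | add x y hx hy => simp only [map_add, hx, hy, neg_add]

theorem barD_barH (i : ℕ) (y : A ⊗[k] HChain k A (i + 1)) :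
    barD ε (i + 1) (barH k A (i + 1) y) = y - barH k A i (barD ε i y) := by
  rw [barH_apply, barD_tmul, one_smul, barSplit_barCons, barTail_barCons, TensorProduct.tmul_neg,
    barH_apply, sub_eq_add_neg]

theorem barTail_zero (a : A) (v : Fin 0 → A) :
    barTail ε 0 (barCons k A 0 (a ⊗ₜ PiTensorProduct.tprod k v)) =
      - (ε a • PiTensorProduct.tprod k v) := by
  rw [barCons_tmul_tprod, barTail_tprod]
  simp only [Finset.univ_eq_empty, Finset.sum_empty, zero_add, pow_one, neg_smul, one_smul]
  have : Fin.init (Fin.cons a v : Fin 1 → A) = v := Subsingleton.elim _ _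
  rw [this]
  rfl

theorem barTail_zero_barCons (y : A ⊗[k] HChain k A 0) :
    barTail ε 0 (barCons k A 0 y) = - baseReduce ε _ y := by
  induction y using bar_induction with
  | tmul a v => rw [barTail_zero]; rfl
  | add x y hx hy => simp only [map_add, hx, hy, neg_add]

theorem barD_barH_zero (y : A ⊗[k] HChain k A 0) :
    barD ε 0 (barH k A 0 y) = y - (1 : A) ⊗ₜ[k] baseReduce ε (HChain k A 0) y := by
  rw [barH_apply, barD_tmul, one_smul, barSplit_barCons, barTail_zero_barCons,
    TensorProduct.tmul_neg, sub_eq_add_neg]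

/-- Under ε the split-off entry of a chain becomes the first face, which was left out of `barTail`.
So k ⊗_A (bar resolution) is the Hochschild complex with coefficients in k. -/
theorem baseReduce_barD (i : ℕ) (y : A ⊗[k] HChain k A (i + 1)) :
    baseReduce ε _ (barD ε i y) = hDiff ε i (baseReduce ε _ y) := by
  induction y using TensorProduct.induction_on with
  | zero => simp only [map_zero]
  | tmul a x =>
    have h : ∀ x, baseReduce ε _ (barSplit k A i x) = firstFace ε i x := by
      intro x
      induction x using hChain_induction with
      | tprod v => 
        rw [barSplit_tprod, baseReduce_tmul, firstFace, PiTensorProduct.lift.tprod]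
        rfl
      | smul r x h => rw [map_smul, map_smul, h, map_smul]
      | add x y hx hy => rw [map_add, map_add, hx, hy, map_add]
    rw [barD_tmul, map_add, baseReduce_smul, h, baseReduce_tmul, baseReduce_tmul, barTail,
      LinearMap.sub_apply, ← smul_add, add_sub_cancel, map_smul]
  | add x y hx hy => simp only [map_add, hx, hy]

/-- On A^{⊗1} the first and the last face coincide and occur with opposite signs. -/
theorem hDiff_zero : hDiff ε 0 = (0 : HChain k A 1 →ₗ[k] HChain k A 0) := by
  ext a
  have h1 : firstFace ε 0 (PiTensorProduct.tprod k a) =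
    ε (a 0) • PiTensorProduct.tprod k (Fin.tail a) := PiTensorProduct.lift.tprod _
  have h2 : lastFace ε 0 (PiTensorProduct.tprod k a) =
    ε (a (Fin.last 0)) • PiTensorProduct.tprod k (Fin.init a) := PiTensorProduct.lift.tprod _
  have h3 : Fin.init a = Fin.tail a := Subsingleton.elim _ _
  simp [hDiff, h1, h2, h3]

theorem baseReduce_barD_zero (y : A ⊗[k] HChain k A 1) : baseReduce ε _ (barD ε 0 y) = 0 := by
  rw [baseReduce_barD, hDiff_zero, LinearMap.zero_apply]

theorem exists_barH (i : ℕ) (x : HChain k A (i + 1)) :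
    ∃ y, (1 : A) ⊗ₜ[k] x = barH k A i y :=
  ⟨barSplit k A i x, by rw [barH_apply, barCons_barSplit]⟩

/-- No simplicial identities are needed. Chains are A-linear combinations of elements in the image
of the contraction h, and from dh = 1 − hd one gets ddh = hdd, so the vanishing passes from one
degree to the next. It starts because the reduction of the lowest differential is zero. -/
theorem barD_barD (i : ℕ) (y : A ⊗[k] HChain k A (i + 2)) :
    barD ε i (barD ε (i + 1) y) = 0 := by
  have key : ∀ i, (∀ y, barD ε i (barD ε (i + 1) (barH k A (i + 1) y)) = 0) →
      ∀ y, barD ε i (barD ε (i + 1) y) = 0 := by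
    intro i h y
    induction y using TensorProduct.induction_on with
    | zero => simp only [map_zero]
    | tmul a x =>
      obtain ⟨y, hy⟩ := exists_barH (i + 1) x
      have h1 : a ⊗ₜ[k] x = a • ((1 : A) ⊗ₜ[k] x) := by
        rw [TensorProduct.smul_tmul', smul_eq_mul, mul_one]
      rw [h1, map_smul, map_smul, hy, h, smul_zero]
    | add x y hx hy => rw [map_add, map_add, hx, hy, add_zero]
  induction i with
  | zero =>
    refine key 0 (fun y => ?_) y
    rw [barD_barH, map_sub, barD_barH_zero, baseReduce_barD_zero, TensorProduct.tmul_zero, sub_zero,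
      sub_self]
  | succ i ih =>
    refine key (i + 1) (fun y => ?_) y
    rw [barD_barH, map_sub, barD_barH, ih, map_zero, sub_zero, sub_self]

end Bar

/-! ### Homogeneity of the bar resolution. -/

section BarGraded

variable {k A M : Type*} [Field k] [CommRing A] [Algebra k A] [AddCommMonoid M] {ε : A →ₐ[k] k}
  {𝒜 : M → Submodule k A}

/-- The homogeneous parts of `A ⊗ V`. -/
noncomputable def basePart {V : Type*} [AddCommGroup V] [Module k V] (𝒜 : M → Submodule k A)
    (𝒱 : M → Submodule k V) (μ : M) : Submodule k (A ⊗[k] V) :=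
  Submodule.span k {x | ∃ ν μ', ν + μ' = μ ∧ ∃ a ∈ 𝒜 ν, ∃ v ∈ 𝒱 μ', x = a ⊗ₜ v}

theorem tmul_mem_basePart {V : Type*} [AddCommGroup V] [Module k V]
    {𝒱 : M → Submodule k V} {ν μ' μ : M} {a : A} {v : V} (ha : a ∈ 𝒜 ν) (hv : v ∈ 𝒱 μ')
    (h : ν + μ' = μ) : a ⊗ₜ v ∈ basePart 𝒜 𝒱 μ :=
  Submodule.subset_span ⟨ν, μ', h, a, ha, v, hv, rfl⟩

theorem map_mem_of_basePart {V N : Type*} [AddCommGroup V] [Module k V] [AddCommGroup N]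
    [Module k N] {𝒱 : M → Submodule k V} (F : A ⊗[k] V →ₗ[k] N) {Q : Submodule k N} {μ : M}
    (h : ∀ ν μ', ν + μ' = μ → ∀ a ∈ 𝒜 ν, ∀ v ∈ 𝒱 μ', F (a ⊗ₜ v) ∈ Q)
    {x : A ⊗[k] V} (hx : x ∈ basePart 𝒜 𝒱 μ) : F x ∈ Q := by
  have : basePart 𝒜 𝒱 μ ≤ Q.comap F := by
    rw [basePart, Submodule.span_le]
    rintro _ ⟨ν, μ', hμ, a, ha, v, hv, rfl⟩
    exact h ν μ' hμ a ha v hv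
  exact this hx

theorem map_mem_of_hPart {N : Type*} [AddCommGroup N] [Module k N] {i : ℕ}
    (F : HChain k A i →ₗ[k] N) {Q : Submodule k N} {μ : M}
    (h : ∀ (a : Fin i → A) (ν : Fin i → M), (∀ l, a l ∈ 𝒜 (ν l)) → ∑ l, ν l = μ →
      F (PiTensorProduct.tprod k a) ∈ Q)
    {x : HChain k A i} (hx : x ∈ hPart 𝒜 i μ) : F x ∈ Q := by
  have : hPart 𝒜 i μ ≤ Q.comap F := by
    rw [hPart, Submodule.span_le]
    rintro _ ⟨a, ν, ha, hν, rfl⟩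
    exact h a ν ha hν
  exact this hx

theorem tprod_mem_hPart {i : ℕ} {a : Fin i → A} {ν : Fin i → M} (h : ∀ l, a l ∈ 𝒜 (ν l)) :
    PiTensorProduct.tprod k a ∈ hPart 𝒜 i (∑ l, ν l) :=
  Submodule.subset_span ⟨a, ν, h, rfl, rfl⟩

theorem barSplit_mem {i : ℕ} {μ : M} {x : HChain k A (i + 1)} (hx : x ∈ hPart 𝒜 (i + 1) μ) :
    barSplit k A i x ∈ basePart 𝒜 (hPart 𝒜 i) μ := by
  refine map_mem_of_hPart (barSplit k A i) (fun a ν ha hν => ?_) hx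
  rw [barSplit_tprod]
  refine tmul_mem_basePart (ha 0) (tprod_mem_hPart (ν := Fin.tail ν) fun l => ha l.succ) ?_
  rw [← hν, Fin.sum_univ_succ]
  rfl

theorem barCons_mem {i : ℕ} {μ : M} {y : A ⊗[k] HChain k A i}
    (hy : y ∈ basePart 𝒜 (hPart 𝒜 i) μ) : barCons k A i y ∈ hPart 𝒜 (i + 1) μ := by
  refine map_mem_of_basePart (barCons k A i) (fun ν μ' hμ a ha v hv => ?_) hy
  refine map_mem_of_hPart (barCons k A i ∘ₗ TensorProduct.mk k A _ a)
    (fun b ν' hb hν' => ?_) hv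
  rw [LinearMap.comp_apply, TensorProduct.mk_apply, barCons_tmul_tprod]
  have := tprod_mem_hPart (k := k) (𝒜 := 𝒜) (a := (Fin.cons a b : Fin (i + 1) → A))
    (ν := (Fin.cons ν ν' : Fin (i + 1) → M))
    (fun l => by cases l using Fin.cases with
      | zero => exact ha
      | succ l => exact hb l)
  rwa [Fin.sum_univ_succ, Fin.cons_zero, Finset.sum_congr rfl fun l _ => Fin.cons_succ (α := fun _ => M) ν ν' l,
    hν', hμ] at this

theorem smul_mem_basePart {V : Type*} [AddCommGroup V] [Module k V] {𝒱 : M → Submodule k V}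
    (hmul : ∀ μ ν, ∀ a ∈ 𝒜 μ, ∀ b ∈ 𝒜 ν, a * b ∈ 𝒜 (μ + ν)) {ν μ : M} {a : A} (ha : a ∈ 𝒜 ν)
    {x : A ⊗[k] V} (hx : x ∈ basePart 𝒜 𝒱 μ) : a • x ∈ basePart 𝒜 𝒱 (ν + μ) := by
  refine map_mem_of_basePart ((LinearMap.lsmul A (A ⊗[k] V) a).restrictScalars k)
    (fun ν' μ' h b hb v hv => ?_) hx
  rw [LinearMap.restrictScalars_apply, LinearMap.lsmul_apply, TensorProduct.smul_tmul']
  exact tmul_mem_basePart (hmul _ _ _ ha _ hb) hv (by rw [add_assoc, h])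

/-- The hypothesis on ε says that only degree zero is seen by ε, so reduction either kills a ⊗ v or
preserves its degree. -/
theorem baseReduce_mem {V : Type*} [AddCommGroup V] [Module k V] {𝒱 : M → Submodule k V}
    (hε : ∀ ν, ∀ a ∈ 𝒜 ν, ε a ≠ 0 → ν = 0) {μ : M} {x : A ⊗[k] V} (hx : x ∈ basePart 𝒜 𝒱 μ) :
    baseReduce ε V x ∈ 𝒱 μ := by
  refine map_mem_of_basePart (baseReduce ε V) (fun ν μ' h a ha v hv => ?_) hx
  rw [baseReduce_tmul]
  by_cases h0 : ε a = 0
  · rw [h0, zero_smul]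
    exact zero_mem _
  · rw [hε ν a ha h0, zero_add] at h
    exact Submodule.smul_mem _ _ (h ▸ hv)

/-- The free module `A ⊗ V`. -/
noncomputable def GradedFreeModule.base {V : Type*} [AddCommGroup V] [Module k V]
    (𝒱 : M → Submodule k V) (hone : 1 ∈ 𝒜 0)
    (hmul : ∀ μ ν, ∀ a ∈ 𝒜 μ, ∀ b ∈ 𝒜 ν, a * b ∈ 𝒜 (μ + ν))
    (hε : ∀ ν, ∀ a ∈ 𝒜 ν, ε a ≠ 0 → ν = 0) : GradedFreeModule ε 𝒜 (A ⊗[k] V) V where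
  ι := TensorProduct.mk k A V 1
  π := baseReduce ε V
  parts := basePart 𝒜 𝒱
  genParts := 𝒱
  isBaseChange := TensorProduct.isBaseChange k V A
  π_smul := baseReduce_smul ε
  π_ι v := by rw [TensorProduct.mk_apply, baseReduce_tmul, map_one, one_smul]
  ι_mem μ v hv := tmul_mem_basePart hone hv (zero_add μ)
  π_mem μ x hx := baseReduce_mem hε hx
  smul_mem ν μ a ha x hx := smul_mem_basePart hmul ha hx
  parts_le μ := by
    refine Submodule.span_mono ?_
    rintro _ ⟨ν, μ', hμ, a, ha, v, hv, rfl⟩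
    refine ⟨ν, μ', hμ, a, ha, v, hv, ?_⟩
    rw [TensorProduct.mk_apply, TensorProduct.smul_tmul', smul_eq_mul, mul_one]

theorem barD_mem_of_barTail_mem
    (hmul : ∀ μ ν, ∀ a ∈ 𝒜 μ, ∀ b ∈ 𝒜 ν, a * b ∈ 𝒜 (μ + ν)) {i : ℕ}
    (h : ∀ μ, ∀ x ∈ hPart 𝒜 (i + 1) μ, barTail ε i x ∈ hPart 𝒜 i μ) {μ : M}
    {y : A ⊗[k] HChain k A (i + 1)} (hy : y ∈ basePart 𝒜 (hPart 𝒜 (i + 1)) μ) :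
    barD ε i y ∈ basePart 𝒜 (hPart 𝒜 i) μ := by
  refine map_mem_of_basePart ((barD ε i).restrictScalars k) (fun ν μ' hμ a ha v hv => ?_) hy
  rw [LinearMap.restrictScalars_apply, barD_tmul]
  exact add_mem (hμ ▸ smul_mem_basePart hmul ha (barSplit_mem hv))
    (tmul_mem_basePart ha (h _ _ hv) hμ)

/-- The recursion `barTail_barCons` lowers the degree, so the individual faces need not be
inspected. -/
theorem barTail_mem (hmul : ∀ μ ν, ∀ a ∈ 𝒜 μ, ∀ b ∈ 𝒜 ν, a * b ∈ 𝒜 (μ + ν))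
    (hε : ∀ ν, ∀ a ∈ 𝒜 ν, ε a ≠ 0 → ν = 0) {i : ℕ} {μ : M} {x : HChain k A (i + 1)}
    (hx : x ∈ hPart 𝒜 (i + 1) μ) : barTail ε i x ∈ hPart 𝒜 i μ := by
  induction i generalizing μ with
  | zero =>
    rw [← barCons_barSplit 0 x, barTail_zero_barCons]
    exact neg_mem (baseReduce_mem hε (barSplit_mem hx))
  | succ i ih =>
    rw [← barCons_barSplit (i + 1) x, barTail_barCons]
    exact neg_mem (barCons_mem (barD_mem_of_barTail_mem hmul (fun μ x hx => ih hx)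
      (barSplit_mem hx)))

/-- The bar resolution. -/
noncomputable def barResolution (hone : 1 ∈ 𝒜 0)
    (hmul : ∀ μ ν, ∀ a ∈ 𝒜 μ, ∀ b ∈ 𝒜 ν, a * b ∈ 𝒜 (μ + ν))
    (hε : ∀ ν, ∀ a ∈ 𝒜 ν, ε a ≠ 0 → ν = 0) :
    GradedResolution fun i => GradedFreeModule.base (ε := ε) (hPart 𝒜 i) hone hmul hε where
  d := barD ε
  h := barH k A
  d_mem _ _ _ hx := barD_mem_of_barTail_mem hmul (fun _ _ hx => barTail_mem hmul hε hx) hx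
  h_mem _ _ _ hx := tmul_mem_basePart hone (barCons_mem hx) (zero_add _)
  d_d := barD_barD ε
  π_d := baseReduce_barD_zero ε
  d_h_zero x hx := by
    have hx : baseReduce ε _ x = 0 := hx
    rw [barD_barH_zero, hx, TensorProduct.tmul_zero, sub_zero]
  d_h i x hx := by rw [barD_barH, hx, map_zero, sub_zero]

theorem barResolution_reduce (hone : 1 ∈ 𝒜 0)
    (hmul : ∀ μ ν, ∀ a ∈ 𝒜 μ, ∀ b ∈ 𝒜 ν, a * b ∈ 𝒜 (μ + ν))
    (hε : ∀ ν, ∀ a ∈ 𝒜 ν, ε a ≠ 0 → ν = 0) (i : ℕ) :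
    (GradedFreeModule.base (hPart 𝒜 (i + 1)) hone hmul hε).reduce
      (GradedFreeModule.base (hPart 𝒜 i) hone hmul hε) (barD ε i) = hDiff ε i := by
  refine LinearMap.ext fun x => ?_
  change baseReduce ε _ (barD ε i (1 ⊗ₜ x)) = hDiff ε i x
  rw [baseReduce_barD, baseReduce_tmul, map_one, one_smul]

theorem barResolution_cycles (hone : 1 ∈ 𝒜 0)
    (hmul : ∀ μ ν, ∀ a ∈ 𝒜 μ, ∀ b ∈ 𝒜 ν, a * b ∈ 𝒜 (μ + ν))
    (hε : ∀ ν, ∀ a ∈ 𝒜 ν, ε a ≠ 0 → ν = 0) (i : ℕ) :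
    (barResolution hone hmul hε).cycles i = hCycles ε i := by
  cases i with
  | zero => rfl
  | succ i =>
    change LinearMap.ker (GradedFreeModule.reduce _ _ (barD ε i)) = LinearMap.ker (hDiff ε i)
    rw [barResolution_reduce]

end BarGraded

/-! ### Homogeneous generalized inverses of linear maps. -/

section QuasiInverse

variable {k M X Y : Type*} [Field k] [AddCommGroup X] [Module k X] [AddCommGroup Y] [Module k Y]

theorem exists_quasiInverse (D : X →ₗ[k] Y) : ∃ h : Y →ₗ[k] X, ∀ x, D (h (D x)) = D x := by
  obtain ⟨g, hg⟩ := LinearMap.exists_rightInverse_of_surjective D.rangeRestrict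
    D.range_rangeRestrict
  obtain ⟨h, hh⟩ := LinearMap.exists_extend g
  refine ⟨h, fun x => ?_⟩
  have h1 : h (D x) = g (D.rangeRestrict x) := LinearMap.congr_fun hh (D.rangeRestrict x)
  rw [h1]
  exact congrArg Subtype.val (LinearMap.congr_fun hg (D.rangeRestrict x))

/-- Generalized inverses are chosen on each homogeneous part separately and extended to all of Y.
The coaction ρ splits y into its components, to which they are applied before summing. -/
theorem exists_graded_quasiInverse {𝒳 : M → Submodule k X} {𝒴 : M → Submodule k Y} (D : X →ₗ[k] Y)
    (hD : ∀ μ, ∀ x ∈ 𝒳 μ, D x ∈ 𝒴 μ) (h𝒳 : ⨆ μ, 𝒳 μ = ⊤) {ρ : Y →ₗ[k] (M →₀ Y)}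
    (hρ : ∀ μ, ∀ y ∈ 𝒴 μ, ρ y = Finsupp.single μ y) :
    ∃ h : Y →ₗ[k] X, (∀ μ, ∀ y ∈ 𝒴 μ, h y ∈ 𝒳 μ) ∧ ∀ x, D (h (D x)) = D x := by
  choose g hg using fun μ => exists_quasiInverse (D.restrict (hD μ))
  choose g' hg' using fun μ => LinearMap.exists_extend ((𝒳 μ).subtype ∘ₗ g μ)
  have key : ∀ μ (y : 𝒴 μ), (Finsupp.lsum k g' ∘ₗ ρ) y = g μ y := by
    intro μ y
    rw [LinearMap.comp_apply, hρ μ y y.2, Finsupp.lsum_single]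
    exact LinearMap.congr_fun (hg' μ) y
  refine ⟨Finsupp.lsum k g' ∘ₗ ρ, fun μ y hy => ?_, fun x => ?_⟩
  · rw [key μ ⟨y, hy⟩]
    exact (g μ ⟨y, hy⟩).2
  · have hx : x ∈ ⨆ μ, 𝒳 μ := h𝒳 ▸ Submodule.mem_top
    induction hx using Submodule.iSup_induction' with
    | mem μ x hx =>
      rw [key μ ⟨D x, hD μ x hx⟩]
      exact congrArg Subtype.val (hg μ ⟨x, hx⟩)
    | zero => simp only [map_zero]
    | add x y _ _ hx hy => rw [map_add, map_add, map_add, hx, hy]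

end QuasiInverse

/-! ### Free modules on weighted generators as graded free modules. -/

section FreeFinsupp

variable {k A M : Type*} [Field k] [CommRing A] [Algebra k A] [AddCommMonoid M] {ε : A →ₐ[k] k}
  {𝒜 : M → Submodule k A} {ι : Type*}

/-- The free module on generators of degrees `wt`. -/
noncomputable def GradedFreeModule.finsupp (wt : ι → M) (hone : 1 ∈ 𝒜 0)
    (hmul : ∀ μ ν, ∀ a ∈ 𝒜 μ, ∀ b ∈ 𝒜 ν, a * b ∈ 𝒜 (μ + ν))
    (hε : ∀ ν, ∀ a ∈ 𝒜 ν, ε a ≠ 0 → ν = 0) : GradedFreeModule ε 𝒜 (ι →₀ A) (ι →₀ k) where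
  ι := Finsupp.mapRange.linearMap (Algebra.linearMap k A)
  π := Finsupp.mapRange.linearMap ε.toLinearMap
  parts := totalPart 𝒜 wt
  genParts μ := Finsupp.supported k k {c | wt c = μ}
  isBaseChange := (IsBaseChange.linearMap k A).finsuppPow ι
  π_smul a x := by
    ext c
    simp
  π_ι v := by
    ext c
    simp
  ι_mem μ v hv := by
    rw [Finsupp.supported_eq_span_single] at hv
    have : Submodule.span k ((fun c => Finsupp.single c (1 : k)) '' {c | wt c = μ}) ≤
        (totalPart 𝒜 wt μ).comap (Finsupp.mapRange.linearMap (Algebra.linearMap k A)) := by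
      rw [Submodule.span_le]
      rintro _ ⟨c, hc, rfl⟩
      rw [SetLike.mem_coe, Submodule.mem_comap, Finsupp.mapRange.linearMap_apply,
        Finsupp.mapRange_single, Algebra.linearMap_apply, map_one]
      exact single_mem_totalPart hone (by rw [zero_add]; exact hc)
    exact this hv
  π_mem μ x hx := by
    refine map_mem_of_totalPart_single (Finsupp.mapRange.linearMap ε.toLinearMap)
      (fun c ν r hr h => ?_) hx
    rw [Finsupp.mapRange.linearMap_apply, Finsupp.mapRange_single, AlgHom.toLinearMap_apply]
    by_cases h0 : ε r = 0
    · rw [h0, Finsupp.single_zero]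
      exact zero_mem _
    · rw [hε ν r hr h0, zero_add] at h
      exact Finsupp.single_mem_supported k _ h
  smul_mem ν μ a ha x hx := smul_mem_totalPart hmul ha hx
  parts_le μ := by
    refine Submodule.span_mono ?_
    rintro _ ⟨c, ν, hμ, a, ha, rfl⟩
    refine ⟨ν, wt c, hμ, a, ha, Finsupp.single c 1, Finsupp.single_mem_supported k _ rfl, ?_⟩
    rw [Finsupp.mapRange.linearMap_apply, Finsupp.mapRange_single, Algebra.linearMap_apply, map_one,
      Finsupp.smul_single, smul_eq_mul, mul_one]

end FreeFinsupp

/-! ### Chains of one fixed homological degree. -/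

section Truncation

/-- The generators of homological degree `i`. -/
abbrev CellOf (n s i : ℕ) : Type := {c : Cell n s // c.degree = i}

variable {R : Type*} [CommRing R] {n s : ℕ}

variable (R n s) in
/-- The inclusion of the chains of degree `i`. -/
noncomputable def extendCell (i : ℕ) : (CellOf n s i →₀ R) →ₗ[R] Total R n s :=
  Finsupp.lmapDomain R R Subtype.val

variable (R n s) in
/-- The projection to the chains of degree `i`. -/
noncomputable def restrictCell (i : ℕ) : Total R n s →ₗ[R] (CellOf n s i →₀ R) :=
  Finsupp.lcomapDomain Subtype.val Subtype.val_injective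

theorem extendCell_single {i : ℕ} (c : CellOf n s i) (r : R) :
    extendCell R n s i (Finsupp.single c r) = Finsupp.single c.1 r :=
  Finsupp.mapDomain_single

theorem restrictCell_apply (i : ℕ) (x : Total R n s) (c : CellOf n s i) :
    restrictCell R n s i x c = x c := rfl

theorem restrictCell_extendCell (i : ℕ) (x : CellOf n s i →₀ R) :
    restrictCell R n s i (extendCell R n s i x) = x := by
  ext c
  rw [restrictCell_apply]
  exact Finsupp.mapDomain_apply Subtype.val_injective x c

theorem extendCell_mem (i : ℕ) (x : CellOf n s i →₀ R) : extendCell R n s i x ∈ part R i := by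
  induction x using Finsupp.induction_linear with
  | zero => rw [map_zero]; exact zero_mem _
  | add x y hx hy => rw [map_add]; exact add_mem hx hy
  | single c r =>
    rw [extendCell_single]
    exact Finsupp.single_mem_supported R r c.2

theorem extendCell_restrictCell {i : ℕ} {x : Total R n s} (hx : x ∈ part R i) :
    extendCell R n s i (restrictCell R n s i x) = x := by
  ext c
  by_cases hc : c.degree = i
  · exact Finsupp.mapDomain_apply Subtype.val_injective _ (⟨c, hc⟩ : CellOf n s i)
  · have h1 : x c = 0 := by
      by_contra h
      exact hc ((Finsupp.mem_supported R x).1 hx (Finsupp.mem_support_iff.2 h))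
    rw [h1]
    refine Finsupp.mapDomain_of_notMem_range _ _ ?_
    rintro ⟨c', rfl⟩
    exact hc c'.2

variable {k M : Type*} [Field k] [Algebra k R] [AddCommMonoid M] {ℛ : M → Submodule k R}
  {wt : Cell n s → M}

theorem extendCell_mem_totalPart {i : ℕ} {μ : M} {x : CellOf n s i →₀ R}
    (hx : x ∈ totalPart ℛ (fun c : CellOf n s i => wt c) μ) :
    extendCell R n s i x ∈ totalPart ℛ wt μ := by
  refine map_mem_of_totalPart_single ((extendCell R n s i).restrictScalars k)
    (fun c ν r hr h => ?_) hx
  rw [LinearMap.restrictScalars_apply, extendCell_single]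
  exact single_mem_totalPart hr h

theorem restrictCell_mem_totalPart {i : ℕ} {μ : M} {x : Total R n s} (hx : x ∈ totalPart ℛ wt μ) :
    restrictCell R n s i x ∈ totalPart ℛ (fun c : CellOf n s i => wt c) μ := by
  refine map_mem_of_totalPart_single ((restrictCell R n s i).restrictScalars k)
    (fun c ν r hr h => ?_) hx
  rw [LinearMap.restrictScalars_apply]
  by_cases hc : c.degree = i
  · have : Finsupp.single c r = extendCell R n s i (Finsupp.single (⟨c, hc⟩ : CellOf n s i) r) :=
      (extendCell_single (⟨c, hc⟩ : CellOf n s i) r).symm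
    rw [this, restrictCell_extendCell]
    exact single_mem_totalPart hr h
  · have : restrictCell R n s i (Finsupp.single c r) = 0 := by
      ext c'
      rw [restrictCell_apply, Finsupp.single_eq_of_ne, Finsupp.zero_apply]
      rintro rfl
      exact hc c'.2
    rw [this]
    exact zero_mem _

end Truncation

/-! ### The Tate complex as a graded resolution of k. -/

section TateResolution

variable {k A M : Type*} [Field k] [CommRing A] [Algebra k A] [AddCommMonoid M] {ε : A →ₐ[k] k}
  {𝒜 : M → Submodule k A} {n s : ℕ} {τ : Fin n → A} {a : Fin s → Fin n → A} {w : Fin n → M}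
  {δ : Fin s → M}

variable (τ a) in
/-- The differential `tateD` between the chains of degrees `i + 1` and `i`. -/
noncomputable def tateDAt (i : ℕ) : (CellOf n s (i + 1) →₀ A) →ₗ[A] (CellOf n s i →₀ A) :=
  restrictCell A n s i ∘ₗ tateD τ a ∘ₗ extendCell A n s (i + 1)

theorem extendCell_tateDAt (i : ℕ) (x : CellOf n s (i + 1) →₀ A) :
    extendCell A n s i (tateDAt τ a i x) = tateD τ a (extendCell A n s (i + 1) x) :=
  extendCell_restrictCell (tateD_part (extendCell_mem (i + 1) x))

theorem exists_tateDAt_eq {i : ℕ} {x : CellOf n s i →₀ A}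
    (h : ∃ y ∈ part A (i + 1), tateD τ a y = extendCell A n s i x) :
    ∃ y, tateDAt τ a i y = x := by
  obtain ⟨y, hy, hyx⟩ := h
  refine ⟨restrictCell A n s (i + 1) y, ?_⟩
  rw [tateDAt, LinearMap.comp_apply, LinearMap.comp_apply, extendCell_restrictCell hy, hyx,
    restrictCell_extendCell]

theorem reduce_tateDAt (hone : 1 ∈ 𝒜 0)
    (hmul : ∀ μ ν, ∀ a ∈ 𝒜 μ, ∀ b ∈ 𝒜 ν, a * b ∈ 𝒜 (μ + ν))
    (hε : ∀ ν, ∀ a ∈ 𝒜 ν, ε a ≠ 0 → ν = 0) (hετ : ∀ i, ε (τ i) = 0) (hεa : ∀ j p, ε (a j p) = 0)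
    (i : ℕ) (x : CellOf n s (i + 1) →₀ A) :
    (GradedFreeModule.finsupp (ε := ε) (fun c : CellOf n s i => weightOf w δ c) hone hmul hε).π
      (tateDAt τ a i x) = 0 := by
  refine Finsupp.ext fun c => ?_
  have := coeff_mem_of_mem_smul_top (tateD_mem_smul_top (I := RingHom.ker ε) hετ hεa
    (extendCell A n s (i + 1) x)) c
  change ε (tateDAt τ a i x c) = 0
  exact this

/-- A map h with ∂h∂ = ∂ satisfies ∂hx = x for every boundary x. By exactness all cycles are
boundaries, and in degree zero so is everything that reduces to zero, because τ generates the kernel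
of ε. Hence homogeneous generalized inverses are contractions. -/
theorem nonempty_tateResolution (hone : 1 ∈ 𝒜 0)
    (hmul : ∀ μ ν, ∀ a ∈ 𝒜 μ, ∀ b ∈ 𝒜 ν, a * b ∈ 𝒜 (μ + ν))
    (hε : ∀ ν, ∀ a ∈ 𝒜 ν, ε a ≠ 0 → ν = 0) (h𝒜 : ⨆ μ, 𝒜 μ = ⊤) {ρ : A →ₗ[k] (M →₀ A)}
    (hρ : ∀ μ, ∀ r ∈ 𝒜 μ, ρ r = Finsupp.single μ r)
    (hετ : ∀ i, ε (τ i) = 0) (hεa : ∀ j p, ε (a j p) = 0) (hτ : ∀ i, τ i ∈ 𝒜 (w i))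
    (ha : ∀ j p, a j p ∈ ⨆ (ν : M) (_ : ν + w p = δ j), 𝒜 ν) (hzero : ∀ j, ∑ p, a j p * τ p = 0)
    (hexact : ∀ q, ∀ x ∈ part A (q + 1), tateD τ a x = 0 → ∃ y ∈ part A (q + 2), tateD τ a y = x)
    (hker : RingHom.ker ε ≤ Ideal.span (Set.range τ)) :
    ∃ S : GradedResolution (fun i => GradedFreeModule.finsupp (ε := ε)
      (fun c : CellOf n s i => weightOf w δ c) hone hmul hε), S.d = tateDAt τ a := by
  have hmem : ∀ i μ, ∀ x ∈ totalPart 𝒜 (fun c : CellOf n s (i + 1) => weightOf w δ c) μ,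
      tateDAt τ a i x ∈ totalPart 𝒜 (fun c : CellOf n s i => weightOf w δ c) μ := fun i μ x hx =>
    restrictCell_mem_totalPart (tateD_mem_totalPart hmul hτ ha (extendCell_mem_totalPart hx))
  have hh : ∀ i, ∃ h : (CellOf n s i →₀ A) →ₗ[k] (CellOf n s (i + 1) →₀ A),
      (∀ μ, ∀ y ∈ totalPart 𝒜 (fun c : CellOf n s i => weightOf w δ c) μ,
        h y ∈ totalPart 𝒜 (fun c : CellOf n s (i + 1) => weightOf w δ c) μ) ∧
      ∀ x, tateDAt τ a i (h (tateDAt τ a i x)) = tateDAt τ a i x := by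
    intro i
    obtain ⟨σ, hσ⟩ := exists_totalPart_coaction (wt := fun c : CellOf n s i => weightOf w δ c) hρ
    exact exists_graded_quasiInverse ((tateDAt τ a i).restrictScalars k) (hmem i)
      (iSup_totalPart h𝒜) hσ
  choose h hh_mem hh using hh
  refine ⟨⟨tateDAt τ a, h, hmem, hh_mem, ?_, ?_, ?_, ?_⟩, rfl⟩
  · intro i x
    rw [tateDAt, LinearMap.comp_apply, LinearMap.comp_apply, extendCell_tateDAt, tateD_tateD]
    simp [hzero]
  · exact reduce_tateDAt hone hmul hε hετ hεa 0
  · intro x hx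
    obtain ⟨y, rfl⟩ : ∃ y, tateDAt τ a 0 y = x := by
      refine exists_tateDAt_eq ?_
      obtain ⟨r, hr⟩ : ∃ r : A, extendCell A n s 0 x = r • gen A ∅ 0 :=
        ⟨_, eq_smul_gen_of_mem_part_zero (extendCell_mem 0 x)⟩
      have hεr : ε r = 0 := by
        have h1 := congrArg (fun z => z (∅, 0)) hr
        have h2 : extendCell A n s 0 x (∅, 0) = x ⟨(∅, 0), by simp [Cell.degree]⟩ :=
          Finsupp.mapDomain_apply Subtype.val_injective x
            (⟨(∅, 0), by simp [Cell.degree]⟩ : CellOf n s 0)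
        have h3 : r = x ⟨(∅, 0), by simp [Cell.degree]⟩ := by
          rw [← h2]
          simpa [gen] using h1.symm
        rw [h3]
        exact DFunLike.congr_fun hx _
      obtain ⟨y, hy, hyr⟩ := exists_tateD_eq_smul_gen (τ := τ) (a := a) (m := n) (r := r) (by
        have := hker hεr
        simpa [Set.image_univ] using this)
      rw [hr]
      refine ⟨y, ?_, hyr⟩
      exact koszulCells_le_part _ _ hy
    exact hh 0 y
  · intro i x hx
    obtain ⟨y, rfl⟩ : ∃ y, tateDAt τ a (i + 1) y = x := by
      refine exists_tateDAt_eq (hexact i _ (extendCell_mem _ _) ?_)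
      rw [← extendCell_tateDAt, hx, map_zero]
    exact hh (i + 1) y

end TateResolution

/-! ### Comparison starting from an isomorphism between the generators in degree zero. -/

section

variable {k A M : Type*} [Field k] [CommRing A] [Algebra k A] [AddCommMonoid M] {ε : A →ₐ[k] k}
  {𝒜 : M → Submodule k A} {P V P' V' : ℕ → Type*}
  [∀ i, AddCommGroup (P i)] [∀ i, Module A (P i)]
  [∀ i, Module k (P i)] [∀ i, IsScalarTower k A (P i)] [∀ i, AddCommGroup (V i)]
  [∀ i, Module k (V i)] {X : ∀ i, GradedFreeModule ε 𝒜 (P i) (V i)}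
  [∀ i, AddCommGroup (P' i)] [∀ i, Module A (P' i)]
  [∀ i, Module k (P' i)] [∀ i, IsScalarTower k A (P' i)] [∀ i, AddCommGroup (V' i)]
  [∀ i, Module k (V' i)] {Y : ∀ i, GradedFreeModule ε 𝒜 (P' i) (V' i)}

theorem GradedResolution.nonempty_homology_equiv_of_equiv (R : GradedResolution X)
    (S : GradedResolution Y) (θ : V 0 ≃ₗ[k] V' 0)
    (hθ : ∀ μ, ∀ v ∈ (X 0).genParts μ, θ v ∈ (Y 0).genParts μ)
    (hθ' : ∀ μ, ∀ v ∈ (Y 0).genParts μ, θ.symm v ∈ (X 0).genParts μ)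
    (hS : ∀ i y, (Y i).π (S.d i y) = 0) (i : ℕ) (μ : M) :
    Nonempty ((↥(R.cycles i ⊓ (X i).genParts μ) ⧸
      (((X (i + 1)).genParts μ).map ((X (i + 1)).reduce (X i) (R.d i))).submoduleOf
        (R.cycles i ⊓ (X i).genParts μ)) ≃ₗ[k] (Y i).genParts μ) := by
  let f₀ := (X 0).isBaseChange.lift ((Y 0).ι ∘ₗ θ.toLinearMap)
  let g₀ := (Y 0).isBaseChange.lift ((X 0).ι ∘ₗ θ.symm.toLinearMap)
  have hf₀ : ∀ v, f₀ ((X 0).ι v) = (Y 0).ι (θ v) := fun v => IsBaseChange.lift_eq _ _ _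
  have hg₀ : ∀ v, g₀ ((Y 0).ι v) = (X 0).ι (θ.symm v) := fun v => IsBaseChange.lift_eq _ _ _
  refine R.nonempty_homology_equiv S (f₀ := f₀) (g₀ := g₀) (fun x hx => ?_) (fun y hy => ?_)
    (fun x => ?_) (fun y => ?_) (fun μ x hx => ?_) (fun μ y hy => ?_) hS i μ
  · rw [(X 0).π_map_eq, hx, map_zero, map_zero, map_zero]
  · rw [(Y 0).π_map_eq, hy, map_zero, map_zero, map_zero]
  · refine LinearMap.congr_fun (f := g₀ ∘ₗ f₀) (g := LinearMap.id)
      ((X 0).isBaseChange.algHom_ext _ _ fun v => ?_) x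
    rw [LinearMap.comp_apply, hf₀, hg₀, θ.symm_apply_apply, LinearMap.id_apply]
  · refine LinearMap.congr_fun (f := f₀ ∘ₗ g₀) (g := LinearMap.id)
      ((Y 0).isBaseChange.algHom_ext _ _ fun v => ?_) y
    rw [LinearMap.comp_apply, hg₀, hf₀, θ.apply_symm_apply, LinearMap.id_apply]
  · refine (X 0).map_mem (Y 0) f₀ (fun μ v hv => ?_) hx
    rw [hf₀]
    exact (Y 0).ι_mem _ _ (hθ _ _ hv)
  · refine (Y 0).map_mem (X 0) g₀ (fun μ v hv => ?_) hy
    rw [hg₀]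
    exact (X 0).ι_mem _ _ (hθ' _ _ hv)

end

/-! ### Computation of the Hochschild homology with coefficients in k. -/

section HochschildHomology

variable {k : Type*} [Field k] {n s : ℕ} {M : Type*} [AddCommMonoid M]
  {f : Fin s → MvPolynomial (Fin n) k} {w : Fin n → M}

/-- A homogeneous polynomial with nonzero constant term contains the monomial 1, whose weight is 0
in every monoid. -/
theorem eq_zero_of_augmentation_ne_zero (h₀ : ∀ j, constantCoeff (f j) = 0) (ν : M) (a : Alg f)
    (ha : a ∈ algPart f w ν) (h : augmentation f h₀ a ≠ 0) : ν = 0 := by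
  obtain ⟨g, hg, rfl⟩ := ha
  rw [AlgHom.toLinearMap_apply, augmentation_cls] at h
  rw [← hg h, map_zero]

theorem sum_diffQuotAt_mul_cls (g : MvPolynomial (Fin n) k) :
    ∑ p, diffQuotAt (fun i => cls f (X i)) 0 p g * cls f (X p) =
      cls f g - algebraMap k _ (constantCoeff g) := by
  have h := sum_diffQuotAt_mul (fun i => cls f (X i)) 0 g
  simp only [Pi.zero_apply, sub_zero] at h
  have h1 : aeval (fun i => cls f (X i)) g = cls f g := by
    have := comp_cls_eq_aeval f (AlgHom.id k (Alg f))
    exact (DFunLike.congr_fun this g).symm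
  rw [h, h1]
  congr 1
  exact aeval_zero g

theorem ker_augmentation_le (h₀ : ∀ j, constantCoeff (f j) = 0) :
    RingHom.ker (augmentation f h₀) ≤ Ideal.span (Set.range fun i => cls f (X i)) := by
  intro a ha
  obtain ⟨g, rfl⟩ := cls_surjective f a
  rw [RingHom.mem_ker, augmentation_cls] at ha
  have h := sum_diffQuotAt_mul_cls (f := f) g
  rw [ha, map_zero, sub_zero] at h
  rw [← h]
  exact Ideal.sum_mem _ fun p _ => Ideal.mul_mem_left _ _ (Ideal.subset_span ⟨p, rfl⟩)

theorem tateD_cls_exact (hf : IsReducedGroebnerBasis f)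
    (hci : IsCompleteIntersection (initialIdeal (Ideal.span (Set.range f))))
    (h₀ : ∀ j, constantCoeff (f j) = 0) {q : ℕ} {x : Total (Alg f) n s}
    (hx : x ∈ part (Alg f) (q + 1))
    (hd : tateD (fun i => cls f (X i))
      (fun j p => diffQuotAt (fun i => cls f (X i)) 0 p (f j)) x = 0) :
    ∃ y ∈ part (Alg f) (q + 2), tateD (fun i => cls f (X i))
      (fun j p => diffQuotAt (fun i => cls f (X i)) 0 p (f j)) y = x := by
  have h1 : (fun j p => diffQuotAt (fun i => cls f (X i)) 0 p (f j)) =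
      fun j p => (cls f).toRingHom (diffQuotAt X 0 p (f j)) := by
    funext j p
    refine Eq.trans ?_ (map_diffQuotAt (cls f) X 0 p (f j)).symm
    simp only [Pi.zero_apply, map_zero]
    rfl
  rw [h1] at hd ⊢
  -- Now R = k[x] and the second point is the origin: the difference quotients give f_j(x) − f_j(0)
  -- = f_j, as there are no constant terms.
  refine tate_exact_quotient (φ := (cls f).toRingHom) (τ := X) (g := f) (cls_surjective f)
    Ideal.mk_ker isRegularFamily_X ?_ (fun j => ?_) hx hd
  · have := isRegularFamily_map (B := k) hf hci
    simpa only [Algebra.algebraMap_self, map_id, RingHom.id_apply] using this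
  · have h := sum_diffQuotAt_mul (X : Fin n → MvPolynomial (Fin n) k) 0 (f j)
    simp only [Pi.zero_apply, sub_zero, aeval_X_left_apply] at h
    rw [h, sub_eq_self]
    refine (aeval_zero (f j)).trans ?_
    rw [h₀, map_zero]

/-- The bar resolution of k reduces to the Hochschild complex. The Tate resolution of k has zero
differential after reduction, since the difference quotients of the f_j at the origin are their
linear coefficients. Comparing the two leaves the cells as a basis of the homology. -/
theorem nonempty_HH_equiv (hf : IsReducedGroebnerBasis f)
    (hci : IsCompleteIntersection (initialIdeal (Ideal.span (Set.range f))))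
    (h₀ : ∀ j, constantCoeff (f j) = 0) (hlin : ∀ j p, coeff (Finsupp.single p 1) (f j) = 0)
    (hw : ∀ j, IsWeightedHomogeneous w (f j) (Finsupp.weight w (leadExp (f j)))) (i : ℕ) (μ : M) :
    Nonempty (HH (augmentation f h₀) (algPart f w) i μ ≃ₗ[k] Finsupp.supported k k
      {c : CellOf n s i | weightOf w (fun j => Finsupp.weight w (leadExp (f j))) c = μ}) := by
  have hone := one_mem_algPart f w
  have hmul : ∀ μ ν, ∀ a ∈ algPart f w μ, ∀ b ∈ algPart f w ν, a * b ∈ algPart f w (μ + ν) :=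
    fun _ _ _ ha _ hb => mul_mem_algPart f w ha hb
  have hε := eq_zero_of_augmentation_ne_zero (w := w) h₀
  have hετ : ∀ i, augmentation f h₀ (cls f (X i)) = 0 := augmentation_X f h₀
  have hεa : ∀ j p, augmentation f h₀ (diffQuotAt (fun i => cls f (X i)) 0 p (f j)) = 0 := by
    intro j p
    rw [map_diffQuotAt]
    simp only [hετ, Pi.zero_apply, map_zero]
    exact (diffQuotAt_zero p (f j)).trans (hlin j p)
  obtain ⟨ρ, hρ⟩ := exists_algPart_coaction hw
  obtain ⟨S, hS⟩ := nonempty_tateResolution (τ := fun i => cls f (X i))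
    (a := fun j p => diffQuotAt (fun i => cls f (X i)) 0 p (f j)) (w := w)
    (δ := fun j => Finsupp.weight w (leadExp (f j))) hone hmul hε (iSup_algPart f w) hρ hετ hεa
    (cls_X_mem_algPart f w)
    (fun j p => diffQuotAt_mem hone hmul (cls_X_mem_algPart f w) (fun i => zero_mem _) (hw j) p)
    (fun j => by
      rw [sum_diffQuotAt_mul_cls, cls_apply_eq_zero, h₀, map_zero, sub_zero])
    (fun q x hx hd => tateD_cls_exact hf hci h₀ hx hd) (ker_augmentation_le h₀)
  have : Subsingleton (CellOf n s 0) := ⟨fun c c' => Subtype.ext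
    ((Cell.degree_eq_zero.1 c.2).trans (Cell.degree_eq_zero.1 c'.2).symm)⟩
  let c₀ : CellOf n s 0 := ⟨(∅, 0), Cell.degree_eq_zero.2 rfl⟩
  -- Either resolution has a single generator in degree zero: the empty tensor, respectively the
  -- cell (∅, 0).
  let θ : HChain k (Alg f) 0 ≃ₗ[k] (CellOf n s 0 →₀ k) :=
    (PiTensorProduct.isEmptyEquiv (Fin 0)).trans (Finsupp.uniqueLinearEquiv k k c₀).symm
  have hθ : ∀ a, θ (PiTensorProduct.tprod k a) = Finsupp.single c₀ 1 := by
    intro a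
    refine (LinearEquiv.symm_apply_eq _).2 ?_
    refine (PiTensorProduct.isEmptyEquiv_apply_tprod (Fin 0) a).trans ?_
    simp
  have key := (barResolution (ε := augmentation f h₀) hone hmul hε).nonempty_homology_equiv_of_equiv
    S θ (fun μ v hv => ?_) (fun μ v hv => ?_) (fun i y => ?_) i μ
  · rw [barResolution_cycles] at key
    have h := barResolution_reduce (ε := augmentation f h₀) hone hmul hε i
    change Nonempty ((_ ⧸ ((hPart (algPart f w) (i + 1) μ).map (GradedFreeModule.reduce _ _
      (barD (augmentation f h₀) i))).submoduleOf _) ≃ₗ[k] _) at key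
    rw [h] at key
    exact key
  · refine map_mem_of_hPart θ.toLinearMap (fun a ν ha hν => ?_) hv
    rw [LinearEquiv.coe_coe, hθ]
    refine Finsupp.single_mem_supported k _ ?_
    rw [← hν]
    simp [weightOf, c₀]
  · change v ∈ Finsupp.supported k k _ at hv
    rw [Finsupp.supported_eq_span_single] at hv
    have : Submodule.span k ((fun c => Finsupp.single c (1 : k)) '' {c : CellOf n s 0 |
        weightOf w (fun j => Finsupp.weight w (leadExp (f j))) c = μ}) ≤
        (hPart (algPart f w) 0 μ).comap θ.symm.toLinearMap := by
      rw [Submodule.span_le]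
      rintro _ ⟨c, hc, rfl⟩
      have hc0 : c = c₀ := Subsingleton.elim _ _
      subst hc0
      rw [SetLike.mem_coe, Submodule.mem_comap]
      have h1 : θ.symm.toLinearMap (Finsupp.single c₀ 1) =
          PiTensorProduct.tprod k (fun i : Fin 0 => i.elim0) :=
        (LinearEquiv.symm_apply_eq _).2 (hθ _).symm
      have h2 : μ = 0 := by
        rw [← hc]
        simp [weightOf, c₀]
      refine h1 ▸ Submodule.subset_span ⟨_, fun i => i.elim0, fun i => i.elim0, ?_, rfl⟩
      rw [h2]
      rfl
    exact this hv
  · rw [hS]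
    exact reduce_tateDAt hone hmul hε hετ hεa i y

end HochschildHomology

/-! ### The generating function of the cells. -/

section CellCount

variable {n s : ℕ} {M : Type*} [AddCommMonoid M]

/-- The generators of homological degree `i`. -/
def cellFinset (n s i : ℕ) : Finset (Cell n s) :=
  ((Finset.univ : Finset (Finset (Fin n))) ×ˢ
    Fintype.piFinset fun _ : Fin s => Finset.range (i + 1)).filter fun c => c.degree = i

/-- In degree i no exponent exceeds i, so restricting the exponents to the range below i + 1 loses
no cell. -/
theorem mem_cellFinset {i : ℕ} {c : Cell n s} : c ∈ cellFinset n s i ↔ c.degree = i := by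
  simp only [cellFinset, Finset.mem_filter, Finset.mem_product, Finset.mem_univ, true_and,
    Fintype.mem_piFinset, Finset.mem_range, and_iff_right_iff_imp]
  intro h j
  have := Finset.single_le_sum (fun i _ => Nat.zero_le (c.2 i)) (Finset.mem_univ j)
  simp only [Cell.degree] at h
  omega

variable (w : Fin n → M) (δ : Fin s → M)

/-- The generating function of the generators `e_I t^{(l)}` with `l` supported in `J`. -/
noncomputable def cellSeries (J : Finset (Fin s)) : PowerSeries (AddMonoidAlgebra ℤ M) :=
  PowerSeries.mk fun i => ∑ c ∈ (cellFinset n s i).filter (fun c => ∀ j ∉ J, c.2 j = 0),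
    AddMonoidAlgebra.single (weightOf w δ c) 1

/-- Expanding the product over i amounts to choosing the set I of exterior variables. -/
theorem cellSeries_empty : cellSeries w δ ∅ =
    ∏ i, (1 + PowerSeries.C (AddMonoidAlgebra.single (w i) 1) * PowerSeries.X) := by
  rw [Finset.prod_one_add]
  ext1 i
  have h1 : ∀ I : Finset (Fin n), ∏ i ∈ I, (PowerSeries.C (AddMonoidAlgebra.single (w i) (1 : ℤ)) *
      PowerSeries.X) = PowerSeries.C (AddMonoidAlgebra.single (∑ i ∈ I, w i) (1 : ℤ)) *
        PowerSeries.X ^ I.card := by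
    intro I
    rw [Finset.prod_mul_distrib, Finset.prod_const, ← map_prod]
    congr 2
    induction I using Finset.induction_on with
    | empty => rfl
    | insert i I hi ih =>
      rw [Finset.prod_insert hi, Finset.sum_insert hi, ih, AddMonoidAlgebra.single_mul_single,
        one_mul]
  simp only [h1, map_sum, PowerSeries.coeff_C_mul, PowerSeries.coeff_X_pow, mul_ite, mul_one,
    mul_zero, cellSeries, PowerSeries.coeff_mk]
  rw [← Finset.sum_filter]
  refine Finset.sum_bij' (fun c _ => c.1) (fun I _ => (I, 0)) (fun c hc => ?_) (fun I hI => ?_)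
    (fun c hc => ?_) (fun I hI => rfl) (fun c hc => ?_)
  · simp only [Finset.mem_filter, mem_cellFinset, Finset.notMem_empty, not_false_eq_true,
      true_imp_iff, Cell.degree] at hc
    simp only [Finset.powerset_univ, Finset.mem_filter, Finset.mem_univ, true_and]
    rw [← hc.1]
    simp [hc.2]
  · simp only [Finset.mem_filter, mem_cellFinset, Cell.degree] at hI ⊢
    refine ⟨?_, fun _ _ => rfl⟩
    simpa using hI.2.symm
  · simp only [Finset.mem_filter, Finset.notMem_empty, not_false_eq_true, true_imp_iff] at hc
    exact Prod.ext rfl (funext fun j => (hc.2 j).symm)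
  · simp only [Finset.mem_filter, Finset.notMem_empty, not_false_eq_true, true_imp_iff] at hc
    simp [weightOf, hc.2]

/-- Cells with l_j = 0 are those of the smaller family; in the others, lowering l_j by one reaches
every cell of the larger family once, with degree reduced by 2 and weight by δ j. -/
theorem cellSeries_insert {J : Finset (Fin s)} {j : Fin s} (hj : j ∉ J) :
    cellSeries w δ (insert j J) *
      (1 - PowerSeries.C (AddMonoidAlgebra.single (δ j) 1) * PowerSeries.X ^ 2) =
      cellSeries w δ J := by
  rw [mul_sub, mul_one, sub_eq_iff_eq_add]
  ext1 i
  rw [map_add, mul_left_comm, PowerSeries.coeff_C_mul, PowerSeries.coeff_mul_X_pow']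
  simp only [cellSeries, PowerSeries.coeff_mk]
  rw [← Finset.sum_filter_add_sum_filter_not _ (fun c : Cell n s => c.2 j = 0)]
  congr 1
  · refine Finset.sum_congr ?_ fun _ _ => rfl
    ext c
    simp only [Finset.mem_filter, Finset.mem_insert, not_or, and_assoc]
    refine and_congr_right fun _ => ⟨fun h m hm => ?_, fun h => ⟨fun m hm => h m hm.2, h j hj⟩⟩
    by_cases hmj : m = j
    · exact hmj ▸ h.2
    · exact h.1 m ⟨hmj, hm⟩
  · split_ifs with hi
    · rw [Finset.mul_sum]
      refine Finset.sum_bij' (fun c _ => (c.1, Function.update c.2 j (c.2 j - 1)))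
        (fun c _ => (c.1, Function.update c.2 j (c.2 j + 1))) (fun c hc => ?_) (fun c hc => ?_)
        (fun c hc => ?_) (fun c hc => ?_) (fun c hc => ?_)
      · simp only [Finset.mem_filter, mem_cellFinset, Finset.mem_insert, not_or] at hc ⊢
        have h : c.degree = _ := (Cell.degree_pred c.1 hc.2).symm
        refine ⟨by omega, fun m hm => ?_⟩
        rw [Function.update_of_ne hm.1]
        exact hc.1.2 m hm
      · simp only [Finset.mem_filter, mem_cellFinset, Finset.mem_insert, not_or] at hc ⊢
        have h : _ = c.degree + 2 := Cell.degree_succ c.1 c.2 j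
        refine ⟨⟨by omega, fun m hm => ?_⟩, by simp⟩
        rw [Function.update_of_ne hm.1]
        exact hc.2 m hm
      · have h := (Finset.mem_filter.1 hc).2
        simp [Nat.sub_add_cancel (Nat.pos_of_ne_zero h)]
      · simp
      · have h := (Finset.mem_filter.1 hc).2
        rw [AddMonoidAlgebra.single_mul_single, one_mul, weightOf_pred c.1 h]
    · rw [mul_zero]
      refine Finset.sum_eq_zero fun c hc => ?_
      simp only [Finset.mem_filter, mem_cellFinset] at hc
      have h : c.degree = _ := (Cell.degree_pred c.1 hc.2).symm
      omega

theorem cellSeries_mul_prod (J : Finset (Fin s)) : cellSeries w δ J *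
    ∏ j ∈ J, (1 - PowerSeries.C (AddMonoidAlgebra.single (δ j) 1) * PowerSeries.X ^ 2) =
    ∏ i, (1 + PowerSeries.C (AddMonoidAlgebra.single (w i) 1) * PowerSeries.X) := by
  induction J using Finset.induction_on with
  | empty => rw [Finset.prod_empty, mul_one, cellSeries_empty]
  | insert j J hj ih => rw [Finset.prod_insert hj, ← mul_assoc, cellSeries_insert w δ hj, ih]

instance (i : ℕ) : Finite (CellOf n s i) :=
  Finite.of_injective (β := cellFinset n s i) (fun c => ⟨c.1, mem_cellFinset.2 c.2⟩)
    fun _ _ h => Subtype.ext (Subtype.mk.inj h)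

theorem coeff_cellSeries_univ (i : ℕ) (μ : M) :
    (PowerSeries.coeff i (cellSeries w δ Finset.univ)).coeff μ =
      (Nat.card {c : CellOf n s i | weightOf w δ c = μ} : ℤ) := by
  classical
  simp only [cellSeries, PowerSeries.coeff_mk, Finset.mem_univ, not_true_eq_false, false_imp_iff,
    implies_true, Finset.filter_true, AddMonoidAlgebra.coeff_sum, AddMonoidAlgebra.coeff_single,
    Finsupp.finsetSum_apply, Finsupp.single_apply]
  rw [Finset.sum_boole]
  congr 1
  rw [← Nat.card_eq_finsetCard]
  exact Nat.card_congr
    { toFun := fun c => ⟨⟨c.1, mem_cellFinset.1 (Finset.mem_filter.1 c.2).1⟩,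
        (Finset.mem_filter.1 c.2).2⟩
      invFun := fun c => ⟨c.1.1, Finset.mem_filter.2 ⟨mem_cellFinset.2 c.1.2, c.2⟩⟩
      left_inv := fun _ => rfl
      right_inv := fun _ => rfl }

end CellCount

/-! ### The Hilbert series and the conclusion. -/

variable {k : Type*} [Field k] {n s : ℕ} {M : Type*} [AddCommMonoid M]
  {f : Fin s → MvPolynomial (Fin n) k} {w : Fin n → M}

theorem hasHilbertSeries (hf : IsReducedGroebnerBasis f)
    (hci : IsCompleteIntersection (initialIdeal (Ideal.span (Set.range f))))
    (h₀ : ∀ j, constantCoeff (f j) = 0) (hlin : ∀ j p, coeff (Finsupp.single p 1) (f j) = 0)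
    (hw : ∀ j, IsWeightedHomogeneous w (f j) (Finsupp.weight w (leadExp (f j)))) :
    HasHilbertSeries f w h₀ := by
  have h : ∀ i μ, Nonempty (HH (augmentation f h₀) (algPart f w) i μ ≃ₗ[k]
      ({c : CellOf n s i | weightOf w (fun j => Finsupp.weight w (leadExp (f j))) c = μ} →₀ k)) :=
    fun i μ => (nonempty_HH_equiv hf hci h₀ hlin hw i μ).map fun e =>
      e.trans (Finsupp.supportedEquivFinsupp _)
  refine ⟨fun i μ => ?_, cellSeries w _ Finset.univ, fun i μ => ?_,
    cellSeries_mul_prod w _ Finset.univ⟩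
  · obtain ⟨e⟩ := h i μ
    exact Module.Finite.equiv e.symm
  · obtain ⟨e⟩ := h i μ
    have := Fintype.ofFinite
      {c : CellOf n s i | weightOf w (fun j => Finsupp.weight w (leadExp (f j))) c = μ}
    rw [coeff_cellSeries_univ, e.finrank_eq, Module.finrank_finsupp_self, Nat.card_eq_fintype_card]

end BachResolution

theorem theorem5p2 {k : Type*} [Field k] {n s : ℕ} (f : Fin s → MvPolynomial (Fin n) k)
    (hf : IsReducedGroebnerBasis f)
    (hci : IsCompleteIntersection (initialIdeal (Ideal.span (Set.range f)))) :
    IsFreeResolution (part (Env k (Alg f))) (diff f) (aug f) ∧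
    IsDGAlgebra (part (Env k (Alg f))) (diff f) (mul (Env k (Alg f))) (gen (Env k (Alg f)) ∅ 0) ∧
    (∀ (M : Type*) [AddCommMonoid M] (w : Fin n → M),
      (∀ j, IsWeightedHomogeneous w (f j) (Finsupp.weight w (leadExp (f j)))) →
        IsMultigraded f w) ∧
    (∀ h₀ : ∀ j, constantCoeff (f j) = 0,
      (IsMinimal f ↔ ∀ j p, coeff (Finsupp.single p 1) (f j) = 0) ∧
      ((∀ j p, coeff (Finsupp.single p 1) (f j) = 0) →
        ∀ (M : Type*) [AddCommMonoid M] (w : Fin n → M),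
          (∀ j, IsWeightedHomogeneous w (f j) (Finsupp.weight w (leadExp (f j)))) →
            HasHilbertSeries f w h₀)) := by
  exact ⟨isFreeResolution_diff hf hci, isDGAlgebra_diff f, fun M _ w hw => isMultigraded hw,
    fun h₀ => ⟨isMinimal_iff f h₀, fun hlin M _ w hw => hasHilbertSeries hf hci h₀ hlin hw⟩⟩
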